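/- Let $\mathcal F$ be a unital C*-algebra with a state $\omega$, let $(\pi_\omega,\mathcal H_\omega,\Omega_\omega)$ be its GNS representation, and let $\mathcal C\subset\pi_\omega(\mathcal F)'$ be a commutative von Neumann algebra on $\mathcal H_\omega$ with spectrum (character space) $X$ and Gelfand isomorphism $\Phi:\mathcal C\to C(X)$. Let $\mu$ be the regular Borel probability measure on $X$ with $\int_X\Phi(C)\,d\mu=\langle\Omega_\omega,C\,\Omega_\omega\rangle$ for all $C\in\mathcal C$. Let $e$ be the projection onto the closure of $\mathcal C\,\Omega_\omega$; for every $A\in\mathcal C'$ there is a unique $E(A)\in\mathcal C$ with $E(A)\,e=eAe$, and for $x\in X$ the formula $\psi_x(A)=\Phi(E(A))(x)$ defines a state $\psi_x$ of $\mathcal C'$, with GNS representation $(\pi_{\psi_x},\mathcal H_{\psi_x},\Omega_{\psi_x})$. A field $x\mapsto T_x\in\mathcal B(\mathcal H_{\psi_x})$ is called measurable if there is a sequence $(a_n)$ in the linear span of the fields $x\mapsto|\pi_{\psi_x}(A)\Omega_{\psi_x}\rangle\langle\pi_{\psi_x}(B)\Omega_{\psi_x}|$ $(A,B\in\mathcal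 C')$ such that $\|a_n(x)-T_x\|\to0$ for $\mu$-almost every $x$. **Theorem.** Let $\mathcal M$ be either $\mathcal C'$ or $\pi_\omega(\mathcal F)''\subset\mathcal C'$. A linear functional $\gamma$ on $\mathcal M$ is a normal state of $\mathcal M$ if and only if there are a measurable field $x\mapsto T_x$ of operators which for $\mu$-almost every $x$ are compact, positive, trace class and normalised ($\operatorname{Tr}T_x=1$), and a function $f\in L^1_+(X,\mu)$ with $\int_Xf\,d\mu=1$, such that for every $A\in\mathcal M$ the function $x\mapsto\operatorname{Tr}\big(\pi_{\psi_x}(A)\,T_x\big)f(x)$ is $\mu$-integrable and $$\gamma(A)=\int_X\operatorname{Tr}\big(\pi_{\psi_x}(A)\,T_x\big)\,f(x)\,d\mu(x).$$ -/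

import Mathlib

open scoped ComplexOrder

noncomputable section

open scoped InnerProductSpace Topology
open MeasureTheory Filter

namespace NormalDecomp

universe u

section Basics

variable {H : Type u} [NormedAddCommGroup H] [InnerProductSpace ℂ H] [CompleteSpace H]

/-- A von Neumann algebra is norm closed, hence a C*-algebra. -/
instance isClosed_vN (S : VonNeumannAlgebra H) :
    IsClosed (S.toStarSubalgebra : Set (H →L[ℂ] H)) := by
  have h : (S.toStarSubalgebra : Set (H →L[ℂ] H))
      = Set.centralizer (Set.centralizer (S.toStarSubalgebra : Set (H →L[ℂ] H))) :=
    S.centralizer_centralizer'.symm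
  rw [h]
  exact Set.isClosed_centralizer _

theorem mem_of_commute (S : VonNeumannAlgebra H) {x : H →L[ℂ] H}
    (h : ∀ y ∈ S.commutant, y * x = x * y) : x ∈ S.toStarSubalgebra := by
  have : x ∈ S.commutant.commutant := VonNeumannAlgebra.mem_commutant_iff.2 h
  rwa [VonNeumannAlgebra.commutant_commutant] at this

/-- On a von Neumann algebra the operator order (inherited from `B(H)`) is the order of the
C*-algebra: positive elements are those of the form `s* s` with `s` in the algebra. -/
instance starOrderedRing_vN (S : VonNeumannAlgebra H) : StarOrderedRing S.toStarSubalgebra := by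
  refine StarOrderedRing.of_nonneg_iff' (fun {x y} h z => ?_) (fun x => ⟨fun hx => ?_, ?_⟩)
  · exact add_le_add_right (α := H →L[ℂ] H) h z
  · have hx' : (0 : H →L[ℂ] H) ≤ (x : H →L[ℂ] H) := hx
    have hmem : CFC.sqrt (x : H →L[ℂ] H) ∈ S.toStarSubalgebra := by
      refine mem_of_commute S fun y hy => ?_
      have hc : Commute (x : H →L[ℂ] H) y := VonNeumannAlgebra.mem_commutant_iff.1 hy _ x.2
      exact (hc.cfcₙ_nnreal NNReal.sqrt).eq.symm
    refine ⟨⟨_, hmem⟩, Subtype.ext ?_⟩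
    have h1 : star (CFC.sqrt (x : H →L[ℂ] H)) = CFC.sqrt (x : H →L[ℂ] H) :=
      (IsSelfAdjoint.of_nonneg (CFC.sqrt_nonneg _)).star_eq
    change (x : H →L[ℂ] H) = star (CFC.sqrt (x : H →L[ℂ] H)) * CFC.sqrt (x : H →L[ℂ] H)
    rw [h1, CFC.sqrt_mul_sqrt_self _ hx']
  · rintro ⟨s, rfl⟩
    exact star_mul_self_nonneg (s : H →L[ℂ] H)

end Basics

/-- A commutative von Neumann algebra `alg` on `H` with a unit vector `vec` which is cyclic for
the commutant of `alg`. -/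
structure AbelianSystem (H : Type u) [NormedAddCommGroup H] [InnerProductSpace ℂ H]
    [CompleteSpace H] where
  alg : VonNeumannAlgebra H
  comm : ∀ a ∈ alg, ∀ b ∈ alg, a * b = b * a
  vec : H
  norm_vec : ‖vec‖ = 1
  cyclic : Dense {v : H | ∃ A ∈ alg.commutant, A vec = v}

namespace AbelianSystem

variable {H : Type u} [NormedAddCommGroup H] [InnerProductSpace ℂ H] [CompleteSpace H]
variable (D : AbelianSystem H)

/-- The commutative algebra, as a star subalgebra of `B(H)`. -/
abbrev C : StarSubalgebra ℂ (H →L[ℂ] H) := D.alg.toStarSubalgebra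

/-- Its commutant, as a star subalgebra of `B(H)`. -/
abbrev C' : StarSubalgebra ℂ (H →L[ℂ] H) := D.alg.commutant.toStarSubalgebra

instance : CommCStarAlgebra D.C :=
  { (inferInstance : CStarAlgebra D.C) with
    mul_comm := fun a b => Subtype.ext (D.comm _ a.2 _ b.2) }

/-- The spectrum of the commutative algebra. -/
abbrev X : Type u := WeakDual.characterSpace ℂ D.C

instance : MeasurableSpace D.X := borel _
instance : BorelSpace D.X := ⟨rfl⟩

/-- The operator in the algebra whose Gelfand transform is `g`. -/
def ofFun (g : C(D.X, ℝ)) : D.C :=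
  (gelfandStarTransform D.C).symm ⟨fun x => (g x : ℂ), by fun_prop⟩

theorem ofFun_apply (g : C(D.X, ℝ)) (x : D.X) : x (D.ofFun g) = g x := by
  have h := (gelfandStarTransform D.C).apply_symm_apply
    (⟨fun x => (g x : ℂ), by fun_prop⟩ : C(D.X, ℂ))
  exact congrArg (fun k : C(D.X, ℂ) => k x) h

theorem eq_of_forall {a b : D.C} (h : ∀ x : D.X, x a = x b) : a = b :=
  (gelfandStarTransform D.C).injective (ContinuousMap.ext h)

/-- The functional `g ↦ ⟨Ω, c Ω⟩`, where `c` is the operator with Gelfand transform `g`. -/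
def functional : CompactlySupportedContinuousMap D.X ℝ →ₚ[ℝ] ℝ :=
  PositiveLinearMap.mk₀
    { toFun := fun g => (⟪D.vec, (D.ofFun g.toContinuousMap : H →L[ℂ] H) D.vec⟫_ℂ).re
      map_add' := fun g h => by
        have : D.ofFun (g + h).toContinuousMap
            = D.ofFun g.toContinuousMap + D.ofFun h.toContinuousMap :=
          D.eq_of_forall fun x => by
            rw [map_add, ofFun_apply, ofFun_apply, ofFun_apply]
            exact Complex.ofReal_add _ _
        rw [this]
        simp
      map_smul' := fun r g => by
        have : D.ofFun (r • g).toContinuousMap = (r : ℂ) • D.ofFun g.toContinuousMap :=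
          D.eq_of_forall fun x => by
            rw [map_smul, ofFun_apply, ofFun_apply]
            exact Complex.ofReal_mul _ _
        rw [this]
        simp }
    (fun g hg => by
      have hg' : ∀ x, 0 ≤ g x := hg
      let s : C(D.X, ℝ) := ⟨fun x => Real.sqrt (g x), by fun_prop⟩
      have : D.ofFun g.toContinuousMap = star (D.ofFun s) * D.ofFun s :=
        D.eq_of_forall fun x => by
          rw [map_mul, map_star, ofFun_apply, ofFun_apply]
          change ((g x : ℝ) : ℂ) = star ((Real.sqrt (g x) : ℝ) : ℂ) * ((Real.sqrt (g x) : ℝ) : ℂ)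
          rw [Complex.star_def, Complex.conj_ofReal, ← Complex.ofReal_mul,
            Real.mul_self_sqrt (hg' x)]
      change 0 ≤ (⟪D.vec, (D.ofFun g.toContinuousMap : H →L[ℂ] H) D.vec⟫_ℂ).re
      rw [this]
      change 0 ≤ (⟪D.vec, (ContinuousLinearMap.adjoint (D.ofFun s : H →L[ℂ] H))
        ((D.ofFun s : H →L[ℂ] H) D.vec)⟫_ℂ).re
      rw [ContinuousLinearMap.adjoint_inner_right]
      exact inner_self_nonneg (𝕜 := ℂ))

/-- The measure on the spectrum attached to the vector state: the regular Borel measure with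
`∫ x(c) dμ(x) = ⟨Ω, c Ω⟩` for all `c` in the algebra. -/
def μ : Measure D.X := RealRMK.rieszMeasure D.functional

/-- The closed subspace generated by the vectors `c Ω`, with `c` in the algebra. -/
def K : Submodule ℂ H :=
  (D.C.toSubalgebra.toSubmodule.map
    ((ContinuousLinearMap.apply ℂ H D.vec : (H →L[ℂ] H) →L[ℂ] H) :
      (H →L[ℂ] H) →ₗ[ℂ] H)).topologicalClosure

instance : CompleteSpace D.K := (Submodule.isClosed_topologicalClosure _).completeSpace_coe

/-- The orthogonal projection onto the closed span of `c Ω`, with `c` in the algebra. -/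
def e : H →L[ℂ] H := D.K.starProjection

theorem mem_K {c : H →L[ℂ] H} (hc : c ∈ D.C) : c D.vec ∈ D.K :=
  Submodule.le_topologicalClosure _ ⟨c, hc, rfl⟩

theorem K_seq {v : H} (hv : v ∈ D.K) :
    ∃ c : ℕ → (H →L[ℂ] H), (∀ n, c n ∈ D.C) ∧ Tendsto (fun n => c n D.vec) atTop (𝓝 v) := by
  have hv' : v ∈ closure (((D.C.toSubalgebra.toSubmodule.map
    ((ContinuousLinearMap.apply ℂ H D.vec : (H →L[ℂ] H) →L[ℂ] H) :
      (H →L[ℂ] H) →ₗ[ℂ] H)) : Set H)) := hv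
  obtain ⟨w, hw, hlim⟩ := mem_closure_iff_seq_limit.1 hv'
  choose c hc hcw using hw
  refine ⟨c, hc, ?_⟩
  have : (fun n => c n D.vec) = w := funext fun n => hcw n
  rwa [this]

theorem K_ext {f g : H →L[ℂ] H} (h : ∀ c ∈ D.C, f (c D.vec) = g (c D.vec)) {v : H}
    (hv : v ∈ D.K) : f v = g v := by
  obtain ⟨c, hc, hlim⟩ := D.K_seq hv
  have h1 := (f.continuous.tendsto v).comp hlim
  have h2 := (g.continuous.tendsto v).comp hlim
  refine tendsto_nhds_unique h1 (h2.congr fun n => ?_)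
  exact (h _ (hc n)).symm

theorem K_zero {z : H} (hz : z ∈ D.K) (h : ∀ d ∈ D.C, ⟪d D.vec, z⟫_ℂ = 0) : z = 0 := by
  obtain ⟨c, hc, hlim⟩ := D.K_seq hz
  have h1 : Tendsto (fun n => ⟪c n D.vec, z⟫_ℂ) atTop (𝓝 ⟪z, z⟫_ℂ) :=
    hlim.inner tendsto_const_nhds
  simp only [h _ (hc _)] at h1
  exact inner_self_eq_zero.1 (tendsto_nhds_unique tendsto_const_nhds h1).symm

theorem e_mem (v : H) : D.e v ∈ D.K := Submodule.starProjection_apply_mem _ v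

theorem e_of_mem {v : H} (hv : v ∈ D.K) : D.e v = v :=
  Submodule.starProjection_eq_self_iff.2 hv

theorem e_inner (v w : H) : ⟪D.e v, w⟫_ℂ = ⟪v, D.e w⟫_ℂ :=
  Submodule.inner_starProjection_left_eq_right _ v w

theorem e_star : star D.e = D.e := (isStarProjection_starProjection (U := D.K)).isSelfAdjoint.star_eq

theorem star_inner (A : H →L[ℂ] H) (v w : H) : ⟪(star A) v, w⟫_ℂ = ⟪v, A w⟫_ℂ :=
  ContinuousLinearMap.adjoint_inner_left A w v

theorem star_inner' (A : H →L[ℂ] H) (v w : H) : ⟪v, (star A) w⟫_ℂ = ⟪A v, w⟫_ℂ :=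
  ContinuousLinearMap.adjoint_inner_right A v w

theorem comm_app {A c : H →L[ℂ] H} (hA : A ∈ D.C') (hc : c ∈ D.C) (v : H) :
    A (c v) = c (A v) :=
  (congrArg (fun T : H →L[ℂ] H => T v) (VonNeumannAlgebra.mem_commutant_iff.1 hA c hc)).symm

theorem C_sub {c : H →L[ℂ] H} (hc : c ∈ D.C) : c ∈ D.C' :=
  VonNeumannAlgebra.mem_commutant_iff.2 fun g hg => D.comm g hg c hc

theorem K_inv {c : H →L[ℂ] H} (hc : c ∈ D.C) {v : H} (hv : v ∈ D.K) : c v ∈ D.K := by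
  obtain ⟨d, hd, hlim⟩ := D.K_seq hv
  have h1 := (c.continuous.tendsto v).comp hlim
  refine (Submodule.isClosed_topologicalClosure _).mem_of_tendsto h1 (Eventually.of_forall ?_)
  intro n
  exact D.mem_K (mul_mem hc (hd n))

theorem e_mem_C' : D.e ∈ D.C' := by
  refine VonNeumannAlgebra.mem_commutant_iff.2 fun c hc => ?_
  ext v
  change c (D.e v) = D.e (c v)
  symm
  refine Submodule.eq_starProjection_of_mem_of_inner_eq_zero (D.K_inv hc (D.e_mem v)) ?_
  intro w hw
  have hs : (star c) w ∈ D.K := D.K_inv (star_mem hc) hw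
  have h0 := D.K.starProjection_inner_eq_zero v _ hs
  rw [star_inner'] at h0
  rw [← h0, map_sub]
  rfl

/-- If `cₙ Ω → e A Ω` then `cₙ* Ω → e A* Ω`. -/
theorem star_seq {A : H →L[ℂ] H} (hA : A ∈ D.C') {c : ℕ → (H →L[ℂ] H)} (hc : ∀ n, c n ∈ D.C)
    (hlim : Tendsto (fun n => c n D.vec) atTop (𝓝 (D.e (A D.vec)))) :
    Tendsto (fun n => (star (c n)) D.vec) atTop (𝓝 (D.e ((star A) D.vec))) := by
  have hnorm : ∀ a ∈ D.C, ‖(star a) D.vec‖ = ‖a D.vec‖ := by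
    intro a ha
    have h1 : ⟪(star a) D.vec, (star a) D.vec⟫_ℂ = ⟪a D.vec, a D.vec⟫_ℂ := by
      rw [star_inner, ← star_inner' a]
      exact congrArg (fun T : H →L[ℂ] H => ⟪D.vec, T D.vec⟫_ℂ) (D.comm a ha _ (star_mem ha))
    rw [@norm_eq_sqrt_re_inner ℂ, h1, ← @norm_eq_sqrt_re_inner ℂ]
  have hcau : CauchySeq fun n => (star (c n)) D.vec := by
    have h := hlim.cauchySeq
    rw [Metric.cauchySeq_iff] at h ⊢
    intro ε hε
    obtain ⟨N, hN⟩ := h ε hε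
    refine ⟨N, fun m hm n hn => ?_⟩
    have := hN m hm n hn
    rw [dist_eq_norm] at this ⊢
    have h2 := hnorm (c m - c n) (sub_mem (hc m) (hc n))
    rw [star_sub] at h2
    simpa [h2] using h2.trans_lt (by simpa using this)
  obtain ⟨w, hw⟩ := cauchySeq_tendsto_of_complete hcau
  have hwK : w ∈ D.K := (Submodule.isClosed_topologicalClosure _).mem_of_tendsto hw
    (Eventually.of_forall fun n => D.mem_K (star_mem (hc n)))
  have hinner : ∀ d ∈ D.C, ⟪d D.vec, w⟫_ℂ = ⟪d D.vec, D.e ((star A) D.vec)⟫_ℂ := by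
    intro d hd
    have h1 : Tendsto (fun n => ⟪d D.vec, (star (c n)) D.vec⟫_ℂ) atTop (𝓝 ⟪d D.vec, w⟫_ℂ) :=
      tendsto_const_nhds.inner hw
    have h2 : Tendsto (fun n => ⟪c n D.vec, (star d) D.vec⟫_ℂ) atTop
        (𝓝 ⟪D.e (A D.vec), (star d) D.vec⟫_ℂ) := hlim.inner tendsto_const_nhds
    have h3 : ∀ n, ⟪c n D.vec, (star d) D.vec⟫_ℂ = ⟪d D.vec, (star (c n)) D.vec⟫_ℂ := by
      intro n
      rw [star_inner', star_inner']
      exact congrArg (fun T : H →L[ℂ] H => ⟪T D.vec, D.vec⟫_ℂ) (D.comm d hd _ (hc n))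
    rw [tendsto_nhds_unique h1 (h2.congr h3), e_inner, D.e_of_mem (D.mem_K (star_mem hd)),
      ← e_inner, D.e_of_mem (D.mem_K hd), star_inner', star_inner', D.comm_app hA hd]
  have : w = D.e ((star A) D.vec) := by
    have hz : w - D.e ((star A) D.vec) ∈ D.K := D.K.sub_mem hwK (D.e_mem _)
    refine sub_eq_zero.1 (D.K_zero hz fun d hd => ?_)
    rw [inner_sub_right, hinner d hd, sub_self]
  rwa [this] at hw

/-- The compressions `e A e`, `e B e` commute. -/
theorem compress_comm {A B : H →L[ℂ] H} (hA : A ∈ D.C') (hB : B ∈ D.C') :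
    (D.e * A * D.e) * (D.e * B * D.e) = (D.e * B * D.e) * (D.e * A * D.e) := by
  have key : ∀ d ∈ D.C, ⟪d (D.e ((star A) D.vec)), D.e (B D.vec)⟫_ℂ
      = ⟪D.e ((star B) D.vec), (star d) (D.e (A D.vec))⟫_ℂ := by
    intro d hd
    obtain ⟨c, hc, hlim⟩ := D.K_seq (D.e_mem (A D.vec))
    have hs := D.star_seq hA hc hlim
    have h1 : Tendsto (fun n => ⟪d ((star (c n)) D.vec), D.e (B D.vec)⟫_ℂ) atTop
        (𝓝 ⟪d (D.e ((star A) D.vec)), D.e (B D.vec)⟫_ℂ) :=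
      ((d.continuous.tendsto _).comp hs).inner tendsto_const_nhds
    have h2 : Tendsto (fun n => ⟪D.e ((star B) D.vec), (star d) (c n D.vec)⟫_ℂ) atTop
        (𝓝 ⟪D.e ((star B) D.vec), (star d) (D.e (A D.vec))⟫_ℂ) :=
      tendsto_const_nhds.inner (((star d).continuous.tendsto _).comp hlim)
    refine tendsto_nhds_unique h1 (h2.congr fun n => ?_)
    have m1 : d * star (c n) ∈ D.C := mul_mem hd (star_mem (hc n))
    have m2 : star d * c n ∈ D.C := mul_mem (star_mem hd) (hc n)
    have e1 : D.e ((star d) (c n D.vec)) = (star d) (c n D.vec) := D.e_of_mem (D.mem_K m2)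
    have e2 : D.e (d ((star (c n)) D.vec)) = d ((star (c n)) D.vec) := D.e_of_mem (D.mem_K m1)
    rw [e_inner, e1, ← e_inner, e2, star_inner, D.comm_app hB (star_mem hd),
      D.comm_app hB (hc n), star_inner', ← star_inner (c n)]
    congr 1
    exact congrArg (fun T : H →L[ℂ] H => T D.vec) (D.comm _ (star_mem (hc n)) d hd)
  have key2 : ∀ d ∈ D.C, ⟪d D.vec, A (D.e (B D.vec))⟫_ℂ = ⟪d D.vec, B (D.e (A D.vec))⟫_ℂ := by
    intro d hd
    have h := key d hd
    rw [star_inner', ← D.comm_app D.e_mem_C' hd, ← D.comm_app D.e_mem_C' hd,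
      ← D.comm_app (star_mem hA) hd, ← D.comm_app (star_mem hB) hd, e_inner, e_inner,
      star_inner, star_inner] at h
    have i1 : D.e (D.e (B D.vec)) = D.e (B D.vec) := D.e_of_mem (D.e_mem _)
    have i2 : D.e (D.e (A D.vec)) = D.e (A D.vec) := D.e_of_mem (D.e_mem _)
    rwa [i1, i2] at h
  have key3 : D.e (A (D.e (B D.vec))) = D.e (B (D.e (A D.vec))) := by
    have hz := D.K.sub_mem (D.e_mem (A (D.e (B D.vec)))) (D.e_mem (B (D.e (A D.vec))))
    refine sub_eq_zero.1 (D.K_zero hz fun d hd => ?_)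
    rw [inner_sub_right, ← e_inner, ← e_inner, D.e_of_mem (D.mem_K hd), key2 d hd, sub_self]
  ext v
  have hee : ∀ w, D.e (D.e w) = D.e w := fun w => D.e_of_mem (D.e_mem w)
  change D.e (A (D.e (D.e (B (D.e v))))) = D.e (B (D.e (D.e (A (D.e v)))))
  rw [hee, hee]
  refine D.K_ext (f := D.e * A * D.e * B) (g := D.e * B * D.e * A) (fun c hc => ?_) (D.e_mem v)
  change D.e (A (D.e (B (c D.vec)))) = D.e (B (D.e (A (c D.vec))))
  rw [D.comm_app hB hc, D.comm_app hA hc, D.comm_app D.e_mem_C' hc, D.comm_app D.e_mem_C' hc,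
    D.comm_app hB hc, D.comm_app hA hc, D.comm_app D.e_mem_C' hc, D.comm_app D.e_mem_C' hc, key3]

theorem vec_mem : D.vec ∈ D.K := D.mem_K (one_mem _)

theorem compress_vec (A : H →L[ℂ] H) : (D.e * A * D.e) D.vec = D.e (A D.vec) := by
  change D.e (A (D.e D.vec)) = _
  rw [D.e_of_mem D.vec_mem]

/-- A square root `R` of `e B* B e` commuting with all compressions. -/
theorem exists_root {B : H →L[ℂ] H} (hB : B ∈ D.C') :
    ∃ R : H →L[ℂ] H, star R = R ∧ R * R = D.e * (star B * B) * D.e ∧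
      ∀ A ∈ D.C', R * (D.e * A * D.e) = (D.e * A * D.e) * R := by
  have hpos : 0 ≤ D.e * (star B * B) * D.e := by
    have := star_mul_self_nonneg (B * D.e)
    rw [star_mul, e_star] at this
    simpa [mul_assoc] using this
  refine ⟨CFC.sqrt (D.e * (star B * B) * D.e),
    (IsSelfAdjoint.of_nonneg (CFC.sqrt_nonneg _)).star_eq, CFC.sqrt_mul_sqrt_self _ hpos,
    fun A hA => ?_⟩
  have hc : Commute (D.e * (star B * B) * D.e) (D.e * A * D.e) :=
    D.compress_comm (mul_mem (star_mem hB) hB) hA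
  exact (hc.cfcₙ_nnreal NNReal.sqrt).eq

theorem root_inner {B R : H →L[ℂ] H} (hs : star R = R)
    (hR : R * R = D.e * (star B * B) * D.e) {v w : H} (hv : v ∈ D.K) (hw : w ∈ D.K) :
    ⟪B v, B w⟫_ℂ = ⟪R v, R w⟫_ℂ := by
  have h1 : ⟪R v, R w⟫_ℂ = ⟪v, (R * R) w⟫_ℂ := by
    conv_lhs => rw [← hs]
    rw [star_inner, hs]
    rfl
  rw [h1, hR]
  change _ = ⟪v, D.e ((star B) (B (D.e w)))⟫_ℂ
  rw [← e_inner, star_inner', D.e_of_mem hv, D.e_of_mem hw]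

theorem dense_range : DenseRange fun B : D.C' => (B : H →L[ℂ] H) D.vec := by
  refine D.cyclic.mono ?_
  rintro v ⟨A, hA, rfl⟩
  exact ⟨⟨A, hA⟩, rfl⟩

/-- The map `c ↦ c e` is injective on the algebra. -/
theorem cutdown_injective {c d : H →L[ℂ] H} (hc : c ∈ D.C) (hd : d ∈ D.C)
    (h : c * D.e = d * D.e) : c = d := by
  have hv : c D.vec = d D.vec := by
    have := congrArg (fun T : H →L[ℂ] H => T D.vec) h
    change c (D.e D.vec) = d (D.e D.vec) at this
    rwa [D.e_of_mem D.vec_mem] at this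
  have := D.dense_range.equalizer c.continuous d.continuous (funext fun B => ?_)
  · exact ContinuousLinearMap.ext fun v => congrFun this v
  · change c ((B : H →L[ℂ] H) D.vec) = d ((B : H →L[ℂ] H) D.vec)
    rw [← D.comm_app B.2 hc, ← D.comm_app B.2 hd, hv]

/-- Every compression `e A e` of an element `A` of the commutant is of the form `c e` for some
`c` in the algebra. -/
theorem exists_cutdown {A : H →L[ℂ] H} (hA : A ∈ D.C') :
    ∃ c ∈ D.C, c * D.e = D.e * A * D.e := by
  let f : D.C' →ₗ[ℂ] H :=
    ((ContinuousLinearMap.apply ℂ H D.vec : (H →L[ℂ] H) →L[ℂ] H) :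
      (H →L[ℂ] H) →ₗ[ℂ] H) ∘ₗ D.C'.toSubalgebra.toSubmodule.subtype
  let g : D.C' →ₗ[ℂ] H :=
    ((ContinuousLinearMap.apply ℂ H (D.e (A D.vec)) : (H →L[ℂ] H) →L[ℂ] H) :
      (H →L[ℂ] H) →ₗ[ℂ] H) ∘ₗ D.C'.toSubalgebra.toSubmodule.subtype
  have hf : ∀ B : D.C', f B = (B : H →L[ℂ] H) D.vec := fun _ => rfl
  have hg : ∀ B : D.C', g B = (B : H →L[ℂ] H) (D.e (A D.vec)) := fun _ => rfl
  have hbound : ∃ k : ℝ, ∀ B, ‖g B‖ ≤ k * ‖f B‖ := by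
    refine ⟨‖D.e * A * D.e‖, fun B => ?_⟩
    obtain ⟨R, hs, hR, hcomm⟩ := D.exists_root B.2
    have hn : ∀ v ∈ D.K, ‖(B : H →L[ℂ] H) v‖ = ‖R v‖ := by
      intro v hv
      rw [@norm_eq_sqrt_re_inner ℂ, D.root_inner hs hR hv hv, ← @norm_eq_sqrt_re_inner ℂ]
    rw [hf, hg, hn _ (D.e_mem _), hn _ D.vec_mem, ← D.compress_vec A]
    have := congrArg (fun T : H →L[ℂ] H => T D.vec) (hcomm A hA)
    change R ((D.e * A * D.e) D.vec) = (D.e * A * D.e) (R D.vec) at this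
    rw [this]
    exact ContinuousLinearMap.le_opNorm _ _
  have hdense : DenseRange f := D.dense_range
  let c : H →L[ℂ] H := g.extendOfNorm f
  have hc : ∀ B ∈ D.C', c (B D.vec) = B (D.e (A D.vec)) := fun B hB =>
    g.extendOfNorm_eq hdense hbound ⟨B, hB⟩
  have hcC : c ∈ D.C := by
    refine mem_of_commute D.alg fun B hB => ?_
    have := D.dense_range.equalizer (B * c).continuous (c * B).continuous (funext fun B' => ?_)
    · exact ContinuousLinearMap.ext fun v => congrFun this v
    · change B (c ((B' : H →L[ℂ] H) D.vec)) = c (B ((B' : H →L[ℂ] H) D.vec))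
      rw [hc _ B'.2]
      exact (hc (B * B') (mul_mem hB B'.2)).symm
  refine ⟨c, hcC, ContinuousLinearMap.ext fun v => ?_⟩
  change c (D.e v) = D.e (A (D.e v))
  refine D.K_ext (f := c) (g := D.e * A) (fun d hd => ?_) (D.e_mem v)
  change c (d D.vec) = D.e (A (d D.vec))
  rw [hc d (D.C_sub hd), D.comm_app hA hd, D.comm_app D.e_mem_C' hd]

/-- The map sending `A` in the commutant to the unique `c` in the algebra with `c e = e A e`. -/
def E (A : D.C') : D.C :=
  ⟨(D.exists_cutdown A.2).choose, (D.exists_cutdown A.2).choose_spec.1⟩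

theorem E_spec (A : D.C') : (D.E A : H →L[ℂ] H) * D.e = D.e * A * D.e :=
  (D.exists_cutdown A.2).choose_spec.2

theorem E_unique {A : D.C'} {c : D.C} (h : (c : H →L[ℂ] H) * D.e = D.e * A * D.e) :
    D.E A = c :=
  Subtype.ext (D.cutdown_injective (D.E A).2 c.2 ((D.E_spec A).trans h.symm))

/-- The map `E` is linear. -/
def Elin : D.C' →ₗ[ℂ] D.C where
  toFun := D.E
  map_add' A B := D.E_unique (by
    change ((D.E A : H →L[ℂ] H) + D.E B) * D.e = D.e * (A + B) * D.e
    rw [add_mul, E_spec, E_spec, mul_add, add_mul])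
  map_smul' r A := D.E_unique (by
    change (r • (D.E A : H →L[ℂ] H)) * D.e = D.e * (r • (A : H →L[ℂ] H)) * D.e
    rw [smul_mul_assoc, E_spec, mul_smul_comm, smul_mul_assoc])

theorem E_nonneg {A : D.C'} (hA : 0 ≤ A) : 0 ≤ D.E A := by
  have hA' : (0 : H →L[ℂ] H) ≤ (A : H →L[ℂ] H) := hA
  change (0 : H →L[ℂ] H) ≤ (D.E A : H →L[ℂ] H)
  have hbase : ∀ B ∈ D.C', 0 ≤ ⟪(D.E A : H →L[ℂ] H) (B D.vec), B D.vec⟫_ℂ := by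
    intro B hB
    obtain ⟨R, hs, hR, hcomm⟩ := D.exists_root hB
    have h1 : (D.E A : H →L[ℂ] H) D.vec = D.e ((A : H →L[ℂ] H) D.vec) := by
      have := congrArg (fun T : H →L[ℂ] H => T D.vec) (D.E_spec A)
      change (D.E A : H →L[ℂ] H) (D.e D.vec) = (D.e * A * D.e) D.vec at this
      rwa [D.e_of_mem D.vec_mem, D.compress_vec] at this
    have h2 := congrArg (fun T : H →L[ℂ] H => T D.vec) (hcomm A A.2)
    change R ((D.e * A * D.e) D.vec) = D.e ((A : H →L[ℂ] H) (D.e (R D.vec))) at h2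
    rw [← D.comm_app hB (D.E A).2, h1, D.root_inner hs hR (D.e_mem _) D.vec_mem,
      ← D.compress_vec, h2, e_inner]
    have h3 := (ContinuousLinearMap.nonneg_iff_isPositive _).1 hA'
    exact h3.inner_nonneg_left _
  have hall : ∀ v : H, 0 ≤ ⟪(D.E A : H →L[ℂ] H) v, v⟫_ℂ := by
    intro v
    have hcl : IsClosed {v : H | 0 ≤ ⟪(D.E A : H →L[ℂ] H) v, v⟫_ℂ} :=
      isClosed_le continuous_const (by fun_prop)
    refine hcl.closure_subset_iff.2 ?_ (D.dense_range v)
    rintro _ ⟨B, rfl⟩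
    exact hbase B B.2
  rw [ContinuousLinearMap.nonneg_iff_isPositive, ContinuousLinearMap.isPositive_iff_complex]
  intro v
  have := hall v
  rw [RCLike.nonneg_iff] at this
  refine ⟨?_, this.1⟩
  exact Complex.ext rfl this.2.symm

/-- The states `ψ_x` of the commutant: `ψ_x(A)` is the value at `x` of the Gelfand transform
of the element `c` of the algebra with `c e = e A e`. -/
def ψ (x : D.X) : D.C' →ₚ[ℂ] ℂ :=
  PositiveLinearMap.mk₀
    { toFun := fun A => x (D.E A)
      map_add' := fun A B => by
        rw [show D.E (A + B) = D.E A + D.E B from D.Elin.map_add A B, map_add]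
      map_smul' := fun r A => by
        rw [show D.E (r • A) = r • D.E A from D.Elin.map_smul r A, map_smul]; rfl }
    (fun A hA => by
      change 0 ≤ x (D.E A)
      obtain ⟨s, hs⟩ := CStarAlgebra.nonneg_iff_eq_star_mul_self.1 (D.E_nonneg hA)
      rw [hs, map_mul, map_star]
      exact star_mul_self_nonneg _)

theorem ψ_apply (x : D.X) (A : D.C') : D.ψ x A = x (D.E A) := rfl

/-- The GNS space `H_{ψ_x}`. -/
abbrev fiber (x : D.X) : Type u := (D.ψ x).GNS

/-- The GNS representation `π_{ψ_x}` of the commutant. -/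
abbrev π (x : D.X) : D.C' →⋆ₐ[ℂ] (D.fiber x →L[ℂ] D.fiber x) := (D.ψ x).gnsStarAlgHom

/-- The GNS vector `Ω_{ψ_x}`. -/
def Ω (x : D.X) : D.fiber x := ((D.ψ x).toPreGNS 1 : (D.ψ x).PreGNS)

/-- The sections `x ↦ a(x)` with `a(x)` a bounded operator on `H_{ψ_x}`. -/
abbrev OperatorField : Type u := (x : D.X) → (D.fiber x →L[ℂ] D.fiber x)

/-- The linear span of the sections `x ↦ |π_{ψ_x}(A) Ω_{ψ_x}⟩⟨π_{ψ_x}(B) Ω_{ψ_x}|`, with `A`, `B`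
in the commutant. Its uniform closure is the algebra of continuous sections of the field of the
algebras of compact operators on the `H_{ψ_x}`. -/
def elementaryFields : Submodule ℂ D.OperatorField :=
  Submodule.span ℂ {a | ∃ A B : D.C', a = fun x =>
    InnerProductSpace.rankOne ℂ (D.π x A (D.Ω x)) (D.π x B (D.Ω x))}

/-- A section `x ↦ T_x` is a `μ`-measurable field of (compact) operators when it is `μ`-almost
everywhere the norm limit of a sequence of elementary (continuous) fields. -/
def IsMeasurableField (T : D.OperatorField) : Prop :=
  ∃ a : ℕ → D.OperatorField, (∀ n, a n ∈ D.elementaryFields) ∧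
    ∀ᵐ x ∂D.μ, Tendsto (fun n => a n x) atTop (𝓝 (T x))

end AbelianSystem

section TraceClass

variable (K : Type u) [NormedAddCommGroup K] [InnerProductSpace ℂ K] [CompleteSpace K]

/-- The index set of a fixed Hilbert basis of `K`. -/
def basisIndex : Set K := (exists_hilbertBasis ℂ K).choose

/-- A fixed Hilbert basis of `K`. -/
def basis : HilbertBasis (basisIndex K) ℂ K := (exists_hilbertBasis ℂ K).choose_spec.choose

variable {K}

/-- `T` is trace class: the sum of the `⟨b, |T| b⟩`, over a Hilbert basis, is finite. -/
def IsTraceClass (T : K →L[ℂ] K) : Prop :=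
  Summable fun i => ‖⟪basis K i, CFC.abs T (basis K i)⟫_ℂ‖

/-- The trace: the sum of the `⟨b, T b⟩` over a Hilbert basis. -/
def trace (T : K →L[ℂ] K) : ℂ := ∑' i, ⟪basis K i, T (basis K i)⟫_ℂ

end TraceClass

section States

variable {H : Type u} [NormedAddCommGroup H] [InnerProductSpace ℂ H] [CompleteSpace H]

/-- A state: a positive linear functional with value `1` at the unit. -/
def IsState (S : VonNeumannAlgebra H) (γ : S.toStarSubalgebra →ₗ[ℂ] ℂ) : Prop :=
  (∀ A, 0 ≤ γ (star A * A)) ∧ γ 1 = 1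

/-- A functional is normal when it preserves the suprema of increasing nets of self-adjoint
elements (equivalently, of nonempty upward directed sets of such elements). -/
def IsNormal (S : VonNeumannAlgebra H) (γ : S.toStarSubalgebra →ₗ[ℂ] ℂ) : Prop :=
  ∀ (M : Set S.toStarSubalgebra) (a : S.toStarSubalgebra), (∀ s ∈ M, IsSelfAdjoint s) →
    M.Nonempty → DirectedOn (· ≤ ·) M → IsLUB M a → IsLUB (γ '' M) (γ a)

/-- A normal state of a von Neumann algebra. -/
def IsNormalState (S : VonNeumannAlgebra H) (γ : S.toStarSubalgebra →ₗ[ℂ] ℂ) : Prop :=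
  IsState S γ ∧ IsNormal S γ

end States

namespace AbelianSystem

variable {H : Type u} [NormedAddCommGroup H] [InnerProductSpace ℂ H] [CompleteSpace H]
variable (D : AbelianSystem H)

/-- `γ(A) = ∫ Tr(π_{ψ_x}(A) T_x) f(x) dμ(x)` for all `A` in `S`, where `S` is a von Neumann
algebra contained in the commutant, the integrand being integrable. -/
def IsDecomposition {S : VonNeumannAlgebra H} (hS : S.toStarSubalgebra ≤ D.C')
    (γ : S.toStarSubalgebra →ₗ[ℂ] ℂ) (T : D.OperatorField) (f : D.X → ℝ) : Prop :=
  ∀ A : S.toStarSubalgebra,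
    Integrable (fun x => trace (D.π x (StarSubalgebra.inclusion hS A) * T x) * (f x : ℂ)) D.μ ∧
      γ A = ∫ x, trace (D.π x (StarSubalgebra.inclusion hS A) * T x) * (f x : ℂ) ∂D.μ

/-- `T` is a measurable field which almost everywhere consists of compact, trace class, positive
operators of trace one. -/
def IsDensityField (T : D.OperatorField) : Prop :=
  D.IsMeasurableField T ∧
    ∀ᵐ x ∂D.μ, IsCompactOperator (T x) ∧ IsTraceClass (T x) ∧ 0 ≤ T x ∧ trace (T x) = 1

/-- `f` belongs to the positive part of `L¹(X, μ)` and has integral one. -/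
def IsDensity (f : D.X → ℝ) : Prop :=
  Integrable f D.μ ∧ (∀ᵐ x ∂D.μ, 0 ≤ f x) ∧ ∫ x, f x ∂D.μ = 1

end AbelianSystem

section GNS

variable {F : Type u} [CStarAlgebra F] [PartialOrder F] [StarOrderedRing F] (ω : F →ₚ[ℂ] ℂ)

/-- The GNS vector `Ω_ω`. -/
def gnsVec : ω.GNS := (ω.toPreGNS 1 : ω.PreGNS)

theorem gns_apply_vec (a : F) : ω.gnsStarAlgHom a (gnsVec ω) = (ω.toPreGNS a : ω.PreGNS) := by
  change ω.gnsNonUnitalStarAlgHom a ((ω.toPreGNS 1 : ω.PreGNS) : ω.GNS) = _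
  rw [PositiveLinearMap.gnsNonUnitalStarAlgHom_apply_coe]
  simp

/-- The von Neumann algebra `π_ω(F)''`. -/
def gnsVN : VonNeumannAlgebra ω.GNS where
  toStarSubalgebra := StarSubalgebra.centralizer ℂ
    (StarSubalgebra.centralizer ℂ (Set.range ω.gnsStarAlgHom) : Set (ω.GNS →L[ℂ] ω.GNS))
  centralizer_centralizer' := by
    simp

theorem mem_gnsVN {A : ω.GNS →L[ℂ] ω.GNS} : A ∈ (gnsVN ω).toStarSubalgebra ↔
    ∀ B : ω.GNS →L[ℂ] ω.GNS, (∀ a : F, ω.gnsStarAlgHom a * B = B * ω.gnsStarAlgHom a) →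
      B * A = A * B := by
  have hmem : ∀ B : ω.GNS →L[ℂ] ω.GNS,
      B ∈ StarSubalgebra.centralizer ℂ (Set.range ω.gnsStarAlgHom) ↔
        ∀ a : F, ω.gnsStarAlgHom a * B = B * ω.gnsStarAlgHom a := by
    intro B
    rw [StarSubalgebra.mem_centralizer_iff]
    refine ⟨fun h a => (h _ ⟨a, rfl⟩).1, ?_⟩
    rintro h _ ⟨a, rfl⟩
    refine ⟨h a, ?_⟩
    rw [← map_star]
    exact h (star a)
  change A ∈ StarSubalgebra.centralizer ℂ _ ↔ _
  rw [StarSubalgebra.mem_centralizer_iff]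
  refine ⟨fun h B hB => (h B ((hmem B).2 hB)).1, fun h B hB => ⟨h B ((hmem B).1 hB), ?_⟩⟩
  exact h _ ((hmem _).1 (star_mem (SetLike.mem_coe.1 hB)))

/-- The data obtained from a state `ω` and a commutative von Neumann algebra in `π_ω(F)'`. -/
def gnsSystem (hω : ω 1 = 1) (𝒞 : VonNeumannAlgebra ω.GNS)
    (hcomm : ∀ a ∈ 𝒞, ∀ b ∈ 𝒞, a * b = b * a)
    (h𝒞 : ∀ c ∈ 𝒞, ∀ a : F, ω.gnsStarAlgHom a * c = c * ω.gnsStarAlgHom a) :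
    AbelianSystem ω.GNS where
  alg := 𝒞
  comm := hcomm
  vec := gnsVec ω
  norm_vec := by
    have h : ‖ω.toPreGNS 1‖ = 1 := by
      rw [PositiveLinearMap.preGNS_norm_def]
      simp [hω]
    exact (UniformSpace.Completion.norm_coe _).trans h
  cyclic := by
    refine Dense.mono ?_ (UniformSpace.Completion.denseRange_coe (α := ω.PreGNS))
    rintro _ ⟨v, rfl⟩
    refine ⟨ω.gnsStarAlgHom (ω.ofPreGNS v), ?_, gns_apply_vec ω _⟩
    exact VonNeumannAlgebra.mem_commutant_iff.2 fun c hc => (h𝒞 c hc _).symm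

theorem gnsVN_le (hω : ω 1 = 1) (𝒞 : VonNeumannAlgebra ω.GNS)
    (hcomm : ∀ a ∈ 𝒞, ∀ b ∈ 𝒞, a * b = b * a)
    (h𝒞 : ∀ c ∈ 𝒞, ∀ a : F, ω.gnsStarAlgHom a * c = c * ω.gnsStarAlgHom a) :
    (gnsVN ω).toStarSubalgebra ≤ (gnsSystem ω hω 𝒞 hcomm h𝒞).C' := fun _ hA =>
  VonNeumannAlgebra.mem_commutant_iff.2 fun c hc => (mem_gnsVN ω).1 hA c (h𝒞 c hc)

end GNS

end NormalDecomp

end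

/-! Write Ω for the cyclic vector, S for the algebra carrying γ (any von Neumann algebra inside the
commutant, which covers both cases), and `vf A x` for the vector of A in the GNS space over x. The
link between H and the fibres is `integral_ψ`: the vector state of Ω on the commutant is the
μ-average of the states ψ_x. Hence ∫ ‖`vf A x`‖² dμ = ‖AΩ‖². By `vf_incl_mul`, an element c of the
abelian algebra acts over x as the scalar x(c), so elementary fields form a *-algebra stable under
multiplication by continuous functions.

From a normal state to fields: an exhaustion argument (`exists_eq_sumVecFunctional`) writes γ as a
sum of vector functionals ⟨ζ_n, · ζ_n⟩ with ∑ ‖ζ_n‖² = 1. Approximating ζ_n geometrically fast by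
vectors AΩ makes the corresponding sections converge almost everywhere (`exists_vector_sections`),
to v_n say, and ⟨ζ_n, a ζ_n⟩ becomes the integral of ⟨v_n(x), π_x(a) v_n(x)⟩. One takes f = ∑ ‖v_n‖²
and T = f⁻¹ ∑ |v_n⟩⟨v_n|, with the projection onto the GNS vector where f vanishes. T is measurable
because measurable scalar coefficients are almost everywhere limits of continuous ones.

From fields to a normal state: positivity and normalisation hold fibrewise; normality is the point.
It suffices that γ is a norm limit of finite sums of functionals ⟨ξ, · η⟩, since bounded increasing
nets converge strongly (`IsUltraweak.isNormal`). If elementary fields a_k converge to T, the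
elementary fields p_n = 1 - (1 - ∑_{k<n} c_k a_k a_k*)^n, with small c_k > 0, form an approximate
unit: (1 - p_n)T^(1/2) tends to 0 in Hilbert-Schmidt norm almost everywhere. This norm is at most 1,
so by dominated convergence T may be replaced by p_n T p_n* with an error small in the norm of
functionals. The trace against p_n T p_n* is a finite sum of terms g(x) ψ_x(B* a C) with g
integrable; replacing g by a continuous function in L¹ turns each into a vector functional
(`exists_vector_approx`). -/

noncomputable section

open scoped InnerProductSpace Topology
open MeasureTheory Filter

namespace NormalDecomp

universe u

/-! ### Hilbert-Schmidt operators, traces, and strong convergence of powers. -/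

section HilbertSchmidt

open scoped ENNReal
open ContinuousLinearMap

variable {K : Type u} [NormedAddCommGroup K] [InnerProductSpace ℂ K] [CompleteSpace K]

/-- The squared Hilbert-Schmidt norm. -/
def hsSq (X : K →L[ℂ] K) : ℝ≥0∞ := ∑' i, ‖X (basis K i)‖ₑ ^ 2

theorem hasSum_norm_inner_sq (v : K) : HasSum (fun i => ‖⟪basis K i, v⟫_ℂ‖ ^ 2) (‖v‖ ^ 2) := by
  have h := (basis K).hasSum_inner_mul_inner v v
  have h2 := Complex.hasSum_re h
  convert h2 using 1
  · funext i
    have h3 := inner_mul_symm_re_eq_norm (𝕜 := ℂ) v (basis K i)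
    rw [norm_mul, norm_inner_symm v, ← sq] at h3
    exact h3.symm
  · rw [← inner_self_eq_norm_sq (𝕜 := ℂ) v]; rfl

theorem tsum_enorm_inner_sq (v : K) : ∑' i, ‖⟪basis K i, v⟫_ℂ‖ₑ ^ 2 = ‖v‖ₑ ^ 2 := by
  have h := hasSum_norm_inner_sq v
  have h2 := ENNReal.ofReal_tsum_of_nonneg (fun i => sq_nonneg ‖⟪basis K i, v⟫_ℂ‖) h.summable
  rw [h.tsum_eq] at h2
  simpa only [ENNReal.ofReal_pow (norm_nonneg _), ofReal_norm] using h2.symm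

/-- Both sides are the double sum of the squared matrix entries, taken in the two orders; in `ℝ≥0∞`
the exchange needs no convergence hypothesis. -/
theorem hsSq_star (X : K →L[ℂ] K) : hsSq (star X) = hsSq X := by
  unfold hsSq
  simp_rw [← tsum_enorm_inner_sq ((star X) _), ← tsum_enorm_inner_sq (X _)]
  rw [ENNReal.tsum_comm]
  refine tsum_congr fun i => tsum_congr fun j => ?_
  rw [star_eq_adjoint, adjoint_inner_right, ← enorm_norm, norm_inner_symm, enorm_norm]

theorem hsSq_mul_le (B X : K →L[ℂ] K) : hsSq (B * X) ≤ ‖B‖ₑ ^ 2 * hsSq X := by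
  unfold hsSq
  rw [← ENNReal.tsum_mul_left]
  refine ENNReal.tsum_le_tsum fun i => ?_
  rw [← mul_pow]
  gcongr
  exact B.le_opENorm _

theorem hsSq_mul_le' (X B : K →L[ℂ] K) : hsSq (X * B) ≤ ‖B‖ₑ ^ 2 * hsSq X := by
  rw [← hsSq_star, star_mul, ← hsSq_star X]
  refine (hsSq_mul_le _ _).trans_eq ?_
  rw [← enorm_norm, norm_star, enorm_norm]

theorem hsSq_mul_ne_top (B : K →L[ℂ] K) {X : K →L[ℂ] K} (hX : hsSq X ≠ ⊤) :
    hsSq (B * X) ≠ ⊤ :=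
  ((hsSq_mul_le B X).trans_lt (ENNReal.mul_lt_top (by simp) hX.lt_top)).ne

theorem hsSq_mul_ne_top' {X : K →L[ℂ] K} (B : K →L[ℂ] K) (hX : hsSq X ≠ ⊤) :
    hsSq (X * B) ≠ ⊤ :=
  ((hsSq_mul_le' X B).trans_lt (ENNReal.mul_lt_top (by simp) hX.lt_top)).ne

/-- The Hilbert-Schmidt norm, which is zero by convention where it should be infinite. -/
def hsNorm (X : K →L[ℂ] K) : ℝ := √(hsSq X).toReal

theorem hsNorm_nonneg (X : K →L[ℂ] K) : 0 ≤ hsNorm X := Real.sqrt_nonneg _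

theorem hsNorm_sq (X : K →L[ℂ] K) : hsNorm X ^ 2 = (hsSq X).toReal :=
  Real.sq_sqrt ENNReal.toReal_nonneg

theorem summable_of_hsSq {X : K →L[ℂ] K} (hX : hsSq X ≠ ⊤) :
    Summable fun i => ‖X (basis K i)‖ ^ 2 := by
  have := ENNReal.summable_toReal hX
  simpa using this

theorem hsSq_toReal (X : K →L[ℂ] K) : (hsSq X).toReal = ∑' i, ‖X (basis K i)‖ ^ 2 := by
  unfold hsSq
  rw [ENNReal.tsum_toReal_eq (by simp)]
  simp

theorem hsNorm_star (X : K →L[ℂ] K) : hsNorm (star X) = hsNorm X := by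
  rw [hsNorm, hsSq_star, hsNorm]

theorem hsNorm_mul_le (B : K →L[ℂ] K) {X : K →L[ℂ] K} (hX : hsSq X ≠ ⊤) :
    hsNorm (B * X) ≤ ‖B‖ * hsNorm X := by
  have h := ENNReal.toReal_mono (ENNReal.mul_lt_top (by simp) hX.lt_top).ne (hsSq_mul_le B X)
  rw [ENNReal.toReal_mul, ENNReal.toReal_pow, toReal_enorm, ← hsNorm_sq, ← hsNorm_sq,
    ← mul_pow] at h
  exact le_of_sq_le_sq h (mul_nonneg (norm_nonneg _) (hsNorm_nonneg _))

theorem inner_mul_basis (X Y : K →L[ℂ] K) (v w : K) :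
    ⟪v, (X * Y) w⟫_ℂ = ⟪(star X) v, Y w⟫_ℂ := by
  rw [star_eq_adjoint, adjoint_inner_left]; rfl

theorem summable_norm_mul {X Y : K →L[ℂ] K} (hX : hsSq X ≠ ⊤) (hY : hsSq Y ≠ ⊤) :
    Summable (fun i => ‖(star X) (basis K i)‖ * ‖Y (basis K i)‖) ∧
      ∑' i, ‖(star X) (basis K i)‖ * ‖Y (basis K i)‖ ≤ hsNorm X * hsNorm Y := by
  have hX' : hsSq (star X) ≠ ⊤ := by rwa [hsSq_star]
  have h := Real.summable_and_inner_le_Lp_mul_Lq_tsum_of_nonneg (p := 2) (q := 2) Real.HolderConjugate.two_two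
    (f := fun i => ‖(star X) (basis K i)‖) (g := fun i => ‖Y (basis K i)‖)
    (fun _ => norm_nonneg _) (fun _ => norm_nonneg _)
    (by simpa using summable_of_hsSq hX') (by simpa using summable_of_hsSq hY)
  refine ⟨h.1, h.2.trans_eq ?_⟩
  rw [← hsNorm_star, hsNorm, hsNorm, hsSq_toReal, hsSq_toReal, Real.sqrt_eq_rpow,
    Real.sqrt_eq_rpow]
  simp

theorem summable_trace_mul {X Y : K →L[ℂ] K} (hX : hsSq X ≠ ⊤) (hY : hsSq Y ≠ ⊤) :
    Summable fun i => ⟪basis K i, (X * Y) (basis K i)⟫_ℂ :=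
  .of_norm_bounded (summable_norm_mul hX hY).1 fun i => by
    rw [inner_mul_basis]; exact norm_inner_le_norm _ _

theorem norm_trace_mul_le {X Y : K →L[ℂ] K} (hX : hsSq X ≠ ⊤) (hY : hsSq Y ≠ ⊤) :
    ‖trace (X * Y)‖ ≤ hsNorm X * hsNorm Y := by
  refine (tsum_of_norm_bounded (summable_norm_mul hX hY).1.hasSum fun i => ?_).trans
    (summable_norm_mul hX hY).2
  rw [inner_mul_basis]; exact norm_inner_le_norm _ _

/-- Expanded in the basis, each trace is a double sum of products of matrix entries. The sum
converges absolutely because |st| ≤ |s|² + |t|², so the order can be exchanged. -/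
theorem trace_mul_comm {X Y : K →L[ℂ] K} (hX : hsSq X ≠ ⊤) (hY : hsSq Y ≠ ⊤) :
    trace (X * Y) = trace (Y * X) := by
  have hsum : ∀ {Z : K →L[ℂ] K}, hsSq Z ≠ ⊤ →
      Summable fun q : basisIndex K × basisIndex K =>
        ‖⟪basis K q.2, Z (basis K q.1)⟫_ℂ‖ ^ 2 := by
    intro Z hZ
    have : ∑' q : basisIndex K × basisIndex K, ‖⟪basis K q.2, Z (basis K q.1)⟫_ℂ‖ₑ ^ 2 ≠ ⊤ := by
      rw [ENNReal.tsum_prod (f := fun i j => ‖⟪basis K j, Z (basis K i)⟫_ℂ‖ₑ ^ 2)]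
      simp_rw [tsum_enorm_inner_sq]
      exact hZ
    simpa using ENNReal.summable_toReal this
  have hexp : ∀ X Y : K →L[ℂ] K, trace (X * Y)
      = ∑' i, ∑' j, ⟪basis K i, X (basis K j)⟫_ℂ * ⟪basis K j, Y (basis K i)⟫_ℂ := by
    intro X Y
    refine tsum_congr fun i => ?_
    rw [inner_mul_basis, ← (basis K).tsum_inner_mul_inner]
    refine tsum_congr fun j => ?_
    rw [star_eq_adjoint, adjoint_inner_left]
  rw [hexp, hexp Y X, Summable.tsum_comm]
  · exact tsum_congr fun i => tsum_congr fun j => mul_comm _ _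
  · refine .of_norm_bounded ((hsum hX).add ((Equiv.prodComm _ _).summable_iff.2 (hsum hY)))
      fun q => ?_
    change ‖_ * _‖ ≤ ‖⟪basis K q.2, X (basis K q.1)⟫_ℂ‖ ^ 2
      + ‖⟪basis K q.1, Y (basis K q.2)⟫_ℂ‖ ^ 2
    rw [norm_mul]
    have := two_mul_le_add_sq ‖⟪basis K q.2, X (basis K q.1)⟫_ℂ‖ ‖⟪basis K q.1, Y (basis K q.2)⟫_ℂ‖
    have := mul_nonneg (norm_nonneg ⟪basis K q.2, X (basis K q.1)⟫_ℂ)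
      (norm_nonneg ⟪basis K q.1, Y (basis K q.2)⟫_ℂ)
    linarith

/-- Finiteness is not needed: when the sum diverges, `toReal` of `⊤` and the `tsum` of a
non-summable family are both zero. -/
theorem trace_star_mul_self {X : K →L[ℂ] K} :
    trace (star X * X) = ((hsSq X).toReal : ℂ) := by
  rw [hsSq_toReal, Complex.ofReal_tsum]
  refine tsum_congr fun i => ?_
  rw [inner_mul_basis, star_star, inner_self_eq_norm_sq_to_K]
  simp

theorem trace_add {A B : K →L[ℂ] K}
    (hA : Summable fun i => ⟪basis K i, A (basis K i)⟫_ℂ)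
    (hB : Summable fun i => ⟪basis K i, B (basis K i)⟫_ℂ) :
    trace (A + B) = trace A + trace B := by
  unfold trace
  rw [← hA.tsum_add hB]
  exact tsum_congr fun i => inner_add_right _ _ _

theorem trace_sub {A B : K →L[ℂ] K}
    (hA : Summable fun i => ⟪basis K i, A (basis K i)⟫_ℂ)
    (hB : Summable fun i => ⟪basis K i, B (basis K i)⟫_ℂ) :
    trace (A - B) = trace A - trace B := by
  unfold trace
  rw [← hA.tsum_sub hB]
  exact tsum_congr fun i => inner_sub_right _ _ _

theorem hasSum_trace_rankOne (u v : K) :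
    HasSum (fun i => ⟪basis K i, InnerProductSpace.rankOne ℂ u v (basis K i)⟫_ℂ) ⟪v, u⟫_ℂ := by
  refine ((basis K).hasSum_inner_mul_inner v u).congr_fun fun i => ?_
  rw [InnerProductSpace.rankOne_apply, inner_smul_right]

theorem trace_rankOne (u v : K) : trace (InnerProductSpace.rankOne ℂ u v) = ⟪v, u⟫_ℂ :=
  (hasSum_trace_rankOne u v).tsum_eq

theorem trace_sum_rankOne {ι : Type*} (s : Finset ι) (u v : ι → K) :
    trace (∑ j ∈ s, InnerProductSpace.rankOne ℂ (u j) (v j)) = ∑ j ∈ s, ⟪v j, u j⟫_ℂ := by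
  refine (HasSum.congr_fun (hasSum_sum fun j (_ : j ∈ s) => hasSum_trace_rankOne (u j) (v j))
    fun i => ?_).tsum_eq
  rw [_root_.sum_apply, inner_sum]

/-- The square root of a positive trace class operator is a Hilbert-Schmidt operator. -/
theorem hsSq_sqrt {T : K →L[ℂ] K} (hT : 0 ≤ T) (h : IsTraceClass T) :
    hsSq (CFC.sqrt T) ≠ ⊤ ∧ ((hsSq (CFC.sqrt T)).toReal : ℂ) = trace T := by
  have hs : star (CFC.sqrt T) = CFC.sqrt T := (IsSelfAdjoint.of_nonneg (CFC.sqrt_nonneg _)).star_eq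
  have hTT : star (CFC.sqrt T) * CFC.sqrt T = T := by rw [hs, CFC.sqrt_mul_sqrt_self T hT]
  refine ⟨?_, by rw [← trace_star_mul_self, hTT]⟩
  have h' : Summable fun i => ‖CFC.sqrt T (basis K i)‖ ^ 2 := by
    refine h.congr fun i => ?_
    rw [CFC.abs_of_nonneg T hT]
    conv_lhs => rw [← hTT]
    rw [inner_mul_basis, star_star, inner_self_eq_norm_sq_to_K]
    simp
  have := h'.tsum_ofReal_ne_top
  simpa only [hsSq, ENNReal.ofReal_pow (norm_nonneg _), ofReal_norm] using this

/-- Dominated convergence for the series over the basis, with majorant C²‖S b_i‖²: a factor S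
upgrades bounded strong convergence to Hilbert-Schmidt convergence. -/
theorem tendsto_hsNorm_mul {S : K →L[ℂ] K} (hS : hsSq S ≠ ⊤) {A : ℕ → K →L[ℂ] K} {C : ℝ}
    (hC : ∀ n, ‖A n‖ ≤ C) (h : ∀ v, Tendsto (fun n => A n (S v)) atTop (𝓝 0)) :
    Tendsto (fun n => hsNorm (A n * S)) atTop (𝓝 0) := by
  have : Tendsto (fun n => ∑' i, ‖(A n * S) (basis K i)‖ ^ 2) atTop (𝓝 (∑' _ : basisIndex K, 0)) := by
    refine tendsto_tsum_of_dominated_convergence ((summable_of_hsSq hS).mul_left (C ^ 2))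
      (fun i => ?_) (Eventually.of_forall fun n i => ?_)
    · simpa using ((h (basis K i)).norm.pow 2)
    · rw [Real.norm_of_nonneg (sq_nonneg _), ← mul_pow]
      have := ((A n).le_opNorm (S (basis K i))).trans
        (mul_le_mul_of_nonneg_right (hC n) (norm_nonneg _))
      exact pow_le_pow_left₀ (norm_nonneg _) this 2
  simp_rw [← hsSq_toReal] at this
  rw [tsum_zero] at this
  simpa [hsNorm] using this.sqrt

/-- Powers of `1 - G` converge strongly to zero on the orthogonal complement of the kernel. -/
theorem tendsto_one_sub_pow {G : K →L[ℂ] K} (h0 : 0 ≤ G) (h1 : G ≤ 1) {w : K}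
    (hw : w ∈ (G.ker)ᗮ) : Tendsto (fun n => ((1 - G) ^ n : K →L[ℂ] K) w) atTop (𝓝 0) := by
  have hsa : IsSelfAdjoint G := .of_nonneg h0
  have hspec : ∀ t ∈ spectrum ℝ G, 0 ≤ t ∧ t ≤ 1 := fun t ht =>
    ⟨spectrum_nonneg_of_nonneg h0 ht, by
      have := (le_algebraMap_iff_spectrum_le (r := (1 : ℝ)) (a := G)).1 (by simpa using h1)
      exact this t ht⟩
  have hc : ∀ n, (1 - G) ^ n = cfc (fun t : ℝ => (1 - t) ^ n) G := by
    intro n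
    rw [cfc_pow (fun t : ℝ => 1 - t) n G, cfc_sub (fun _ : ℝ => (1 : ℝ)) (fun t => t) G,
      cfc_const_one ℝ G, cfc_id' ℝ G]
  have hn1 : ∀ n, ‖(1 - G) ^ n‖ ≤ 1 := by
    intro n
    rw [hc]
    refine norm_cfc_le zero_le_one fun t ht => ?_
    obtain ⟨ht0, ht1⟩ := hspec t ht
    rw [Real.norm_of_nonneg (pow_nonneg (by linarith) _)]
    exact pow_le_one₀ (by linarith) (by linarith)
  have hn2 : ∀ n : ℕ, ‖(1 - G) ^ n * G‖ ≤ 1 / (n + 1) := by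
    intro n
    have : (1 - G) ^ n * G = cfc (fun t : ℝ => (1 - t) ^ n * t) G := by
      rw [cfc_mul (fun t : ℝ => (1 - t) ^ n) (fun t => t) G, ← hc, cfc_id' ℝ G]
    rw [this]
    refine norm_cfc_le (by positivity) fun t ht => ?_
    obtain ⟨ht0, ht1⟩ := hspec t ht
    have hp : 0 ≤ (1 - t) ^ n := pow_nonneg (by linarith) _
    rw [Real.norm_of_nonneg (mul_nonneg hp ht0), le_div_iff₀ (by positivity)]
    -- Bernoulli bounds 1 + nt by (1 + t)^n, and (1 - t)^n (1 + t)^n = (1 - t²)^n ≤ 1; together they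
    -- give (1 - t)^n t ≤ 1/(n + 1).
    have hb := one_add_mul_le_pow (a := t) (by linarith) n
    have hq : (1 - t) ^ n * (1 + t) ^ n ≤ 1 := by
      rw [← mul_pow]
      exact pow_le_one₀ (by nlinarith) (by nlinarith)
    have hq' : (1 - t) ^ n * (1 + n * t) ≤ 1 :=
      (mul_le_mul_of_nonneg_left hb hp).trans hq
    have : (1 - t) ^ n * t * (n + 1) = (1 - t) ^ n * (1 + n * t) - (1 - t) ^ n * (1 - t) := by ring
    nlinarith [mul_nonneg hp (sub_nonneg.2 ht1)]
  -- G is self-adjoint, so the complement of its kernel is the closure of its range. Hence w is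
  -- close to some G u, where the bound on (1 - G)^n G applies; the remainder is handled by ‖(1 -
  -- G)^n‖ ≤ 1.
  have hcl : w ∈ closure (Set.range G) := by
    have : (G.ker)ᗮ = (LinearMap.range (G : K →ₗ[ℂ] K)).topologicalClosure := by
      have h := ContinuousLinearMap.orthogonal_ker G
      rw [h, ← star_eq_adjoint, hsa.star_eq]
    rw [this] at hw
    exact hw
  rw [Metric.tendsto_atTop]
  intro ε hε
  obtain ⟨_, ⟨u, rfl⟩, hu⟩ := Metric.mem_closure_iff.1 hcl (ε / 2) (by positivity)
  have hlim : Tendsto (fun n : ℕ => 1 / ((n : ℝ) + 1) * ‖u‖) atTop (𝓝 (0 * ‖u‖)) :=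
    tendsto_one_div_add_atTop_nhds_zero_nat.mul_const _
  rw [zero_mul] at hlim
  obtain ⟨N, hN⟩ := eventually_atTop.1 (hlim.eventually_lt_const (show 0 < ε / 2 by positivity))
  refine ⟨N, fun n hn => ?_⟩
  rw [dist_zero_right]
  have hsplit : ((1 - G) ^ n : K →L[ℂ] K) w = ((1 - G) ^ n : K →L[ℂ] K) (w - G u) + ((1 - G) ^ n * G : K →L[ℂ] K) u := by
    rw [map_sub]; simp
  rw [hsplit]
  have e1 : ‖((1 - G) ^ n : K →L[ℂ] K) (w - G u)‖ < ε / 2 := by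
    refine ((le_opNorm _ _).trans (mul_le_of_le_one_left (norm_nonneg _) (hn1 n))).trans_lt ?_
    rwa [← dist_eq_norm]
  have e2 : ‖((1 - G) ^ n * G : K →L[ℂ] K) u‖ < ε / 2 :=
    ((le_opNorm _ _).trans (mul_le_mul_of_nonneg_right (hn2 n) (norm_nonneg _))).trans_lt (hN n hn)
  exact (norm_add_le _ _).trans_lt (by linarith)

end HilbertSchmidt

/-! ### Increasing nets in a von Neumann algebra and continuity of functionals along them. -/

section MonotoneConvergence

open ContinuousLinearMap

variable {H : Type u} [NormedAddCommGroup H] [InnerProductSpace ℂ H] [CompleteSpace H]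

omit [CompleteSpace H] in
theorem nonneg_iff_inner (X : H →L[ℂ] H) : 0 ≤ X ↔ ∀ v, 0 ≤ ⟪X v, v⟫_ℂ := by
  rw [nonneg_iff_isPositive, isPositive_iff_complex]
  refine forall_congr' fun v => ?_
  refine ⟨fun h => ?_, fun h => ⟨Complex.ext rfl h.2, h.1⟩⟩
  rw [← h.1]
  exact Complex.zero_le_real.2 h.2

/-- With X = R*R, one has ‖R*Rv‖² ≤ ‖R‖²‖Rv‖². This turns convergence of the quadratic forms of a
monotone net into strong convergence. -/
theorem norm_apply_sq_le {X : H →L[ℂ] H} (hX : 0 ≤ X) (v : H) :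
    ‖X v‖ ^ 2 ≤ ‖X‖ * (⟪X v, v⟫_ℂ).re := by
  obtain ⟨R, rfl⟩ := CStarAlgebra.nonneg_iff_eq_star_mul_self.1 hX
  have h1 : (⟪(star R * R) v, v⟫_ℂ).re = ‖R v‖ ^ 2 := by
    rw [star_eq_adjoint]
    change (⟪(adjoint R) (R v), v⟫_ℂ).re = _
    rw [adjoint_inner_left]
    exact inner_self_eq_norm_sq (𝕜 := ℂ) _
  rw [h1, CStarRing.norm_star_mul_self, ← sq, ← mul_pow]
  refine pow_le_pow_left₀ (norm_nonneg _) ?_ 2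
  exact ((star R).le_opNorm (R v)).trans_eq (by rw [norm_star])

variable (S : VonNeumannAlgebra H)

theorem vN_nonneg_iff {S : VonNeumannAlgebra H} (x : S.toStarSubalgebra) :
    0 ≤ x ↔ ∀ v, 0 ≤ ⟪(x : H →L[ℂ] H) v, v⟫_ℂ :=
  nonneg_iff_inner (x : H →L[ℂ] H)

theorem vN_le_iff {S : VonNeumannAlgebra H} (x y : S.toStarSubalgebra) :
    x ≤ y ↔ ∀ v, ⟪(x : H →L[ℂ] H) v, v⟫_ℂ ≤ ⟪(y : H →L[ℂ] H) v, v⟫_ℂ := by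
  rw [← sub_nonneg, vN_nonneg_iff]
  refine forall_congr' fun v => ?_
  rw [← sub_nonneg (b := ⟪(x : H →L[ℂ] H) v, v⟫_ℂ), ← inner_sub_left]
  rfl

theorem vN_apply_sq_le {S : VonNeumannAlgebra H} {x : S.toStarSubalgebra} (hx : 0 ≤ x) (v : H) :
    ‖(x : H →L[ℂ] H) v‖ ^ 2 ≤ ‖x‖ * (⟪(x : H →L[ℂ] H) v, v⟫_ℂ).re :=
  norm_apply_sq_le (X := (x : H →L[ℂ] H)) hx v

/-- Bounded increasing nets in a von Neumann algebra converge strongly to their supremum, which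
belongs to the algebra. -/
theorem exists_isLUB_tendsto {S : VonNeumannAlgebra H} {M : Set S.toStarSubalgebra}
    (hne : M.Nonempty)
    (hdir : DirectedOn (· ≤ ·) M) {b : S.toStarSubalgebra} (hb : b ∈ upperBounds M) :
    ∃ a : S.toStarSubalgebra, IsLUB M a ∧
      ∀ v, Tendsto (fun s : M => ((s : S.toStarSubalgebra) : H →L[ℂ] H) v) atTop
        (𝓝 ((a : H →L[ℂ] H) v)) := by
  have : IsDirectedOrder M := directedOn_iff_isDirectedOrder.1 hdir
  have : Nonempty M := hne.to_subtype
  obtain ⟨s₀, hs₀⟩ := hne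
  let g : M → (H →L[ℂ] H) := fun s => ((s : S.toStarSubalgebra) : H →L[ℂ] H)
  have hbd : ∀ s : M, s₀ ≤ s → ‖(s : S.toStarSubalgebra) - s₀‖ ≤ ‖b - s₀‖ := fun s hs =>
    CStarAlgebra.norm_le_norm_of_nonneg_of_le (sub_nonneg.2 hs) (sub_le_sub_right (hb s.2) _)
  have hconv : ∀ v, ∃ w, Tendsto (fun s : M => g s v) atTop (𝓝 w) := by
    intro v
    refine cauchy_map_iff_exists_tendsto.1 ?_
    have hmono : Monotone fun s : M => (⟪g s v, v⟫_ℂ).re := fun s t hst =>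
      ((vN_le_iff _ _).1 hst v).1
    have hbdd : BddAbove (Set.range fun s : M => (⟪g s v, v⟫_ℂ).re) :=
      ⟨(⟪(b : H →L[ℂ] H) v, v⟫_ℂ).re, by
        rintro _ ⟨s, rfl⟩; exact ((vN_le_iff _ _).1 (hb s.2) v).1⟩
    have hl := tendsto_atTop_ciSup hmono hbdd
    set L := ⨆ s : M, (⟪g s v, v⟫_ℂ).re
    have hle : ∀ s : M, (⟪g s v, v⟫_ℂ).re ≤ L := le_ciSup hbdd
    rw [Metric.cauchy_iff]
    refine ⟨inferInstance, fun ε hε => ?_⟩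
    -- C bounds the norm of every difference t - s₂ with t ≥ s₂ ≥ s₀; the `+ 1` makes it positive,
    -- so that the threshold (ε/2)²/C makes sense.
    set C := ‖b - s₀‖ + 1
    have hC : 0 < C := by positivity
    have hδ : 0 < (ε / 2) ^ 2 / C := by positivity
    obtain ⟨s₁, hs₁⟩ := (hl.eventually (lt_mem_nhds (sub_lt_self L hδ))).exists
    obtain ⟨s₂, h02, h12⟩ := exists_ge_ge (⟨s₀, hs₀⟩ : M) s₁
    have key : ∀ t : M, s₂ ≤ t → ‖g t v - g s₂ v‖ < ε / 2 := by
      intro t ht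
      have hpos : 0 ≤ (t : S.toStarSubalgebra) - s₂ := sub_nonneg.2 ht
      have h1 := vN_apply_sq_le hpos v
      have h2 : ‖(t : S.toStarSubalgebra) - s₂‖ ≤ C := by
        have : ‖(t : S.toStarSubalgebra) - s₂‖ ≤ ‖b - s₀‖ :=
          CStarAlgebra.norm_le_norm_of_nonneg_of_le hpos (sub_le_sub (hb t.2) h02)
        exact this.trans (by simp [C])
      have h3 : (⟪(((t : S.toStarSubalgebra) - s₂ : S.toStarSubalgebra) : H →L[ℂ] H) v, v⟫_ℂ).re
          = (⟪g t v, v⟫_ℂ).re - (⟪g s₂ v, v⟫_ℂ).re := by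
        rw [← Complex.sub_re, ← inner_sub_left]; rfl
      rw [h3] at h1
      have h4 : (⟪g t v, v⟫_ℂ).re - (⟪g s₂ v, v⟫_ℂ).re < (ε / 2) ^ 2 / C := by
        have := hle t
        have := hmono h12
        simp only at this
        linarith
      have h5 : 0 ≤ (⟪g t v, v⟫_ℂ).re - (⟪g s₂ v, v⟫_ℂ).re := by
        have := hmono ht
        simp only at this
        linarith
      have h6 : ‖g t v - g s₂ v‖ ^ 2 < (ε / 2) ^ 2 := by
        refine lt_of_le_of_lt (h1.trans (mul_le_mul_of_nonneg_right h2 h5)) ?_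
        rwa [lt_div_iff₀ hC, mul_comm] at h4
      exact lt_of_pow_lt_pow_left₀ 2 (by positivity) h6
    refine ⟨(fun s : M => g s v) '' Set.Ici s₂, image_mem_map (mem_atTop s₂), ?_⟩
    rintro _ ⟨t, ht, rfl⟩ _ ⟨t', ht', rfl⟩
    have := dist_triangle_right (g t v) (g t' v) (g s₂ v)
    have e1 := key t ht
    have e2 := key t' ht'
    rw [dist_eq_norm, dist_eq_norm (g t v), dist_eq_norm (g t' v)] at this
    rw [dist_eq_norm]
    linarith
  choose L hL using hconv
  have hL' : Tendsto (fun (s : M) (x : H) => (g s : H →ₗ[ℂ] H) x) atTop (𝓝 L) :=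
    tendsto_pi_nhds.2 hL
  let Llin : H →ₗ[ℂ] H := linearMapOfTendsto L (fun s : M => (g s : H →ₗ[ℂ] H)) hL'
  have hLlin : ∀ v, Llin v = L v := fun _ => rfl
  let a : H →L[ℂ] H := Llin.mkContinuous (‖b - s₀‖ + ‖s₀‖) fun v => by
    refine le_of_tendsto (hL v).norm ?_
    filter_upwards [eventually_ge_atTop (⟨s₀, hs₀⟩ : M)] with s hs
    refine ((g s).le_opNorm v).trans (mul_le_mul_of_nonneg_right ?_ (norm_nonneg _))
    have h1 := norm_add_le ((s : S.toStarSubalgebra) - s₀) s₀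
    rw [sub_add_cancel] at h1
    exact h1.trans (add_le_add_left (hbd s hs) _)
  have ha : ∀ v, Tendsto (fun s : M => g s v) atTop (𝓝 (a v)) := hL
  -- Commutation with the commutant passes to strong limits, so the bicommutant theorem puts the
  -- limit in the algebra.
  have hmem : a ∈ S.toStarSubalgebra := by
    refine mem_of_commute S fun y hy => ContinuousLinearMap.ext fun v => ?_
    have h1 : Tendsto (fun s : M => y (g s v)) atTop (𝓝 (y (a v))) :=
      (y.continuous.tendsto _).comp (ha v)
    have h2 := ha (y v)
    refine tendsto_nhds_unique h1 (h2.congr fun s => ?_)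
    exact congrArg (fun T : H →L[ℂ] H => T v)
      (VonNeumannAlgebra.mem_commutant_iff.1 hy (g s) (s : S.toStarSubalgebra).2)
  refine ⟨⟨a, hmem⟩, ⟨fun s hs => ?_, fun u hu => ?_⟩, ha⟩
  · rw [vN_le_iff]
    intro v
    refine ge_of_tendsto ((ha v).inner tendsto_const_nhds) ?_
    filter_upwards [eventually_ge_atTop (⟨s, hs⟩ : M)] with t ht
    exact (vN_le_iff _ _).1 ht v
  · rw [vN_le_iff]
    intro v
    refine le_of_tendsto' ((ha v).inner tendsto_const_nhds) fun t => ?_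
    exact (vN_le_iff _ _).1 (hu t.2) v

theorem tendsto_of_isLUB {S : VonNeumannAlgebra H} {M : Set S.toStarSubalgebra}
    (hne : M.Nonempty)
    (hdir : DirectedOn (· ≤ ·) M) {a : S.toStarSubalgebra} (ha : IsLUB M a) (v : H) :
    Tendsto (fun s : M => ((s : S.toStarSubalgebra) : H →L[ℂ] H) v) atTop
        (𝓝 ((a : H →L[ℂ] H) v)) := by
  obtain ⟨a', h1, h2⟩ := exists_isLUB_tendsto hne hdir ha.1
  rw [ha.unique h1]
  exact h2 v

/-- An increasing net need not be bounded below; only its part above a chosen element s₀ is squeezed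
between s₀ and the supremum. -/
theorem eventually_norm_le {S : VonNeumannAlgebra H} {M : Set S.toStarSubalgebra}
    (hne : M.Nonempty) {a : S.toStarSubalgebra} (ha : IsLUB M a) :
    ∃ C : ℝ, ∀ᶠ s : M in atTop, ‖(s : S.toStarSubalgebra)‖ ≤ C := by
  obtain ⟨s₀, hs₀⟩ := hne
  refine ⟨‖a - s₀‖ + ‖s₀‖, ?_⟩
  filter_upwards [eventually_ge_atTop (⟨s₀, hs₀⟩ : M)] with s hs
  have h1 := norm_add_le ((s : S.toStarSubalgebra) - s₀) s₀
  rw [sub_add_cancel] at h1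
  have h2 : ‖(s : S.toStarSubalgebra) - s₀‖ ≤ ‖a - s₀‖ :=
    CStarAlgebra.norm_le_norm_of_nonneg_of_le (sub_nonneg.2 hs) (sub_le_sub_right (ha.1 s.2) _)
  exact h1.trans (add_le_add_left h2 _)

/-- A functional is ultraweakly continuous when it is a norm limit of finite sums of functionals
`A ↦ ⟨ξ, A η⟩`. -/
def IsUltraweak (γ : S.toStarSubalgebra →ₗ[ℂ] ℂ) : Prop :=
  ∀ ε > 0, ∃ (n : ℕ) (ξ η : Fin n → H), ∀ A : S.toStarSubalgebra,
    ‖γ A - ∑ i, ⟪ξ i, (A : H →L[ℂ] H) (η i)⟫_ℂ‖ ≤ ε * ‖A‖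

variable {S}

/-- Finite sums of vector functionals follow strong convergence, and the approximation error,
proportional to the norm, stays small because the net is eventually bounded. -/
theorem IsUltraweak.tendsto {γ : S.toStarSubalgebra →ₗ[ℂ] ℂ} (hγ : IsUltraweak S γ)
    {M : Set S.toStarSubalgebra} (hne : M.Nonempty) (hdir : DirectedOn (· ≤ ·) M)
    {a : S.toStarSubalgebra} (ha : IsLUB M a) :
    Tendsto (fun s : M => γ s) atTop (𝓝 (γ a)) := by
  obtain ⟨C, hC⟩ := eventually_norm_le hne ha
  have : IsDirectedOrder M := directedOn_iff_isDirectedOrder.1 hdir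
  have : Nonempty M := hne.to_subtype
  rw [Metric.tendsto_nhds]
  intro ε hε
  have hC0 : 0 ≤ C := by
    obtain ⟨s, hs⟩ := hC.exists
    exact (norm_nonneg _).trans hs
  set D := C + ‖a‖ + 1
  have hD : 0 < D := by positivity
  obtain ⟨n, ξ, η, h⟩ := hγ (ε / (2 * D)) (by positivity)
  have hlim : Tendsto (fun s : M => ∑ i, ⟪ξ i, ((s : S.toStarSubalgebra) : H →L[ℂ] H) (η i)⟫_ℂ)
      atTop (𝓝 (∑ i, ⟪ξ i, (a : H →L[ℂ] H) (η i)⟫_ℂ)) :=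
    tendsto_finsetSum _ fun i _ => tendsto_const_nhds.inner (tendsto_of_isLUB hne hdir ha _)
  filter_upwards [hC, Metric.tendsto_nhds.1 hlim (ε / 2) (by positivity)] with s hs hs2
  rw [dist_eq_norm] at hs2 ⊢
  have e1 := h s
  have e2 := h a
  rw [norm_sub_rev] at e2
  set x := ∑ i, ⟪ξ i, ((s : S.toStarSubalgebra) : H →L[ℂ] H) (η i)⟫_ℂ
  set y := ∑ i, ⟪ξ i, (a : H →L[ℂ] H) (η i)⟫_ℂ
  have : γ s - γ a = (γ s - x) + (x - y) + (y - γ a) := by ring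
  rw [this]
  have e3 : ε / (2 * D) * ‖(s : S.toStarSubalgebra)‖ + ε / (2 * D) * ‖a‖ ≤ ε / 2 := by
    rw [← mul_add]
    have : ‖(s : S.toStarSubalgebra)‖ + ‖a‖ ≤ D := by simp only [D]; linarith
    calc _ ≤ ε / (2 * D) * D := mul_le_mul_of_nonneg_left this (by positivity)
      _ = ε / 2 := by field_simp
  calc _ ≤ ‖γ s - x‖ + ‖x - y‖ + ‖y - γ a‖ := norm_add₃_le
    _ < ε := by linarith

/-- A functional whose real part respects the limits of increasing nets. -/
def IsOrderContinuous (γ : S.toStarSubalgebra →ₗ[ℂ] ℂ) : Prop :=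
  ∀ (M : Set S.toStarSubalgebra) (a : S.toStarSubalgebra), (∀ s ∈ M, IsSelfAdjoint s) →
    M.Nonempty → DirectedOn (· ≤ ·) M → IsLUB M a →
      Tendsto (fun s : M => (γ s).re) atTop (𝓝 (γ a).re)

theorem IsUltraweak.isOrderContinuous {γ : S.toStarSubalgebra →ₗ[ℂ] ℂ} (hγ : IsUltraweak S γ) :
    IsOrderContinuous γ := fun _ _ _ hne hdir ha =>
  (Complex.continuous_re.tendsto _).comp (hγ.tendsto hne hdir ha)

/-- Stability under differences is the reason for working with limits of real parts and not with
suprema: the exhaustion below uses differences of positive functionals, which need not be positive.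
-/
theorem IsOrderContinuous.sub {γ γ' : S.toStarSubalgebra →ₗ[ℂ] ℂ} (h : IsOrderContinuous γ)
    (h' : IsOrderContinuous γ') : IsOrderContinuous (γ - γ') := fun M a hsa hne hdir ha => by
  simpa using (h M a hsa hne hdir ha).sub (h' M a hsa hne hdir ha)

theorem map_mono_of_pos {γ : S.toStarSubalgebra →ₗ[ℂ] ℂ} (hp : ∀ A, 0 ≤ γ (star A * A))
    {x y : S.toStarSubalgebra} (h : x ≤ y) : γ x ≤ γ y := by
  obtain ⟨c, hc⟩ := CStarAlgebra.nonneg_iff_eq_star_mul_self.1 (sub_nonneg.2 h)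
  have := hp c
  rw [← hc, map_sub] at this
  exact sub_nonneg.1 this

theorem IsNormal.isOrderContinuous {γ : S.toStarSubalgebra →ₗ[ℂ] ℂ} (hγ : IsNormal S γ)
    (hp : ∀ A, 0 ≤ γ (star A * A)) : IsOrderContinuous γ := by
  intro M a hsa hne hdir ha
  have hlub := hγ M a hsa hne hdir ha
  refine tendsto_atTop_isLUB (fun s t hst => (map_mono_of_pos hp hst).1) ⟨?_, fun u hu => ?_⟩
  · rintro _ ⟨s, rfl⟩
    exact (hlub.1 ⟨s, s.2, rfl⟩).1
  -- In the order of ℂ, comparable numbers have equal imaginary parts, so a real upper bound u must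
  -- be given the imaginary part of γ a before it can be compared with the supremum.
  · have : γ a ≤ (⟨u, (γ a).im⟩ : ℂ) := hlub.2 (by
      rintro _ ⟨s, hs, rfl⟩
      exact ⟨hu ⟨⟨s, hs⟩, rfl⟩, (hlub.1 ⟨s, hs, rfl⟩).2⟩)
    exact this.1

theorem IsUltraweak.isNormal {γ : S.toStarSubalgebra →ₗ[ℂ] ℂ} (hγ : IsUltraweak S γ)
    (hp : ∀ A, 0 ≤ γ (star A * A)) : IsNormal S γ := by
  intro M a hsa hne hdir ha
  have : IsDirectedOrder M := directedOn_iff_isDirectedOrder.1 hdir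
  have : Nonempty M := hne.to_subtype
  refine ⟨?_, fun u hu => ?_⟩
  · rintro _ ⟨s, hs, rfl⟩
    exact map_mono_of_pos hp (ha.1 hs)
  · exact le_of_tendsto' (hγ.tendsto hne hdir ha) fun s => hu ⟨s, s.2, rfl⟩

/-- For an order continuous functional, the elements `d` with `0 ≤ d ≤ s` at which the
functional has a nonnegative real part include a maximal one. -/
theorem IsOrderContinuous.exists_maximal {γ : S.toStarSubalgebra →ₗ[ℂ] ℂ}
    (hγ : IsOrderContinuous γ) {s : S.toStarSubalgebra} (hs : 0 ≤ s) :
    ∃ d, 0 ≤ d ∧ d ≤ s ∧ 0 ≤ (γ d).re ∧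
      ∀ d', d ≤ d' → d' ≤ s → 0 ≤ (γ d').re → d' = d := by
  have hz : ∃ d, 0 ≤ d ∧
      Maximal (· ∈ {d : S.toStarSubalgebra | 0 ≤ d ∧ d ≤ s ∧ 0 ≤ (γ d).re}) d := by
    -- A chain is a bounded increasing net, so it has a supremum in the algebra; order continuity
    -- preserves the sign condition there.
    refine zorn_le_nonempty₀ _ (fun c hc hchain y hy => ?_) 0 ⟨le_rfl, hs, by simp⟩
    have hne : c.Nonempty := ⟨y, hy⟩
    have hdir : DirectedOn (· ≤ ·) c := hchain.directedOn
    have : IsDirectedOrder c := directedOn_iff_isDirectedOrder.1 hdir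
    have : Nonempty c := hne.to_subtype
    obtain ⟨a, ha, -⟩ := exists_isLUB_tendsto hne hdir (b := s) fun d hd => (hc hd).2.1
    refine ⟨a, ⟨(hc hy).1.trans (ha.1 hy), ha.2 fun d hd => (hc hd).2.1, ?_⟩, fun z hz => ha.1 hz⟩
    exact ge_of_tendsto' (hγ c a (fun d hd => .of_nonneg (hc hd).1) hne hdir ha)
      fun d => (hc d.2).2.2
  obtain ⟨d, -, hd⟩ := hz
  exact ⟨d, hd.1.1, hd.1.2.1, hd.1.2.2, fun d' h1 h2 h3 =>
    (hd.le_of_ge ⟨hd.1.1.trans h1, h2, h3⟩ h1).antisymm h1⟩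

end MonotoneConvergence

/-! ### Positive order continuous functionals as countable sums of vector functionals. -/

section NormalStates

open ContinuousLinearMap

variable {H : Type u} [NormedAddCommGroup H] [InnerProductSpace ℂ H] [CompleteSpace H]
variable {S : VonNeumannAlgebra H}

/-- This is the Cauchy-Schwarz inequality of the GNS pre-Hilbert space of γ. -/
theorem norm_map_star_mul_sq_le {γ : S.toStarSubalgebra →ₗ[ℂ] ℂ} (hp : ∀ A, 0 ≤ γ (star A * A))
    (A B : S.toStarSubalgebra) :
    ‖γ (star A * B)‖ ^ 2 ≤ (γ (star A * A)).re * (γ (star B * B)).re := by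
  let φ : S.toStarSubalgebra →ₚ[ℂ] ℂ := PositiveLinearMap.mk₀ γ fun a ha => by
    obtain ⟨c, rfl⟩ := CStarAlgebra.nonneg_iff_eq_star_mul_self.1 ha
    exact hp c
  have hn : ∀ C : S.toStarSubalgebra, ‖φ.toPreGNS C‖ ^ 2 = (γ (star C * C)).re := fun C => by
    rw [PositiveLinearMap.preGNS_norm_def, Real.sq_sqrt]
    · rfl
    · exact (hp C).1
  have h := norm_inner_le_norm (𝕜 := ℂ) (φ.toPreGNS A) (φ.toPreGNS B)
  rw [← hn, ← hn, ← mul_pow]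
  exact pow_le_pow_left₀ (norm_nonneg _) h 2

/-- The `+ 1` keeps the scalar invertible when A = 0; `exists_locally_dominated` divides by it. -/
theorem star_mul_le_norm_sq (A : S.toStarSubalgebra) :
    star A * A ≤ ((‖A‖ ^ 2 + 1 : ℝ) : ℂ) • (1 : S.toStarSubalgebra) := by
  rw [vN_le_iff]
  intro v
  change ⟪(star (A : H →L[ℂ] H)) ((A : H →L[ℂ] H) v), v⟫_ℂ
    ≤ ⟪((‖A‖ ^ 2 + 1 : ℝ) : ℂ) • v, v⟫_ℂ
  rw [star_eq_adjoint, adjoint_inner_left, inner_smul_left, Complex.conj_ofReal,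
    inner_self_eq_norm_sq_to_K, inner_self_eq_norm_sq_to_K]
  simp only [RCLike.ofReal_eq_complex_ofReal]
  have h1 : ‖(A : H →L[ℂ] H) v‖ ^ 2 ≤ (‖A‖ ^ 2 + 1) * ‖v‖ ^ 2 := by
    have := pow_le_pow_left₀ (norm_nonneg _) ((A : H →L[ℂ] H).le_opNorm v) 2
    rw [mul_pow] at this
    refine this.trans (mul_le_mul_of_nonneg_right ?_ (sq_nonneg _))
    change ‖(A : H →L[ℂ] H)‖ ^ 2 ≤ ‖(A : H →L[ℂ] H)‖ ^ 2 + 1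
    linarith
  exact_mod_cast Complex.real_le_real.2 h1

/-- The functional `A ↦ ⟨ζ, A ζ⟩`. -/
def vecFunctional (S : VonNeumannAlgebra H) (ζ : H) : S.toStarSubalgebra →ₗ[ℂ] ℂ where
  toFun A := ⟪ζ, (A : H →L[ℂ] H) ζ⟫_ℂ
  map_add' _ _ := inner_add_right _ _ _
  map_smul' _ _ := inner_smul_right _ _ _

theorem vecFunctional_apply (ζ : H) (A : S.toStarSubalgebra) :
    vecFunctional S ζ A = ⟪ζ, (A : H →L[ℂ] H) ζ⟫_ℂ := rfl

theorem vecFunctional_star_mul (ζ : H) (A : S.toStarSubalgebra) :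
    vecFunctional S ζ (star A * A) = ((‖(A : H →L[ℂ] H) ζ‖ ^ 2 : ℝ) : ℂ) := by
  change ⟪ζ, (star (A : H →L[ℂ] H)) ((A : H →L[ℂ] H) ζ)⟫_ℂ = _
  rw [star_eq_adjoint, adjoint_inner_right, inner_self_eq_norm_sq_to_K]
  simp

theorem isUltraweak_vecFunctional (ζ : H) : IsUltraweak S (vecFunctional S ζ) := fun ε hε =>
  ⟨1, fun _ => ζ, fun _ => ζ, fun A => by
    simp only [Finset.univ_unique, Finset.sum_singleton, vecFunctional_apply, sub_self, norm_zero]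
    positivity⟩

/-- A nonzero positive order continuous functional dominates, on a left ideal generated by one
element where it does not vanish, a vector functional. -/
theorem exists_locally_dominated {γ : S.toStarSubalgebra →ₗ[ℂ] ℂ} (hp : ∀ A, 0 ≤ γ (star A * A))
    (hc : IsOrderContinuous γ) (h1 : 0 < (γ 1).re) :
    ∃ (c : S.toStarSubalgebra) (ζ : H), 0 < (γ (star c * c)).re ∧
      ∀ A : S.toStarSubalgebra,
        (γ (star (A * c) * (A * c))).re ≤ ‖(A : H →L[ℂ] H) ζ‖ ^ 2 := by
  have hnn : ∀ {a : S.toStarSubalgebra}, 0 ≤ a → 0 ≤ (γ a).re := fun ha => by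
    have := (map_mono_of_pos hp ha).1
    simpa using this
  have hzero : IsOrderContinuous (0 : S.toStarSubalgebra →ₗ[ℂ] ℂ) := fun _ _ _ _ _ _ => by
    simpa using tendsto_const_nhds
  -- Applied to -γ, this gives a maximal z in [0, 1] annihilated by γ. By maximality γ is strictly
  -- positive on the nonzero elements of [0, 1 - z].
  obtain ⟨z, hz0, hz1, hzγ, hzmax⟩ :=
    (hzero.sub hc).exists_maximal (s := 1) zero_le_one
  have hzγ' : (γ z).re = 0 := le_antisymm (by simpa using hzγ) (hnn hz0)
  have hfaithful : ∀ r : S.toStarSubalgebra, 0 ≤ r → r ≤ 1 - z → r ≠ 0 → 0 < (γ r).re := by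
    intro r hr hrs hr0
    refine lt_of_le_of_ne (hnn hr) fun h => hr0 ?_
    have := hzmax (z + r) (le_add_of_nonneg_right hr) (by rw [add_comm]; exact le_sub_iff_add_le.1 hrs)
      (by simp [hzγ', ← h])
    simpa using this
  set s := 1 - z
  have hs0 : 0 ≤ s := sub_nonneg.2 hz1
  have hsγ : 0 < (γ s).re := by simp [s, hzγ', h1]
  obtain ⟨v, hv⟩ : ∃ v, 0 < (⟪(s : H →L[ℂ] H) v, v⟫_ℂ).re := by
    by_contra! hcon
    have : s = 0 := by
      refine le_antisymm ((vN_le_iff _ _).2 fun v => ?_) hs0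
      have h2 := (vN_nonneg_iff s).1 hs0 v
      refine ⟨?_, ?_⟩
      · simpa using hcon v
      · simpa using h2.2.symm
    rw [this] at hsγ
    simp at hsγ
  -- The scaling makes the vector functional of η = t v exceed γ at s by exactly 1.
  set t : ℝ := √(((γ s).re + 1) / (⟪(s : H →L[ℂ] H) v, v⟫_ℂ).re)
  have ht : t ^ 2 * (⟪(s : H →L[ℂ] H) v, v⟫_ℂ).re = (γ s).re + 1 := by
    rw [Real.sq_sqrt (by positivity)]; field_simp
  set η : H := (t : ℂ) • v
  have hη : (vecFunctional S η s).re = (γ s).re + 1 := by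
    rw [vecFunctional_apply, ← ht, map_smul, inner_smul_left, inner_smul_right, ← mul_assoc,
      Complex.conj_ofReal, ← Complex.ofReal_mul, Complex.re_ofReal_mul, ← inner_conj_symm, sq, Complex.conj_re]
  have hωpos : ∀ A, 0 ≤ vecFunctional S η (star A * A) := fun A => by
    rw [vecFunctional_star_mul]; exact Complex.zero_le_real.2 (sq_nonneg _)
  have hδ := hc.sub (isUltraweak_vecFunctional (S := S) η).isOrderContinuous
  -- A maximal d in [0, s] at which γ is at least the functional of η. It cannot be s, and by
  -- maximality the functional of η dominates γ on all of [0, s - d].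
  obtain ⟨d, hd0, hds, hdδ, hdmax⟩ := hδ.exists_maximal hs0
  have hr0 : 0 ≤ s - d := sub_nonneg.2 hds
  have hrne : s - d ≠ 0 := by
    intro h
    rw [← sub_eq_zero.1 h, LinearMap.sub_apply, Complex.sub_re, hη] at hdδ
    linarith
  have hrγ := hfaithful (s - d) hr0 (sub_le_self _ hd0) hrne
  have hsmall : ∀ a, 0 ≤ a → a ≤ s - d → ((γ - vecFunctional S η) a).re ≤ 0 := by
    intro a ha has
    by_contra! hcon
    have := hdmax (d + a) (le_add_of_nonneg_right ha) (by rw [add_comm]; exact le_sub_iff_add_le.1 has)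
      (by rw [map_add, Complex.add_re]; linarith)
    have ha0 : a = 0 := by simpa using this
    rw [ha0] at hcon
    simp at hcon
  obtain ⟨c, hcr⟩ := CStarAlgebra.nonneg_iff_eq_star_mul_self.1 hr0
  refine ⟨c, (c : H →L[ℂ] H) η, by rwa [← hcr], fun A => ?_⟩
  have hk : 0 < ‖A‖ ^ 2 + 1 := by positivity
  -- As s - d = c*c, a positive multiple of (Ac)*(Ac) lies in [0, s - d], where the domination
  -- holds; it is homogeneous, so the multiple drops out.
  have h2 : star (A * c) * (A * c) ≤ ((‖A‖ ^ 2 + 1 : ℝ) : ℂ) • (s - d) := by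
    have := star_left_conjugate_le_conjugate (star_mul_le_norm_sq A) c
    rw [hcr]
    simpa [mul_assoc] using this
  have h3 := hsmall ((((‖A‖ ^ 2 + 1)⁻¹ : ℝ) : ℂ) • (star (A * c) * (A * c)))
    (smul_nonneg (Complex.zero_le_real.2 (by positivity)) (star_mul_self_nonneg _)) (by
      have := smul_le_smul_of_nonneg_left h2
        (Complex.zero_le_real.2 (inv_nonneg.2 hk.le))
      rwa [smul_smul, ← Complex.ofReal_mul, inv_mul_cancel₀ hk.ne', Complex.ofReal_one,
        one_smul] at this)
  rw [map_smul, smul_eq_mul, Complex.re_ofReal_mul] at h3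
  have h4 := nonpos_of_mul_nonpos_right h3 (inv_pos.2 hk)
  rw [LinearMap.sub_apply, vecFunctional_star_mul, Complex.sub_re, Complex.ofReal_re] at h4
  have h5 : ((A * c : S.toStarSubalgebra) : H →L[ℂ] H) η
    = (A : H →L[ℂ] H) ((c : H →L[ℂ] H) η) := rfl
  rw [h5] at h4
  linarith

/-- A nonzero positive order continuous functional dominates a nonzero vector functional. -/
theorem exists_vector_le {γ : S.toStarSubalgebra →ₗ[ℂ] ℂ} (hp : ∀ A, 0 ≤ γ (star A * A))
    (hc : IsOrderContinuous γ) (h1 : 0 < (γ 1).re) :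
    ∃ ζ : H, ζ ≠ 0 ∧ ∀ A : S.toStarSubalgebra,
      ‖(A : H →L[ℂ] H) ζ‖ ^ 2 ≤ (γ (star A * A)).re := by
  obtain ⟨c, ζ, hcpos, hdom⟩ := exists_locally_dominated hp hc h1
  let f₀ : S.toStarSubalgebra →ₗ[ℂ] H :=
    ((ContinuousLinearMap.apply ℂ H ζ : (H →L[ℂ] H) →L[ℂ] H) :
      (H →L[ℂ] H) →ₗ[ℂ] H) ∘ₗ S.toStarSubalgebra.toSubalgebra.toSubmodule.subtype
  have hf₀ : ∀ A, f₀ A = (A : H →L[ℂ] H) ζ := fun _ => rfl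
  let W : Submodule ℂ H := (LinearMap.range f₀).topologicalClosure
  have : CompleteSpace W := (Submodule.isClosed_topologicalClosure _).completeSpace_coe
  have hW : ∀ A, f₀ A ∈ W := fun A => Submodule.le_topologicalClosure _ ⟨A, rfl⟩
  let f : S.toStarSubalgebra →ₗ[ℂ] W := f₀.codRestrict W hW
  have hdense : DenseRange f := by
    rw [DenseRange, dense_iff_closure_eq, Set.eq_univ_iff_forall]
    intro w
    rw [closure_subtype, ← Set.range_comp]
    exact w.2
  let g : S.toStarSubalgebra →ₗ[ℂ] ℂ := γ ∘ₗ LinearMap.mulRight ℂ c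
  have hg : ∀ A, g A = γ (A * c) := fun _ => rfl
  have hCS : ∀ A B : S.toStarSubalgebra,
      ‖γ (star A * (B * c))‖ ≤ √(γ (star A * A)).re * ‖(B : H →L[ℂ] H) ζ‖ := by
    intro A B
    refine le_of_sq_le_sq ?_ (by positivity)
    rw [mul_pow, Real.sq_sqrt (hp A).1]
    exact (norm_map_star_mul_sq_le hp A (B * c)).trans
      (mul_le_mul_of_nonneg_left (hdom B) (hp A).1)
  have hbound : ∃ k : ℝ, ∀ B, ‖g B‖ ≤ k * ‖f B‖ := ⟨√(γ (star 1 * 1)).re, fun B => by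
    have h : star 1 * (B * c) = B * c := by rw [star_one, one_mul]
    rw [hg, ← h]
    exact hCS 1 B⟩
  let φ : W →L[ℂ] ℂ := g.extendOfNorm f
  have hφ : ∀ B, φ (f B) = γ (B * c) := fun B => g.extendOfNorm_eq hdense hbound B
  -- By Cauchy-Schwarz and the local domination, Bζ ↦ γ(Bc) is a bounded functional on the closure W
  -- of the orbit of ζ. Its Riesz vector w is the one sought: w is nonzero since ⟨w, c*ζ⟩ = γ(c*c) >
  -- 0.
  let w : W := (InnerProductSpace.toDual ℂ W).symm φ
  have hw : ∀ B : S.toStarSubalgebra, ⟪(w : H), (B : H →L[ℂ] H) ζ⟫_ℂ = γ (B * c) := by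
    intro B
    rw [← hφ]
    exact InnerProductSpace.toDual_symm_apply (x := f B) (y := φ)
  refine ⟨w, fun h0 => ?_, fun A => ?_⟩
  · have := hw (star c)
    rw [h0, inner_zero_left] at this
    rw [← this] at hcpos
    simp at hcpos
  -- Invariance of W allows the estimate of |⟨Aw, u⟩| on W to be tested at u = Aw.
  · have hcl : ∀ u ∈ W, (A : H →L[ℂ] H) u ∈ W := by
      intro u hu
      have : Set.MapsTo (A : H →L[ℂ] H) (Set.range f₀) (Set.range f₀) := by
        rintro _ ⟨B, rfl⟩
        exact ⟨A * B, rfl⟩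
      exact map_mem_closure (A : H →L[ℂ] H).continuous hu this
    have hAw := hcl w w.2
    have hineq : ∀ u ∈ W, ‖⟪(A : H →L[ℂ] H) w, u⟫_ℂ‖ ≤ √(γ (star A * A)).re * ‖u‖ := by
      intro u hu
      have hclosed : IsClosed {u : H | ‖⟪(A : H →L[ℂ] H) w, u⟫_ℂ‖ ≤ √(γ (star A * A)).re * ‖u‖} :=
        isClosed_le (by fun_prop) (by fun_prop)
      refine hclosed.closure_subset_iff.2 ?_ hu
      rintro _ ⟨B, rfl⟩
      have h2 : ⟪(A : H →L[ℂ] H) w, f₀ B⟫_ℂ = γ (star A * (B * c)) := by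
        rw [← mul_assoc, ← hw, ← adjoint_inner_right]; rfl
      change ‖⟪(A : H →L[ℂ] H) w, f₀ B⟫_ℂ‖ ≤ _
      rw [h2]
      exact hCS A B
    have h3 := hineq _ hAw
    rw [inner_self_eq_norm_sq_to_K, norm_pow, RCLike.norm_ofReal, abs_norm, sq] at h3
    have h4 : ‖(A : H →L[ℂ] H) w‖ ≤ √(γ (star A * A)).re := by
      by_contra! hcon
      have : 0 < ‖(A : H →L[ℂ] H) w‖ := (Real.sqrt_nonneg _).trans_lt hcon
      exact absurd (le_of_mul_le_mul_right h3 this) (not_le.2 hcon)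
    have := pow_le_pow_left₀ (norm_nonneg _) h4 2
    rwa [Real.sq_sqrt (hp A).1] at this

omit [CompleteSpace H] in
theorem norm_inner_apply_le (A : H →L[ℂ] H) (ζ : H) : ‖⟪ζ, A ζ⟫_ℂ‖ ≤ ‖A‖ * ‖ζ‖ ^ 2 := by
  refine (norm_inner_le_norm _ _).trans ?_
  nlinarith [A.le_opNorm ζ, norm_nonneg ζ]

omit [CompleteSpace H] in
theorem summable_vecFunctional {ζ : ℕ → H} (hζ : Summable fun n => ‖ζ n‖ ^ 2)
    (A : H →L[ℂ] H) : Summable fun n => ⟪ζ n, A (ζ n)⟫_ℂ :=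
  .of_norm_bounded (hζ.mul_left ‖A‖) fun n => norm_inner_apply_le A (ζ n)

/-- The functional `A ↦ ∑ ⟨ζₙ, A ζₙ⟩`. -/
def sumVecFunctional (S : VonNeumannAlgebra H) {ζ : ℕ → H} (hζ : Summable fun n => ‖ζ n‖ ^ 2) :
    S.toStarSubalgebra →ₗ[ℂ] ℂ where
  toFun A := ∑' n, vecFunctional S (ζ n) A
  map_add' A B := by
    simp only [map_add]
    exact (summable_vecFunctional hζ (A : H →L[ℂ] H)).tsum_add (summable_vecFunctional hζ (B : H →L[ℂ] H))
  map_smul' r A := by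
    simp only [map_smul, smul_eq_mul, RingHom.id_apply]
    exact tsum_mul_left

theorem hasSum_sumVecFunctional {ζ : ℕ → H} (hζ : Summable fun n => ‖ζ n‖ ^ 2)
    (A : S.toStarSubalgebra) :
    HasSum (fun n => vecFunctional S (ζ n) A) (sumVecFunctional S hζ A) :=
  (summable_vecFunctional hζ (A : H →L[ℂ] H)).hasSum

theorem isUltraweak_sumVecFunctional {ζ : ℕ → H} (hζ : Summable fun n => ‖ζ n‖ ^ 2) :
    IsUltraweak S (sumVecFunctional S hζ) := by
  intro ε hε
  have h := tendsto_sum_nat_add (fun n => ‖ζ n‖ ^ 2)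
  obtain ⟨N, hN⟩ := (h.eventually_lt_const hε).exists
  refine ⟨N, fun i => ζ i, fun i => ζ i, fun A => ?_⟩
  have h1 := (summable_vecFunctional hζ (A : H →L[ℂ] H)).sum_add_tsum_nat_add N
  have h2 : sumVecFunctional S hζ A - ∑ i : Fin N, ⟪ζ i, (A : H →L[ℂ] H) (ζ i)⟫_ℂ
      = ∑' k, ⟪ζ (k + N), (A : H →L[ℂ] H) (ζ (k + N))⟫_ℂ := by
    rw [Fin.sum_univ_eq_sum_range (fun i => ⟪ζ i, (A : H →L[ℂ] H) (ζ i)⟫_ℂ), sub_eq_iff_eq_add',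
      h1]
    rfl
  rw [h2]
  have hs := (summable_nat_add_iff N).2 hζ
  refine (tsum_of_norm_bounded (hs.mul_left ‖(A : H →L[ℂ] H)‖).hasSum
    fun n => norm_inner_apply_le _ _).trans ?_
  rw [tsum_mul_left, mul_comm]
  exact mul_le_mul_of_nonneg_right hN.le (norm_nonneg _)

/-- Among the vector functionals dominated by a positive functional one can choose one whose
norm is at least half as large as that of any other. -/
theorem exists_almost_largest {γ : S.toStarSubalgebra →ₗ[ℂ] ℂ} (hp : ∀ A, 0 ≤ γ (star A * A)) :
    ∃ ζ : H, (∀ A : S.toStarSubalgebra, ‖(A : H →L[ℂ] H) ζ‖ ^ 2 ≤ (γ (star A * A)).re) ∧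
      ∀ ζ' : H, (∀ A : S.toStarSubalgebra, ‖(A : H →L[ℂ] H) ζ'‖ ^ 2 ≤ (γ (star A * A)).re) →
        ‖ζ'‖ ^ 2 ≤ 2 * ‖ζ‖ ^ 2 := by
  set Q : Set H := {ζ | ∀ A : S.toStarSubalgebra, ‖(A : H →L[ℂ] H) ζ‖ ^ 2 ≤ (γ (star A * A)).re}
  have h0 : (0 : H) ∈ Q := fun A => by simpa using (hp A).1
  have hbdd : BddAbove ((fun ζ : H => ‖ζ‖ ^ 2) '' Q) := ⟨(γ (star 1 * 1)).re, by
    rintro _ ⟨ζ, hζ, rfl⟩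
    exact hζ 1⟩
  have hle : ∀ ζ ∈ Q, ‖ζ‖ ^ 2 ≤ sSup ((fun ζ : H => ‖ζ‖ ^ 2) '' Q) := fun ζ hζ =>
    le_csSup hbdd ⟨ζ, hζ, rfl⟩
  rcases (by simpa using hle 0 h0 : 0 ≤ sSup ((fun ζ : H => ‖ζ‖ ^ 2) '' Q)).eq_or_lt with h | h
  · refine ⟨0, h0, fun ζ' hζ' => ?_⟩
    simpa [← h] using hle ζ' hζ'
  · obtain ⟨_, ⟨ζ, hζ, rfl⟩, hlt⟩ := exists_lt_of_lt_csSup (Set.Nonempty.image _ ⟨0, h0⟩)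
      (half_lt_self h)
    exact ⟨ζ, hζ, fun ζ' hζ' => (hle ζ' hζ').trans (by simp only at hlt; linarith)⟩

/-- A positive order continuous functional is a countable sum of vector functionals. -/
theorem exists_eq_sumVecFunctional {γ : S.toStarSubalgebra →ₗ[ℂ] ℂ}
    (hp : ∀ A, 0 ≤ γ (star A * A)) (hc : IsOrderContinuous γ) :
    ∃ (ζ : ℕ → H) (hζ : Summable fun n => ‖ζ n‖ ^ 2), γ = sumVecFunctional S hζ := by
  let P := {φ : S.toStarSubalgebra →ₗ[ℂ] ℂ // ∀ A, 0 ≤ φ (star A * A)}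
  choose z hz hzmax using fun φ : P => exists_almost_largest φ.2
  let step : P → P := fun φ => ⟨φ.1 - vecFunctional S (z φ), fun A => by
    rw [LinearMap.sub_apply, vecFunctional_star_mul, sub_nonneg]
    exact ⟨hz φ A, (φ.2 A).2⟩⟩
  let φ : ℕ → P := fun n => step^[n] ⟨γ, hp⟩
  let ζ : ℕ → H := fun n => z (φ n)
  have hφ : ∀ n, (φ n).1 = γ - ∑ k ∈ Finset.range n, vecFunctional S (ζ k) := by
    intro n
    induction n with
    | zero => simp [φ]
    | succ n ih =>
      have : φ (n + 1) = step (φ n) := Function.iterate_succ_apply' _ _ _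
      rw [this, Finset.sum_range_succ, ← sub_sub, ← ih]
  have hpart : ∀ n (A : S.toStarSubalgebra),
      ∑ k ∈ Finset.range n, ‖(A : H →L[ℂ] H) (ζ k)‖ ^ 2 ≤ (γ (star A * A)).re := by
    intro n A
    have h := ((φ n).2 A).1
    rw [hφ, LinearMap.sub_apply, LinearMap.sum_apply] at h
    simp only [vecFunctional_star_mul] at h
    rw [← Complex.ofReal_sum, Complex.sub_re, Complex.ofReal_re] at h
    simpa using h
  have hζ : Summable fun n => ‖ζ n‖ ^ 2 :=
    summable_of_sum_range_le (fun n => sq_nonneg _) fun n => hpart n 1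
  refine ⟨ζ, hζ, ?_⟩
  have hstar : ∀ A : S.toStarSubalgebra, sumVecFunctional S hζ (star A * A)
      = ((∑' n, ‖(A : H →L[ℂ] H) (ζ n)‖ ^ 2 : ℝ) : ℂ) := by
    intro A
    rw [Complex.ofReal_tsum]
    exact tsum_congr fun n => vecFunctional_star_mul _ _
  set ρ := γ - sumVecFunctional S hζ
  have hρp : ∀ A, 0 ≤ ρ (star A * A) := by
    intro A
    rw [LinearMap.sub_apply, hstar, sub_nonneg]
    refine ⟨?_, (hp A).2⟩
    rw [Complex.ofReal_re]
    exact Real.tsum_le_of_sum_range_le (fun n => sq_nonneg _) fun n => hpart n A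
  have hρc : IsOrderContinuous ρ := hc.sub (isUltraweak_sumVecFunctional hζ).isOrderContinuous
  have hρ1 : (ρ 1).re = 0 := by
    have h0 : 0 ≤ (ρ 1).re := by simpa using (hρp 1).1
    refine le_antisymm (not_lt.1 fun hlt => ?_) h0
    obtain ⟨ζ', hne, hdom⟩ := exists_vector_le hρp hρc hlt
    -- A vector functional dominated by the final remainder ρ was available at every stage, so ‖ζ'‖²
    -- is at most twice the n-th term of a convergent series, for every n; hence ζ' = 0.
    have hle : ∀ n, ‖ζ'‖ ^ 2 ≤ 2 * ‖ζ n‖ ^ 2 := by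
      intro n
      refine hzmax (φ n) ζ' fun A => (hdom A).trans ?_
      rw [hφ, LinearMap.sub_apply, LinearMap.sub_apply, LinearMap.sum_apply, hstar]
      simp only [vecFunctional_star_mul]
      rw [← Complex.ofReal_sum, Complex.sub_re, Complex.sub_re, Complex.ofReal_re,
        Complex.ofReal_re]
      refine sub_le_sub_left ?_ _
      refine Summable.sum_le_tsum _ (fun n _ => sq_nonneg _) ?_
      exact summable_of_sum_range_le (fun n => sq_nonneg _) fun n => hpart n A
    have hlim := hζ.tendsto_atTop_zero.const_mul 2
    rw [mul_zero] at hlim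
    have := ge_of_tendsto' hlim hle
    exact hne (by simpa using (le_antisymm this (sq_nonneg _)))
  have hρ0 : ρ = 0 := by
    ext A
    have h := norm_map_star_mul_sq_le hρp 1 A
    rw [star_one, one_mul, one_mul, hρ1, zero_mul] at h
    simpa using le_antisymm h (sq_nonneg _)
  exact sub_eq_zero.1 hρ0

end NormalStates

/-! ### Products of rank one operators. -/

section RankOne

open InnerProductSpace

variable {K : Type u} [NormedAddCommGroup K] [InnerProductSpace ℂ K]

theorem rankOne_mul_rankOne (u v w z : K) :
    rankOne ℂ u v * rankOne ℂ w z = ⟪v, w⟫_ℂ • rankOne ℂ u z :=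
  rankOne_comp_rankOne u v w z

theorem rankOne_smul_left (r : ℂ) (u v : K) : rankOne ℂ (r • u) v = r • rankOne ℂ u v := by
  rw [map_smul]; rfl

/-- The scalars are absorbed into free vectors `w j k` because, in a fibre, such a multiple is again
the value of a section `vf`. -/
theorem sum_rankOne_mul_sum_rankOne {n m : ℕ} (u v : Fin n → K) (u' v' : Fin m → K)
    (w : Fin n → Fin m → K) (h : ∀ j k, w j k = ⟪v j, u' k⟫_ℂ • u j) :
    (∑ j, rankOne ℂ (u j) (v j)) * ∑ k, rankOne ℂ (u' k) (v' k)
      = ∑ j, ∑ k, rankOne ℂ (w j k) (v' k) := by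
  rw [Finset.sum_mul_sum]
  refine Finset.sum_congr rfl fun j _ => Finset.sum_congr rfl fun k _ => ?_
  rw [rankOne_mul_rankOne, h, rankOne_smul_left]

end RankOne

/-! ### Disintegration over the spectrum and the algebra of elementary fields. -/

namespace AbelianSystem

open InnerProductSpace

variable {H : Type u} [NormedAddCommGroup H] [InnerProductSpace ℂ H] [CompleteSpace H]
variable (D : AbelianSystem H)

instance : D.μ.Regular := inferInstanceAs (RealRMK.rieszMeasure D.functional).Regular

instance : IsFiniteMeasure D.μ := inferInstance

/-- The inclusion of the commutative algebra in its commutant. -/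
def incl (c : D.C) : D.C' := ⟨c, D.C_sub c.2⟩

/-- The operator in the algebra with the complex Gelfand transform `g`. -/
def ofCFun (g : C(D.X, ℂ)) : D.C := (gelfandStarTransform D.C).symm g

theorem ofCFun_apply (g : C(D.X, ℂ)) (x : D.X) : x (D.ofCFun g) = g x :=
  congrArg (fun k : C(D.X, ℂ) => k x) ((gelfandStarTransform D.C).apply_symm_apply g)

theorem continuous_eval (c : D.C) : Continuous fun x : D.X => x c :=
  (gelfandStarTransform D.C c).continuous

theorem continuous_ψ (A : D.C') : Continuous fun x : D.X => D.ψ x A := D.continuous_eval _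

theorem E_one : D.E 1 = 1 := D.E_unique (by
  have he : D.e * D.e = D.e := (isStarProjection_starProjection (U := D.K)).isIdempotentElem
  change (1 : H →L[ℂ] H) * D.e = D.e * 1 * D.e
  rw [one_mul, mul_one, he])

theorem ψ_one (x : D.X) : D.ψ x 1 = 1 := by
  rw [ψ_apply, E_one, map_one]

theorem E_mul (c : D.C) (A : D.C') : D.E (D.incl c * A) = c * D.E A := D.E_unique (by
  change (c : H →L[ℂ] H) * (D.E A : H →L[ℂ] H) * D.e = D.e * ((c : H →L[ℂ] H) * A) * D.e
  have h := VonNeumannAlgebra.mem_commutant_iff.1 D.e_mem_C' c c.2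
  rw [mul_assoc, E_spec, ← mul_assoc, ← mul_assoc, ← mul_assoc, h])

theorem ψ_mul (x : D.X) (c : D.C) (A : D.C') : D.ψ x (D.incl c * A) = x c * D.ψ x A := by
  rw [ψ_apply, E_mul, map_mul, ψ_apply]

theorem inner_vec_E (A : D.C') :
    ⟪D.vec, (D.E A : H →L[ℂ] H) D.vec⟫_ℂ = ⟪D.vec, (A : H →L[ℂ] H) D.vec⟫_ℂ := by
  have h := congrArg (fun T : H →L[ℂ] H => T D.vec) (D.E_spec A)
  change (D.E A : H →L[ℂ] H) (D.e D.vec) = (D.e * A * D.e) D.vec at h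
  rw [D.e_of_mem D.vec_mem, D.compress_vec] at h
  rw [h, ← e_inner, D.e_of_mem D.vec_mem]

theorem integral_eval_ofFun (g : C(D.X, ℝ)) :
    ((∫ x, g x ∂D.μ : ℝ) : ℂ) = ⟪D.vec, (D.ofFun g : H →L[ℂ] H) D.vec⟫_ℂ := by
  let g' : CompactlySupportedContinuousMap D.X ℝ :=
    ⟨g, HasCompactSupport.of_compactSpace _⟩
  have h : ∫ x, g x ∂D.μ = (⟪D.vec, (D.ofFun g : H →L[ℂ] H) D.vec⟫_ℂ).re :=
    RealRMK.integral_rieszMeasure D.functional g'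
  have hsa : star (D.ofFun g) = D.ofFun g := D.eq_of_forall fun x => by
    rw [map_star, ofFun_apply, Complex.star_def, Complex.conj_ofReal]
  have hsa' : star (D.ofFun g : H →L[ℂ] H) = D.ofFun g := congrArg Subtype.val hsa
  rw [h]
  refine Complex.conj_eq_iff_re.1 ?_
  rw [inner_conj_symm, ← star_inner', hsa']

theorem integral_eval (c : D.C) : ∫ x, x c ∂D.μ = ⟪D.vec, (c : H →L[ℂ] H) D.vec⟫_ℂ := by
  let g := gelfandStarTransform D.C c
  have hg : ∀ x, g x = x c := fun _ => rfl
  let r : C(D.X, ℝ) := ⟨fun x => (g x).re, Complex.continuous_re.comp g.continuous⟩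
  let i : C(D.X, ℝ) := ⟨fun x => (g x).im, Complex.continuous_im.comp g.continuous⟩
  have hc : c = D.ofFun r + Complex.I • D.ofFun i := D.eq_of_forall fun x => by
    rw [map_add, map_smul, ofFun_apply, ofFun_apply, smul_eq_mul, mul_comm]
    exact (Complex.re_add_im (g x)).symm
  have hi : Integrable (fun x : D.X => x c) D.μ :=
    (D.continuous_eval c).integrable_of_hasCompactSupport (.of_compactSpace _)
  rw [← integral_re_add_im hi]
  conv_rhs => rw [hc]
  have e1 := D.integral_eval_ofFun r
  have e2 := D.integral_eval_ofFun i
  change ((∫ x, r x ∂D.μ : ℝ) : ℂ) + ((∫ x, i x ∂D.μ : ℝ) : ℂ) * Complex.I = _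
  rw [e1, e2]
  change _ = ⟪D.vec, (D.ofFun r : H →L[ℂ] H) D.vec
    + Complex.I • (D.ofFun i : H →L[ℂ] H) D.vec⟫_ℂ
  rw [inner_add_right, inner_smul_right, mul_comm]

/-- Since e fixes the vector, `E` preserves the vector state, and on the abelian algebra that state
is integration against μ. -/
theorem integral_ψ (A : D.C') : ∫ x, D.ψ x A ∂D.μ = ⟪D.vec, (A : H →L[ℂ] H) D.vec⟫_ℂ := by
  rw [← inner_vec_E, ← integral_eval]
  rfl

theorem integral_mul_ψ (g : C(D.X, ℂ)) (A : D.C') :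
    ∫ x, g x * D.ψ x A ∂D.μ
      = ⟪D.vec, (D.ofCFun g : H →L[ℂ] H) ((A : H →L[ℂ] H) D.vec)⟫_ℂ := by
  have h := D.integral_ψ (D.incl (D.ofCFun g) * A)
  simp only [ψ_mul, ofCFun_apply] at h
  exact h

/-- The vector field `x ↦ π_{ψ_x}(A) Ω_{ψ_x}`. -/
def vf (A : D.C') (x : D.X) : D.fiber x := D.π x A (D.Ω x)

theorem vf_eq (A : D.C') (x : D.X) : D.vf A x = ((D.ψ x).toPreGNS A : (D.ψ x).PreGNS) := by
  change (D.ψ x).gnsNonUnitalStarAlgHom A (((D.ψ x).toPreGNS 1 : (D.ψ x).PreGNS) : (D.ψ x).GNS) = _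
  rw [PositiveLinearMap.gnsNonUnitalStarAlgHom_apply_coe]
  simp

theorem inner_vf (A B : D.C') (x : D.X) : ⟪D.vf A x, D.vf B x⟫_ℂ = D.ψ x (star A * B) := by
  rw [vf_eq, vf_eq, UniformSpace.Completion.inner_coe]
  rfl

theorem π_vf (A B : D.C') (x : D.X) : D.π x A (D.vf B x) = D.vf (A * B) x := by
  unfold vf
  rw [map_mul]
  rfl

theorem vf_sub (A B : D.C') (x : D.X) : D.vf (A - B) x = D.vf A x - D.vf B x := by
  unfold vf
  rw [map_sub]
  rfl

theorem vf_smul (r : ℂ) (A : D.C') (x : D.X) : D.vf (r • A) x = r • D.vf A x := by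
  unfold vf
  rw [map_smul]
  rfl

theorem continuous_inner_vf (A B : D.C') : Continuous fun x => ⟪D.vf A x, D.vf B x⟫_ℂ := by
  simp only [inner_vf]
  exact D.continuous_ψ _

theorem norm_vf_sq (A : D.C') (x : D.X) : ‖D.vf A x‖ ^ 2 = (D.ψ x (star A * A)).re := by
  rw [← inner_vf]
  exact (inner_self_eq_norm_sq (𝕜 := ℂ) _).symm

theorem norm_vf_sq' (A : D.C') (x : D.X) : ((‖D.vf A x‖ ^ 2 : ℝ) : ℂ) = D.ψ x (star A * A) := by
  rw [← inner_vf, inner_self_eq_norm_sq_to_K]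
  simp

theorem continuous_norm_vf_sq (A : D.C') : Continuous fun x => ‖D.vf A x‖ ^ 2 := by
  simp only [norm_vf_sq]
  exact Complex.continuous_re.comp (D.continuous_ψ _)

/-- This isometry lets limits in H be taken fibrewise. -/
theorem integral_norm_vf_sq (A : D.C') :
    ∫ x, ‖D.vf A x‖ ^ 2 ∂D.μ = ‖(A : H →L[ℂ] H) D.vec‖ ^ 2 := by
  have h := D.integral_ψ (star A * A)
  simp only [← norm_vf_sq'] at h
  rw [integral_complex_ofReal] at h
  have h2 : ⟪D.vec, ((star A * A : D.C') : H →L[ℂ] H) D.vec⟫_ℂ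
      = ((‖(A : H →L[ℂ] H) D.vec‖ ^ 2 : ℝ) : ℂ) := by
    change ⟪D.vec, (star (A : H →L[ℂ] H)) ((A : H →L[ℂ] H) D.vec)⟫_ℂ = _
    rw [star_inner', inner_self_eq_norm_sq_to_K]
    simp
  rw [h2] at h
  exact_mod_cast h

theorem exists_norm_vf_le (A : D.C') : ∃ C : ℝ, 0 ≤ C ∧ ∀ x, ‖D.vf A x‖ ≤ C := by
  obtain ⟨C, hC⟩ := (isCompact_range (D.continuous_norm_vf_sq A)).bddAbove
  refine ⟨√(max C 0), Real.sqrt_nonneg _, fun x => Real.le_sqrt_of_sq_le ?_⟩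
  exact (hC ⟨x, rfl⟩).trans (le_max_left _ _)

/-- The algebra acts in the fiber over `x` by evaluation at `x`. -/
theorem vf_incl_mul (c : D.C) (A : D.C') (x : D.X) : D.vf (D.incl c * A) x = x c • D.vf A x := by
  rw [← sub_eq_zero, ← vf_smul, ← vf_sub, ← norm_eq_zero, ← sq_eq_zero_iff]
  -- k vanishes at x, and the squared norm of `vf (k A) x` is ψ_x(k*k A*A) = |x(k)|² ψ_x(A*A) = 0.
  let k : D.C := c - algebraMap ℂ D.C (x c)
  have hk : D.incl c * A - x c • A = D.incl k * A := by
    have : D.incl k = D.incl c - algebraMap ℂ D.C' (x c) := rfl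
    rw [this, sub_mul, Algebra.smul_def]
  have hstar : star (D.incl k * A) * (D.incl k * A) = D.incl (star k * k) * (star A * A) := by
    have h1 : star (D.incl k) = D.incl (star k) := rfl
    have h2 : D.incl (star k * k) = D.incl (star k) * D.incl k := rfl
    have h3 : star A * (D.incl (star k) * D.incl k) = D.incl (star k) * D.incl k * star A := by
      refine Subtype.ext ?_
      exact (VonNeumannAlgebra.mem_commutant_iff.1 (star A).2 _ (star k * k).2).symm
    rw [star_mul, h1, h2, mul_assoc, ← mul_assoc (D.incl (star k)), ← mul_assoc, h3, mul_assoc]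
  have hx : x k = 0 := by
    simp only [k, map_sub]
    rw [AlgHomClass.commutes]
    simp
  rw [hk, norm_vf_sq, hstar, ψ_mul, map_mul, hx, mul_zero, zero_mul, Complex.zero_re]

theorem rankOne_incl_mul (c : D.C) (A B : D.C') (x : D.X) {r : ℂ} (h : x c = r) :
    rankOne ℂ (D.vf (D.incl c * A) x) (D.vf B x) = r • rankOne ℂ (D.vf A x) (D.vf B x) :=
  (congrArg (fun v => rankOne ℂ v (D.vf B x)) (D.vf_incl_mul c A x)).trans
    ((rankOne_smul_left _ _ _).trans (by rw [h]))

/-! ### Elementary fields -/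

theorem rankOne_mem (A B : D.C') :
    (fun x => rankOne ℂ (D.vf A x) (D.vf B x)) ∈ D.elementaryFields :=
  Submodule.subset_span ⟨A, B, rfl⟩

theorem exists_eq_sum {a : D.OperatorField} (ha : a ∈ D.elementaryFields) :
    ∃ (n : ℕ) (A B : Fin n → D.C'), a = fun x => ∑ j, rankOne ℂ (D.vf (A j) x) (D.vf (B j) x) := by
  induction ha using Submodule.span_induction with
  | mem a h =>
    obtain ⟨A, B, rfl⟩ := h
    exact ⟨1, fun _ => A, fun _ => B, by simp [vf]⟩
  | zero => exact ⟨0, Fin.elim0, Fin.elim0, by ext; simp⟩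
  | add a b _ _ iha ihb =>
    obtain ⟨n, A, B, rfl⟩ := iha
    obtain ⟨m, A', B', rfl⟩ := ihb
    refine ⟨n + m, Fin.append A A', Fin.append B B', ?_⟩
    funext x
    simp [Fin.sum_univ_add]
  | smul r a _ iha =>
    obtain ⟨n, A, B, rfl⟩ := iha
    refine ⟨n, fun j => r • A j, B, ?_⟩
    funext x
    simp [vf_smul, Finset.smul_sum]

theorem finset_sum_mem {ι : Type*} (s : Finset ι) {a : ι → D.OperatorField}
    (h : ∀ j, a j ∈ D.elementaryFields) : (fun x => ∑ j ∈ s, a j x) ∈ D.elementaryFields := by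
  classical
  induction s using Finset.induction_on with
  | empty => exact D.elementaryFields.zero_mem
  | insert j s hj ih =>
    simp only [Finset.sum_insert hj]
    exact D.elementaryFields.add_mem (h j) ih

theorem sum_mem {n : ℕ} (A B : Fin n → D.C') :
    (fun x => ∑ j, rankOne ℂ (D.vf (A j) x) (D.vf (B j) x)) ∈ D.elementaryFields :=
  D.finset_sum_mem _ fun j => D.rankOne_mem (A j) (B j)

/-- The inner product ⟨`vf B x`, `vf A' x`⟩ produced by multiplying two generators is the Gelfand
transform of E(B*A'), so it can be moved into the first section as an element of the abelian
algebra. -/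
theorem mul_mem {a b : D.OperatorField} (ha : a ∈ D.elementaryFields)
    (hb : b ∈ D.elementaryFields) : (fun x => a x * b x) ∈ D.elementaryFields := by
  obtain ⟨n, A, B, rfl⟩ := D.exists_eq_sum ha
  obtain ⟨m, A', B', rfl⟩ := D.exists_eq_sum hb
  have : (fun x => (∑ j, rankOne ℂ (D.vf (A j) x) (D.vf (B j) x))
      * ∑ k, rankOne ℂ (D.vf (A' k) x) (D.vf (B' k) x))
      = fun x => ∑ j, ∑ k, rankOne ℂ (D.vf (D.incl (D.E (star (B j) * A' k)) * A j) x)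
        (D.vf (B' k) x) := by
    funext x
    exact sum_rankOne_mul_sum_rankOne _ _ _ _ _ fun j k =>
      (D.vf_incl_mul _ _ _).trans (congrArg (· • D.vf (A j) x) (D.inner_vf (B j) (A' k) x).symm)
  rw [this]
  exact D.finset_sum_mem _ fun j => D.finset_sum_mem _ fun k => D.rankOne_mem _ _

theorem star_mem_elementaryFields {a : D.OperatorField} (ha : a ∈ D.elementaryFields) :
    (fun x => star (a x)) ∈ D.elementaryFields := by
  obtain ⟨n, A, B, rfl⟩ := D.exists_eq_sum ha
  have : (fun x => star (∑ j, rankOne ℂ (D.vf (A j) x) (D.vf (B j) x)))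
      = fun x => ∑ j, rankOne ℂ (D.vf (B j) x) (D.vf (A j) x) := by
    funext x
    simp [star_sum, ContinuousLinearMap.star_eq_adjoint]
  rw [this]
  exact D.sum_mem _ _

theorem smul_mem_elementaryFields (g : C(D.X, ℂ)) {a : D.OperatorField}
    (ha : a ∈ D.elementaryFields) : (fun x => g x • a x) ∈ D.elementaryFields := by
  obtain ⟨n, A, B, rfl⟩ := D.exists_eq_sum ha
  have : (fun x => g x • ∑ j, rankOne ℂ (D.vf (A j) x) (D.vf (B j) x))
      = fun x => ∑ j, rankOne ℂ (D.vf (D.incl (D.ofCFun g) * A j) x) (D.vf (B j) x) := by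
    funext x
    rw [Finset.smul_sum]
    refine Finset.sum_congr rfl fun j _ => ?_
    exact (D.rankOne_incl_mul _ _ _ _ (D.ofCFun_apply g x)).symm
  rw [this]
  exact D.sum_mem _ _

theorem exists_norm_le {a : D.OperatorField} (ha : a ∈ D.elementaryFields) :
    ∃ C : ℝ, 0 ≤ C ∧ ∀ x, ‖a x‖ ≤ C := by
  induction ha using Submodule.span_induction with
  | mem a h =>
    obtain ⟨A, B, rfl⟩ := h
    obtain ⟨C, hC, h1⟩ := D.exists_norm_vf_le A
    obtain ⟨C', hC', h2⟩ := D.exists_norm_vf_le B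
    refine ⟨C * C', by positivity, fun x => ?_⟩
    rw [norm_rankOne]
    exact mul_le_mul (h1 x) (h2 x) (norm_nonneg _) hC
  | zero => exact ⟨0, le_rfl, by simp⟩
  | add a b _ _ iha ihb =>
    obtain ⟨C, hC, h1⟩ := iha
    obtain ⟨C', hC', h2⟩ := ihb
    exact ⟨C + C', by positivity, fun x => (norm_add_le _ _).trans (add_le_add (h1 x) (h2 x))⟩
  | smul r a _ iha =>
    obtain ⟨C, hC, h1⟩ := iha
    refine ⟨‖r‖ * C, by positivity, fun x => ?_⟩
    change ‖r • a x‖ ≤ _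
    rw [norm_smul]
    exact mul_le_mul_of_nonneg_left (h1 x) (norm_nonneg _)

theorem continuous_inner_elementary {a : D.OperatorField} (ha : a ∈ D.elementaryFields)
    (A B : D.C') : Continuous fun x => ⟪D.vf A x, a x (D.vf B x)⟫_ℂ := by
  obtain ⟨n, A', B', rfl⟩ := D.exists_eq_sum ha
  simp only [_root_.sum_apply, inner_sum, rankOne_apply, inner_smul_right]
  refine continuous_finsetSum _ fun j _ => ?_
  exact (D.continuous_inner_vf _ _).mul (D.continuous_inner_vf _ _)

/-! ### Approximation of functions by continuous functions -/

theorem exists_continuous_integral_sub_le {g : D.X → ℂ} (hg : Integrable g D.μ) {ε : ℝ}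
    (hε : 0 < ε) : ∃ k : C(D.X, ℂ), ∫ x, ‖g x - k x‖ ∂D.μ ≤ ε := by
  obtain ⟨k, hk, -⟩ := hg.exists_boundedContinuous_integral_sub_le hε
  exact ⟨k.toContinuousMap, hk⟩

/-- Every almost everywhere measurable function is almost everywhere the limit of a sequence of
continuous functions. -/
theorem exists_continuous_tendsto {g : D.X → ℝ} (hg : AEStronglyMeasurable g D.μ) :
    ∃ k : ℕ → C(D.X, ℝ), ∀ᵐ x ∂D.μ, Tendsto (fun n => k n x) atTop (𝓝 (g x)) := by
  -- The function g need not be integrable; its image under a homeomorphism of ℝ onto (-1, 1) is,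
  -- because μ is finite.
  set φ : D.X → ℝ := fun x => g x / (1 + |g x|)
  have hcont : Continuous fun t : ℝ => t / (1 + |t|) :=
    continuous_id.div (by fun_prop) fun t => by positivity
  have habs : ∀ x, |φ x| < 1 := fun x => by
    have : 0 < 1 + |g x| := by positivity
    rw [abs_div, abs_of_pos this, div_lt_one this]
    linarith
  have hφ : Integrable φ D.μ := by
    refine Integrable.of_bound (hcont.comp_aestronglyMeasurable hg) 1 ?_
    exact Eventually.of_forall fun x => (habs x).le
  choose h hh hint using fun n : ℕ =>
    hφ.exists_boundedContinuous_integral_sub_le (ε := 1 / ((n : ℝ) + 1)) (by positivity)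
  have hlim : TendstoInMeasure D.μ (fun n x => h n x) atTop φ := by
    refine tendstoInMeasure_of_tendsto_eLpNorm one_ne_zero
      (fun n => (hint n).aestronglyMeasurable) hφ.aestronglyMeasurable ?_
    have h0 : Tendsto (fun n : ℕ => ENNReal.ofReal (1 / ((n : ℝ) + 1))) atTop (𝓝 0) := by
      have := ENNReal.tendsto_ofReal (tendsto_one_div_add_atTop_nhds_zero_nat (𝕜 := ℝ))
      rwa [ENNReal.ofReal_zero] at this
    refine tendsto_of_tendsto_of_tendsto_of_le_of_le tendsto_const_nhds h0 (fun _ => zero_le)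
      fun n => ?_
    have h2 := ENNReal.ofReal_le_ofReal (hh n)
    have h3 := ofReal_integral_norm_eq_lintegral_enorm (hφ.sub (hint n))
    simp only [Pi.sub_apply] at h3
    rw [h3] at h2
    rw [eLpNorm_one_eq_lintegral_enorm]
    refine le_trans (le_of_eq ?_) h2
    refine lintegral_congr fun x => ?_
    rw [← enorm_neg]
    simp
  obtain ⟨ns, -, hns⟩ := hlim.exists_seq_tendsto_ae
  -- The inverse homeomorphism is s ↦ s/(1 - |s|). The approximants may leave (-1, 1), so the
  -- denominator is kept above 1/(n + 1), a floor that disappears in the limit.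
  refine ⟨fun n => ⟨fun x => h (ns n) x / max (1 - |h (ns n) x|) (1 / ((n : ℝ) + 1)), ?_⟩, ?_⟩
  · refine (h (ns n)).continuous.div (by fun_prop) fun x => ?_
    have : 0 < 1 / ((n : ℝ) + 1) := by positivity
    exact (lt_max_of_lt_right this).ne'
  · filter_upwards [hns] with x hx
    have hpos : 0 < 1 - |φ x| := sub_pos.2 (habs x)
    have hd : Tendsto (fun n : ℕ => max (1 - |h (ns n) x|) (1 / ((n : ℝ) + 1))) atTop
        (𝓝 (1 - |φ x|)) := by
      have := (tendsto_const_nhds.sub hx.abs).max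
        (tendsto_one_div_add_atTop_nhds_zero_nat (𝕜 := ℝ)) (f := fun n => (1 : ℝ) - |h (ns n) x|)
      rwa [max_eq_left hpos.le] at this
    have hlim := hx.div hd hpos.ne'
    have : φ x / (1 - |φ x|) = g x := by
      have h1 : 0 < 1 + |g x| := by positivity
      have h2 : 1 - |φ x| = 1 / (1 + |g x|) := by
        simp only [φ]
        rw [abs_div, abs_of_pos h1]
        field_simp
        ring
      rw [h2]
      simp only [φ]
      field_simp
    rw [this] at hlim
    exact hlim

end AbelianSystem

/-! ### Compressing density operators, and approximate units in a single fibre. -/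

section DensityOperators

open ContinuousLinearMap InnerProductSpace

variable {K : Type u} [NormedAddCommGroup K] [InnerProductSpace ℂ K] [CompleteSpace K]

theorem norm_apply_le_hsNorm {X : K →L[ℂ] K} (hX : hsSq X ≠ ⊤) (v : K) :
    ‖X v‖ ≤ hsNorm X * ‖v‖ := by
  have hX' : hsSq (star X) ≠ ⊤ := by rwa [hsSq_star]
  refine le_of_sq_le_sq ?_ (mul_nonneg (hsNorm_nonneg _) (norm_nonneg _))
  rw [← (hasSum_norm_inner_sq (X v)).tsum_eq, mul_pow, ← hsNorm_star, hsNorm_sq, hsSq_toReal,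
    ← tsum_mul_right]
  refine Summable.tsum_le_tsum (fun i => ?_) (hasSum_norm_inner_sq (X v)).summable
    ((summable_of_hsSq hX').mul_right _)
  rw [← mul_pow, ← adjoint_inner_left]
  exact pow_le_pow_left₀ (norm_nonneg _) (norm_inner_le_norm _ _) 2

theorem star_sqrt (T : K →L[ℂ] K) : star (CFC.sqrt T) = CFC.sqrt T :=
  (IsSelfAdjoint.of_nonneg (CFC.sqrt_nonneg _)).star_eq

section

variable {T : K →L[ℂ] K} (hT : 0 ≤ T) (htc : IsTraceClass T)
include hT htc

/-- Splitting T into two Hilbert-Schmidt factors T^(1/2) makes cyclicity of the trace available. -/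
theorem trace_mul_eq (B : K →L[ℂ] K) :
    trace (B * T) = trace (CFC.sqrt T * (B * CFC.sqrt T)) := by
  have hS := (hsSq_sqrt hT htc).1
  rw [trace_mul_comm hS (hsSq_mul_ne_top B hS), mul_assoc, CFC.sqrt_mul_sqrt_self T hT]

theorem trace_star_mul_nonneg (B : K →L[ℂ] K) : 0 ≤ trace (star B * B * T) := by
  rw [trace_mul_eq hT htc]
  have : CFC.sqrt T * (star B * B * CFC.sqrt T) = star (B * CFC.sqrt T) * (B * CFC.sqrt T) := by
    rw [star_mul, star_sqrt, mul_assoc, mul_assoc]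
  rw [this, trace_star_mul_self]
  exact Complex.zero_le_real.2 ENNReal.toReal_nonneg

theorem norm_le_of_trace_eq_one (h1 : trace T = 1) : ‖T‖ ≤ 1 := by
  obtain ⟨hS, htr⟩ := hsSq_sqrt hT htc
  have hn : hsNorm (CFC.sqrt T) = 1 := by
    rw [h1] at htr
    rw [hsNorm, show (hsSq (CFC.sqrt T)).toReal = 1 from by exact_mod_cast htr, Real.sqrt_one]
  have hS1 : ‖CFC.sqrt T‖ ≤ 1 := opNorm_le_bound _ zero_le_one fun v => by
    rw [← hn]; exact norm_apply_le_hsNorm hS v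
  rw [← CFC.sqrt_mul_sqrt_self T hT]
  exact (norm_mul_le _ _).trans (mul_le_one₀ hS1 (norm_nonneg _) hS1)

theorem hsNorm_sqrt_eq_one (h1 : trace T = 1) : hsNorm (CFC.sqrt T) = 1 := by
  obtain ⟨hS, htr⟩ := hsSq_sqrt hT htc
  rw [h1] at htr
  rw [hsNorm, show (hsSq (CFC.sqrt T)).toReal = 1 from by exact_mod_cast htr, Real.sqrt_one]

/-- The trace functional of a density operator is close to that of its compression. -/
theorem norm_trace_sub_compress_le (h1 : trace T = 1) (B p : K →L[ℂ] K) :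
    ‖trace (B * T) - trace (B * (p * T * star p))‖
      ≤ ‖B‖ * (1 + ‖p‖) * hsNorm ((1 - p) * CFC.sqrt T) := by
  obtain ⟨hS, htr⟩ := hsSq_sqrt hT htc
  set S := CFC.sqrt T
  have hn : hsNorm S = 1 := hsNorm_sqrt_eq_one hT htc h1
  have hSS : S * S = T := CFC.sqrt_mul_sqrt_self T hT
  have hstar : star S = S := star_sqrt T
  have e1 : B * T = (B * S) * S := by rw [mul_assoc, hSS]
  have e2 : B * (p * T * star p) = (B * p * S) * (S * star p) := by
    rw [← hSS]; simp only [mul_assoc]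
  have h3 : hsSq ((1 - p) * S) ≠ ⊤ := hsSq_mul_ne_top _ hS
  have h3' : hsSq (star ((1 - p) * S)) ≠ ⊤ := by rwa [hsSq_star]
  -- The difference T - pTp* is (1 - p)T + pT(1 - p)*. Each summand contains the small factor (1 -
  -- p)T^(1/2) or its adjoint.
  have e3 : B * T - B * (p * T * star p)
      = (B * ((1 - p) * S)) * S + (B * p * S) * star ((1 - p) * S) := by
    rw [e1, e2, star_mul, hstar, star_sub, star_one]
    noncomm_ring
  rw [← trace_sub (e1 ▸ summable_trace_mul (hsSq_mul_ne_top B hS) hS)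
    (e2 ▸ summable_trace_mul (hsSq_mul_ne_top (B * p) hS) (hsSq_mul_ne_top' _ hS)), e3,
    trace_add (summable_trace_mul (hsSq_mul_ne_top B h3) hS)
      (summable_trace_mul (hsSq_mul_ne_top (B * p) hS) h3')]
  have b1 := norm_trace_mul_le (hsSq_mul_ne_top B h3) hS
  have b2 := norm_trace_mul_le (hsSq_mul_ne_top (B * p) hS) h3'
  rw [hn, mul_one] at b1
  rw [hsNorm_star] at b2
  have b3 := hsNorm_mul_le B h3
  have b4 : hsNorm (B * p * S) ≤ ‖B‖ * ‖p‖ := by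
    refine (hsNorm_mul_le (B * p) hS).trans ?_
    rw [hn, mul_one]; exact norm_mul_le _ _
  have b5 := mul_le_mul_of_nonneg_right b4 (hsNorm_nonneg ((1 - p) * S))
  refine (norm_add_le _ _).trans ?_
  calc _ ≤ ‖B‖ * hsNorm ((1 - p) * S) + ‖B‖ * ‖p‖ * hsNorm ((1 - p) * S) :=
        add_le_add (b1.trans b3) (b2.trans b5)
    _ = _ := by ring

/-- With r = p* + p - p*p, the square of (1 - p)T^(1/2) is T - T^(1/2) r T^(1/2), of trace 1 -
Tr(Tr). As r has finite rank, the error is expressed by finitely many matrix elements of T, which is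
how its measurability is obtained. -/
theorem hsNorm_sq_eq (h1 : trace T = 1) {n : ℕ} (p : K →L[ℂ] K) (u v : Fin n → K)
    (h : star p + p - star p * p = ∑ j, rankOne ℂ (u j) (v j)) :
    ((hsNorm ((1 - p) * CFC.sqrt T) ^ 2 : ℝ) : ℂ) = 1 - ∑ j, ⟪v j, T (u j)⟫_ℂ := by
  obtain ⟨hS, htr⟩ := hsSq_sqrt hT htc
  set S := CFC.sqrt T
  have hSS : S * S = T := CFC.sqrt_mul_sqrt_self T hT
  have hstar : star S = S := star_sqrt T
  set r := ∑ j, rankOne ℂ (u j) (v j)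
  have e1 : star ((1 - p) * S) * ((1 - p) * S) = S * S - S * (r * S) := by
    rw [← h, star_mul, hstar, star_sub, star_one]
    noncomm_ring
  rw [hsNorm_sq, ← trace_star_mul_self, e1, trace_sub (summable_trace_mul hS hS)
    (summable_trace_mul hS (hsSq_mul_ne_top r hS)), hSS, h1]
  congr 1
  have e2 : T * r = ∑ j, rankOne ℂ (T (u j)) (v j) := by
    rw [Finset.mul_sum]
    exact Finset.sum_congr rfl fun j _ => comp_rankOne _ _ _
  rw [← mul_assoc, trace_mul_comm (hsSq_mul_ne_top' r hS) hS, ← mul_assoc, hSS, e2,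
    trace_sum_rankOne]

end

theorem trace_mul_compress {n : ℕ} (B T : K →L[ℂ] K) (u v : Fin n → K) {p : K →L[ℂ] K}
    (hp : p = ∑ j, rankOne ℂ (u j) (v j)) :
    trace (B * (p * T * star p))
      = ∑ q : Fin n × Fin n, ⟪v q.1, T (v q.2)⟫_ℂ * ⟪u q.2, B (u q.1)⟫_ℂ := by
  have e : B * (p * T * star p)
      = ∑ q : Fin n × Fin n, rankOne ℂ (⟪v q.1, T (v q.2)⟫_ℂ • B (u q.1)) (u q.2) := by
    have hs : star p = ∑ k, rankOne ℂ (v k) (u k) := by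
      rw [hp, star_sum]
      exact Finset.sum_congr rfl fun j _ => adjoint_rankOne _ _
    rw [hs, hp, Fintype.sum_prod_type, Finset.sum_mul, Finset.sum_mul_sum, Finset.mul_sum]
    refine Finset.sum_congr rfl fun j _ => ?_
    rw [Finset.mul_sum]
    refine Finset.sum_congr rfl fun k _ => ?_
    ext w
    simp [smul_smul, mul_comm]
  rw [e, trace_sum_rankOne]
  simp

theorem norm_pow_sub_pow_le {x y : K →L[ℂ] K} (hx : ‖x‖ ≤ 1) (hy : ‖y‖ ≤ 1) (n : ℕ) :
    ‖x ^ n - y ^ n‖ ≤ n * ‖x - y‖ := by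
  induction n with
  | zero => simp
  | succ n ih =>
    have e : x ^ (n + 1) - y ^ (n + 1) = x ^ n * (x - y) + (x ^ n - y ^ n) * y := by
      rw [pow_succ, pow_succ]; noncomm_ring
    have hxn : ‖x ^ n‖ ≤ 1 := by
      rcases Nat.eq_zero_or_pos n with rfl | hn
      · rw [pow_zero]; exact norm_id_le
      · exact (norm_pow_le' x hn).trans (pow_le_one₀ (norm_nonneg _) hx)
    rw [e]
    have h1 : ‖x ^ n * (x - y)‖ ≤ ‖x - y‖ :=
      (norm_mul_le _ _).trans (mul_le_of_le_one_left (norm_nonneg _) hxn)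
    have h2 : ‖(x ^ n - y ^ n) * y‖ ≤ n * ‖x - y‖ :=
      ((norm_mul_le _ _).trans (mul_le_of_le_one_right (norm_nonneg _) hy)).trans ih
    push_cast
    linarith [norm_add_le (x ^ n * (x - y)) ((x ^ n - y ^ n) * y)]

theorem norm_one_sub_le {G : K →L[ℂ] K} (h0 : 0 ≤ G) (h1 : G ≤ 1) : ‖1 - G‖ ≤ 1 :=
  (CStarAlgebra.norm_le_one_iff_of_nonneg _ (sub_nonneg.2 h1)).2 (sub_le_self _ h0)

theorem norm_one_sub_pow_le {G : K →L[ℂ] K} (h0 : 0 ≤ G) (h1 : G ≤ 1) (n : ℕ) :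
    ‖(1 - G) ^ n‖ ≤ 1 := by
  rcases Nat.eq_zero_or_pos n with rfl | hn
  · rw [pow_zero]; exact norm_id_le
  · exact (norm_pow_le' _ hn).trans (pow_le_one₀ (norm_nonneg _) (norm_one_sub_le h0 h1))

section

variable {b : ℕ → K →L[ℂ] K} (h0 : ∀ k, 0 ≤ b k) (hb : ∀ k, ‖b k‖ ≤ (1 / 2) ^ (k + 1))
include h0 hb

theorem sum_nonneg_le_one (n : ℕ) :
    0 ≤ ∑ k ∈ Finset.range n, b k ∧ ∑ k ∈ Finset.range n, b k ≤ 1 := by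
  have hnn : 0 ≤ ∑ k ∈ Finset.range n, b k := Finset.sum_nonneg fun k _ => h0 k
  refine ⟨hnn, (CStarAlgebra.norm_le_one_iff_of_nonneg _ hnn).1 ?_⟩
  refine (norm_sum_le_of_le _ fun k _ => hb k).trans ?_
  have hs : HasSum (fun k : ℕ => ((1 : ℝ) / 2) ^ (k + 1)) 1 := by
    refine (hasSum_geometric_two' 1).congr_fun fun k => ?_
    rw [pow_succ, one_div, inv_pow]; ring
  exact sum_le_hasSum _ (fun k _ => by positivity) hs

/-- Powers of `1 - ∑_{k<n} bₖ`, for summable positive `bₖ`, converge to zero on the orthogonal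
complement of the common kernel. -/
theorem tendsto_one_sub_sum_pow {w : K} (hw : ∀ z, (∀ k, b k z = 0) → ⟪z, w⟫_ℂ = 0) :
    Tendsto (fun n => ((1 - ∑ k ∈ Finset.range n, b k) ^ n : K →L[ℂ] K) w) atTop (𝓝 0) := by
  have hgeo : HasSum (fun k : ℕ => ((1 : ℝ) / 2) ^ (k + 1)) 1 := by
    refine (hasSum_geometric_two' 1).congr_fun fun k => ?_
    rw [pow_succ, one_div, inv_pow]; ring
  have hsum : Summable b := .of_norm_bounded hgeo.summable hb
  set G := ∑' k, b k
  have hG : HasSum b G := hsum.hasSum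
  have hGv : ∀ v, HasSum (fun k => ⟪b k v, v⟫_ℂ) ⟪G v, v⟫_ℂ := fun v => by
    have h1 := hG.mapL (ContinuousLinearMap.apply ℂ K v)
    have h2 := h1.mapL (innerSL ℂ v)
    have h3 := Complex.hasSum_conj'.2 h2
    simpa using h3
  have hG0 : 0 ≤ G := by
    rw [nonneg_iff_inner]
    intro v
    exact (hGv v).nonneg fun k => (nonneg_iff_inner _).1 (h0 k) v
  have hG1 : G ≤ 1 := (CStarAlgebra.norm_le_one_iff_of_nonneg _ hG0).1
    (tsum_of_norm_bounded hgeo hb)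
  -- The form of G is the sum of the nonnegative forms of the b_k, so a vector killed by G is killed
  -- by each b_k.
  have hker : w ∈ (G.ker)ᗮ := by
    rw [Submodule.mem_orthogonal]
    intro z hz
    have hz' : G z = 0 := hz
    refine hw z fun k => ?_
    have h1 := Complex.hasSum_re (hGv z)
    rw [hz', inner_zero_left, Complex.zero_re] at h1
    have h2 := (hasSum_zero_iff_of_nonneg fun k => ((nonneg_iff_inner _).1 (h0 k) z).1).1 h1
    have h3 := norm_apply_sq_le (h0 k) z
    have h4 : (⟪b k z, z⟫_ℂ).re = 0 := congrFun h2 k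
    rw [h4, mul_zero] at h3
    simpa using le_antisymm h3 (sq_nonneg _)
  -- Replacing the partial sum by G inside the n-th power costs at most n times this tail, and n 2⁻ⁿ
  -- still tends to 0.
  have htail : ∀ n, ‖(1 - ∑ k ∈ Finset.range n, b k) - (1 - G)‖ ≤ (1 / 2) ^ n := by
    intro n
    have : (1 - ∑ k ∈ Finset.range n, b k) - (1 - G) = ∑' k, b (k + n) := by
      rw [sub_sub_sub_cancel_left]
      exact sub_eq_of_eq_add' (hsum.sum_add_tsum_nat_add n).symm
    rw [this]
    have h2 := hgeo.mul_left ((1 / 2 : ℝ) ^ n)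
    rw [mul_one] at h2
    refine tsum_of_norm_bounded h2 fun k => (hb _).trans_eq ?_
    rw [← pow_add]; congr 1; ring
  have hlim := tendsto_one_sub_pow hG0 hG1 hker
  have hdiff : Tendsto (fun n : ℕ => ((n : ℝ) * (1 / 2) ^ n) * ‖w‖) atTop (𝓝 0) := by
    have := (tendsto_self_mul_const_pow_of_lt_one (r := (1 / 2 : ℝ)) (by norm_num)
      (by norm_num)).mul_const ‖w‖
    rwa [zero_mul] at this
  have hz : Tendsto (fun n => ((1 - ∑ k ∈ Finset.range n, b k) ^ n - (1 - G) ^ n : K →L[ℂ] K) w)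
      atTop (𝓝 0) := by
    refine squeeze_zero_norm (fun n => ?_) hdiff
    refine (le_opNorm _ _).trans (mul_le_mul_of_nonneg_right ?_ (norm_nonneg _))
    obtain ⟨s0, s1⟩ := sum_nonneg_le_one h0 hb n
    refine (norm_pow_sub_pow_le (norm_one_sub_le s0 s1) (norm_one_sub_le hG0 hG1) n).trans ?_
    exact mul_le_mul_of_nonneg_left (htail n) (Nat.cast_nonneg _)
  have := hz.add hlim
  rw [add_zero] at this
  refine this.congr fun n => ?_
  rw [sub_apply, sub_add_cancel]

end

end DensityOperators

section

open ContinuousLinearMap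

variable {K : Type u} [NormedAddCommGroup K] [InnerProductSpace ℂ K] [CompleteSpace K]

theorem mul_star_apply_eq_zero {a : K →L[ℂ] K} {z : K} (h : (a * star a) z = 0) :
    (star a) z = 0 := by
  have : ⟪(star a) z, (star a) z⟫_ℂ = 0 := by
    rw [star_eq_adjoint, adjoint_inner_left, ← star_eq_adjoint]
    change ⟪z, (a * star a) z⟫_ℂ = 0
    rw [h, inner_zero_right]
  exact inner_self_eq_zero.1 this

/-- Each a_k* kills z, and a_k* tends to T* = T, so T and hence T^(1/2) kill z. Thus the range of
T^(1/2) is orthogonal to the common kernel of the a_k a_k*. -/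
theorem inner_sqrt_eq_zero {T : K →L[ℂ] K} (hT : 0 ≤ T) {a : ℕ → K →L[ℂ] K}
    (ha : Tendsto a atTop (𝓝 T)) {z : K} (hz : ∀ k, (a k * star (a k)) z = 0) (v : K) :
    ⟪z, CFC.sqrt T v⟫_ℂ = 0 := by
  have hTz : T z = 0 := by
    have h1 : Tendsto (fun k => star (a k) z) atTop (𝓝 (star T z)) :=
      ((ContinuousLinearMap.apply ℂ K z).continuous.tendsto _).comp
        ((continuous_star.tendsto T).comp ha)
    rw [(IsSelfAdjoint.of_nonneg hT).star_eq] at h1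
    simp only [mul_star_apply_eq_zero (hz _)] at h1
    exact (tendsto_nhds_unique h1 tendsto_const_nhds)
  have hSz : CFC.sqrt T z = 0 := by
    rw [← star_sqrt T]
    refine mul_star_apply_eq_zero ?_
    rw [star_sqrt, CFC.sqrt_mul_sqrt_self T hT, hTz]
  rw [← star_sqrt, star_eq_adjoint, adjoint_inner_right, hSz, inner_zero_left]

/-- The Hilbert-Schmidt norm of `(1 - p) T^(1/2)`. -/
def compressError (p T : K →L[ℂ] K) : ℝ := hsNorm ((1 - p) * CFC.sqrt T)

theorem compressError_nonneg (p T : K →L[ℂ] K) : 0 ≤ compressError p T := hsNorm_nonneg _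

theorem compressError_le_one {T : K →L[ℂ] K} (hT : 0 ≤ T) (htc : IsTraceClass T)
    (h1 : trace T = 1) {p : K →L[ℂ] K} (hp : ‖1 - p‖ ≤ 1) : compressError p T ≤ 1 := by
  have h := hsNorm_mul_le (1 - p) (hsSq_sqrt hT htc).1
  rw [hsNorm_sqrt_eq_one hT htc h1, mul_one] at h
  exact h.trans hp

theorem norm_trace_sub_le_compressError {T : K →L[ℂ] K} (hT : 0 ≤ T) (htc : IsTraceClass T)
    (h1 : trace T = 1) {p : K →L[ℂ] K} (hp : ‖1 - p‖ ≤ 1) (B : K →L[ℂ] K) :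
    ‖trace (B * T) - trace (B * (p * T * star p))‖ ≤ 3 * ‖B‖ * compressError p T := by
  have hp2 : ‖p‖ ≤ 2 := by
    have h2 := norm_sub_le (1 : K →L[ℂ] K) (1 - p)
    rw [sub_sub_cancel] at h2
    have : ‖(1 : K →L[ℂ] K)‖ ≤ 1 := norm_id_le
    linarith
  refine (norm_trace_sub_compress_le hT htc h1 B p).trans
    (mul_le_mul_of_nonneg_right ?_ (compressError_nonneg _ _))
  nlinarith [norm_nonneg B]

theorem compressError_eq {T : K →L[ℂ] K} (hT : 0 ≤ T) (htc : IsTraceClass T)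
    (h1 : trace T = 1) {n : ℕ} (p : K →L[ℂ] K) (u v : Fin n → K)
    (h : star p + p - star p * p = ∑ j, InnerProductSpace.rankOne ℂ (u j) (v j)) :
    compressError p T = √(1 - ∑ j, ⟪v j, T (u j)⟫_ℂ).re := by
  rw [← hsNorm_sq_eq hT htc h1 p u v h, Complex.ofReal_re]
  exact (Real.sqrt_sq (hsNorm_nonneg _)).symm

/-- The right side builds the next element from the previous one and G without using the identity,
which need not be an elementary field. -/
theorem one_sub_one_sub_pow_succ {R : Type*} [Ring R] (G : R) (m : ℕ) :
    1 - (1 - G) ^ (m + 1) = (1 - (1 - G) ^ m) + (G - (1 - (1 - G) ^ m) * G) := by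
  rw [pow_succ]; noncomm_ring

/-- The positive elements `c a a*`, for `c` a small number. -/
def scaledSquare (c : ℝ) (a : K →L[ℂ] K) : K →L[ℂ] K := (c : ℂ) • (a * star a)

theorem scaledSquare_nonneg {c : ℝ} (hc : 0 ≤ c) (a : K →L[ℂ] K) : 0 ≤ scaledSquare c a :=
  smul_nonneg (Complex.zero_le_real.2 hc) (mul_star_self_nonneg _)

theorem norm_scaledSquare_le {a : K →L[ℂ] K} {C : ℝ} (h : ‖a‖ ≤ C) {δ : ℝ} (hδ : 0 ≤ δ) :
    ‖scaledSquare (δ / (C ^ 2 + 1)) a‖ ≤ δ := by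
  have hc : 0 ≤ δ / (C ^ 2 + 1) := by positivity
  rw [scaledSquare, norm_smul, Complex.norm_real, Real.norm_of_nonneg hc,
    CStarRing.norm_self_mul_star, ← sq]
  have h1 : ‖a‖ ^ 2 ≤ C ^ 2 + 1 := by
    have := pow_le_pow_left₀ (norm_nonneg _) h 2
    linarith
  calc _ ≤ δ / (C ^ 2 + 1) * (C ^ 2 + 1) := mul_le_mul_of_nonneg_left h1 hc
    _ = _ := div_mul_cancel₀ _ (by positivity)

theorem tendsto_compressError {T : K →L[ℂ] K} (hT : 0 ≤ T) (htc : IsTraceClass T)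
    {a : ℕ → K →L[ℂ] K} (ha : Tendsto a atTop (𝓝 T)) {c : ℕ → ℝ} (hc : ∀ k, 0 < c k)
    (hb : ∀ k, ‖scaledSquare (c k) (a k)‖ ≤ (1 / 2) ^ (k + 1)) :
    Tendsto (fun n => compressError
      (1 - (1 - ∑ k ∈ Finset.range n, scaledSquare (c k) (a k)) ^ n) T) atTop (𝓝 0) := by
  have hb0 : ∀ k, 0 ≤ scaledSquare (c k) (a k) := fun k => scaledSquare_nonneg (hc k).le _
  unfold compressError
  simp only [sub_sub_cancel]
  refine tendsto_hsNorm_mul (hsSq_sqrt hT htc).1 (C := 1) (fun n => ?_) fun v => ?_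
  · obtain ⟨h0, h1⟩ := sum_nonneg_le_one hb0 hb n
    exact norm_one_sub_pow_le h0 h1 n
  · refine tendsto_one_sub_sum_pow hb0 hb fun z hz => ?_
    refine inner_sqrt_eq_zero hT ha (fun k => ?_) v
    have h1 : (c k : ℂ) • (a k * star (a k)) z = 0 := hz k
    exact (smul_eq_zero.1 h1).resolve_left (Complex.ofReal_ne_zero.2 (hc k).ne')

end

/-! ### Approximate units made of elementary fields, and approximation by vector functionals. -/

namespace AbelianSystem

open InnerProductSpace

variable {H : Type u} [NormedAddCommGroup H] [InnerProductSpace ℂ H] [CompleteSpace H]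
variable (D : AbelianSystem H)

variable {D} in
theorem add_mem_elementaryFields {a b : D.OperatorField} (ha : a ∈ D.elementaryFields)
    (hb : b ∈ D.elementaryFields) : (fun x => a x + b x) ∈ D.elementaryFields :=
  D.elementaryFields.add_mem ha hb

variable {D} in
theorem sub_mem_elementaryFields {a b : D.OperatorField} (ha : a ∈ D.elementaryFields)
    (hb : b ∈ D.elementaryFields) : (fun x => a x - b x) ∈ D.elementaryFields :=
  D.elementaryFields.sub_mem ha hb

theorem scaledSquare_mem {a : D.OperatorField} (ha : a ∈ D.elementaryFields) (c : ℝ) :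
    (fun x => scaledSquare c (a x)) ∈ D.elementaryFields :=
  D.elementaryFields.smul_mem (c : ℂ) (D.mul_mem ha (D.star_mem_elementaryFields ha))

theorem one_sub_one_sub_pow_mem {G : D.OperatorField} (hG : G ∈ D.elementaryFields) (m : ℕ) :
    (fun x => 1 - (1 - G x) ^ m) ∈ D.elementaryFields := by
  induction m with
  | zero =>
    have : (fun x => 1 - (1 - G x) ^ 0) = (0 : D.OperatorField) := by
      funext x; rw [pow_zero, sub_self]; rfl
    rw [this]; exact D.elementaryFields.zero_mem
  | succ m ih =>
    have := add_mem_elementaryFields ih (sub_mem_elementaryFields hG (D.mul_mem ih hG))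
    simpa only [one_sub_one_sub_pow_succ] using this

variable {D}

/-- An approximate unit, made of elementary fields, for a field of density operators. -/
theorem IsDensityField.exists_approximate_unit {T : D.OperatorField} (hT : D.IsDensityField T) :
    ∃ p : ℕ → D.OperatorField, (∀ n, p n ∈ D.elementaryFields) ∧
      (∀ n x, ‖1 - p n x‖ ≤ 1) ∧
      ∀ᵐ x ∂D.μ, Tendsto (fun n => compressError (p n x) (T x)) atTop (𝓝 0) := by
  obtain ⟨⟨a, ha, hlim⟩, hdens⟩ := hT
  choose C hC0 hC using fun k => D.exists_norm_le (ha k)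
  -- Elementary fields are bounded uniformly in x, so constant weights, which keep the field
  -- elementary, give the geometric bound in all fibres at once.
  let c : ℕ → ℝ := fun k => (1 / 2) ^ (k + 1) / (C k ^ 2 + 1)
  have hc : ∀ k, 0 < c k := fun k => by positivity
  have hbn : ∀ x k, ‖scaledSquare (c k) (a k x)‖ ≤ (1 / 2) ^ (k + 1) := fun x k =>
    norm_scaledSquare_le (hC k x) (by positivity)
  refine ⟨fun n x => 1 - (1 - ∑ k ∈ Finset.range n, scaledSquare (c k) (a k x)) ^ n, fun n =>
    D.one_sub_one_sub_pow_mem (D.finset_sum_mem _ fun k => D.scaledSquare_mem (ha k) (c k)) n,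
    fun n x => ?_, ?_⟩
  · rw [sub_sub_cancel]
    obtain ⟨h0, h1⟩ := sum_nonneg_le_one (fun k => scaledSquare_nonneg (hc k).le (a k x)) (hbn x) n
    exact norm_one_sub_pow_le h0 h1 n
  · filter_upwards [hlim, hdens] with x hx hx0
    exact tendsto_compressError hx0.2.2.1 hx0.2.1 hx hc (hbn x)

theorem IsMeasurableField.aestronglyMeasurable_inner {T : D.OperatorField}
    (hT : D.IsMeasurableField T) (A B : D.C') :
    AEStronglyMeasurable (fun x => ⟪D.vf A x, T x (D.vf B x)⟫_ℂ) D.μ := by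
  obtain ⟨a, ha, hlim⟩ := hT
  refine aestronglyMeasurable_of_tendsto_ae atTop
    (fun n => (D.continuous_inner_elementary (ha n) A B).aestronglyMeasurable) ?_
  filter_upwards [hlim] with x hx
  exact tendsto_const_nhds.inner
    (((ContinuousLinearMap.apply ℂ _ (D.vf B x)).continuous.tendsto _).comp hx)

/-- The Hilbert-Schmidt norm is defined through unrelated bases of the fibres; measurability comes
from `compressError_eq`, applied to the elementary field p* + p - p*p. -/
theorem IsDensityField.aestronglyMeasurable_compressError {T : D.OperatorField}
    (hT : D.IsDensityField T) {p : D.OperatorField} (hp : p ∈ D.elementaryFields) :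
    AEStronglyMeasurable (fun x => compressError (p x) (T x)) D.μ := by
  have hr : (fun x => star (p x) + p x - star (p x) * p x) ∈ D.elementaryFields :=
    sub_mem_elementaryFields (add_mem_elementaryFields (D.star_mem_elementaryFields hp) hp)
      (D.mul_mem (D.star_mem_elementaryFields hp) hp)
  obtain ⟨n, A, B, h⟩ := D.exists_eq_sum hr
  have hmeas : AEStronglyMeasurable
      (fun x => (1 : ℂ) - ∑ j, ⟪D.vf (B j) x, T x (D.vf (A j) x)⟫_ℂ) D.μ :=
    aestronglyMeasurable_const.sub
      (Finset.aestronglyMeasurable_fun_sum _ fun j _ => hT.1.aestronglyMeasurable_inner _ _)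
  refine (Real.continuous_sqrt.comp_aestronglyMeasurable
    (Complex.continuous_re.comp_aestronglyMeasurable hmeas)).congr ?_
  filter_upwards [hT.2] with x hx
  exact (compressError_eq hx.2.2.1 hx.2.1 hx.2.2.2 (p x) _ _ (congrFun h x)).symm

theorem IsDensityField.tendsto_integral {T : D.OperatorField} (hT : D.IsDensityField T)
    {f : D.X → ℝ} (hf : D.IsDensity f) {p : ℕ → D.OperatorField}
    (hp : ∀ n, p n ∈ D.elementaryFields) (hp1 : ∀ n x, ‖1 - p n x‖ ≤ 1)
    (hlim : ∀ᵐ x ∂D.μ, Tendsto (fun n => compressError (p n x) (T x)) atTop (𝓝 0)) :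
    (∀ n, Integrable (fun x => compressError (p n x) (T x) * f x) D.μ) ∧
    Tendsto (fun n => ∫ x, compressError (p n x) (T x) * f x ∂D.μ) atTop (𝓝 0) := by
  have hmeas : ∀ n, AEStronglyMeasurable
      (fun x => compressError (p n x) (T x) * f x) D.μ := fun n =>
    (hT.aestronglyMeasurable_compressError (hp n)).mul hf.1.aestronglyMeasurable
  have hbd : ∀ n, ∀ᵐ x ∂D.μ, ‖compressError (p n x) (T x) * f x‖ ≤ f x := by
    intro n
    filter_upwards [hT.2, hf.2.1] with x hx hfx
    rw [Real.norm_of_nonneg (mul_nonneg (compressError_nonneg _ _) hfx)]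
    exact mul_le_of_le_one_left hfx
      (compressError_le_one hx.2.2.1 hx.2.1 hx.2.2.2 (hp1 n x))
  refine ⟨fun n => hf.1.mono' (hmeas n) (hbd n), ?_⟩
  rw [← integral_zero D.X ℝ (μ := D.μ)]
  refine tendsto_integral_of_dominated_convergence f hmeas hf.1 hbd ?_
  filter_upwards [hlim] with x hx
  have := hx.mul_const (f x)
  rwa [zero_mul] at this

variable (D)

theorem norm_π_le (A : D.C') (x : D.X) : ‖D.π x A‖ ≤ ‖A‖ :=
  NonUnitalStarAlgHom.norm_apply_le (D.π x) A

theorem inner_vf_π (A B C : D.C') (x : D.X) :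
    ⟪D.vf B x, D.π x A (D.vf C x)⟫_ℂ = D.ψ x (star B * (A * C)) :=
  (congrArg (fun v => ⟪D.vf B x, v⟫_ℂ) (D.π_vf A C x)).trans (D.inner_vf B (A * C) x)

theorem exists_norm_ψ_le (B C : D.C') : ∃ M : ℝ, 0 < M ∧ ∀ (A : D.C') (x : D.X),
    ‖D.ψ x (star B * (A * C))‖ ≤ M * ‖A‖ := by
  obtain ⟨M₁, h₁, hB⟩ := D.exists_norm_vf_le B
  obtain ⟨M₂, h₂, hC⟩ := D.exists_norm_vf_le C
  refine ⟨M₁ * M₂ + 1, by positivity, fun A x => ?_⟩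
  rw [← inner_vf_π]
  refine (norm_inner_le_norm _ _).trans ?_
  have h3 : ‖D.π x A (D.vf C x)‖ ≤ ‖A‖ * M₂ :=
    ((D.π x A).le_opNorm _).trans (mul_le_mul (D.norm_π_le A x) (hC x) (norm_nonneg _)
      (norm_nonneg _))
  calc _ ≤ M₁ * (‖A‖ * M₂) := mul_le_mul (hB x) h3 (norm_nonneg _) h₁
    _ ≤ _ := by nlinarith [norm_nonneg A]

theorem integrable_mul_ψ {g : D.X → ℂ} (hg : Integrable g D.μ) (A : D.C') :
    Integrable (fun x => g x * D.ψ x A) D.μ := by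
  obtain ⟨M, hM⟩ := (isCompact_range (D.continuous_ψ A).norm).bddAbove
  exact hg.mul_bdd (c := M) (D.continuous_ψ A).aestronglyMeasurable
    (Eventually.of_forall fun x => hM ⟨x, rfl⟩)

/-- Functionals given by an integrable density are approximated by vector functionals. -/
theorem exists_vector_approx {g : D.X → ℂ} (hg : Integrable g D.μ) (B C : D.C') {ε : ℝ}
    (hε : 0 < ε) : ∃ ξ η : H, ∀ A : D.C',
      ‖∫ x, g x * D.ψ x (star B * (A * C)) ∂D.μ - ⟪ξ, (A : H →L[ℂ] H) η⟫_ℂ‖ ≤ ε * ‖A‖ := by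
  obtain ⟨M, hM0, hM⟩ := D.exists_norm_ψ_le B C
  obtain ⟨k, hk⟩ := D.exists_continuous_integral_sub_le hg (ε := ε / M) (by positivity)
  have hki : Integrable k D.μ := k.continuous.integrable_of_hasCompactSupport (.of_compactSpace _)
  -- For continuous k the integral of k(x) ψ_x(B*AC) is exactly ⟨Ω, c B*AC Ω⟩, where c has Gelfand
  -- transform k; moving c B* to the left gives this pair.
  refine ⟨(B : H →L[ℂ] H) ((star (D.ofCFun k : H →L[ℂ] H)) D.vec), (C : H →L[ℂ] H) D.vec,
    fun A => ?_⟩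
  have h1 : ⟪(B : H →L[ℂ] H) ((star (D.ofCFun k : H →L[ℂ] H)) D.vec),
      (A : H →L[ℂ] H) ((C : H →L[ℂ] H) D.vec)⟫_ℂ
      = ∫ x, k x * D.ψ x (star B * (A * C)) ∂D.μ := by
    rw [integral_mul_ψ, ← star_inner', ← star_inner', star_star]
    rfl
  rw [h1, ← integral_sub (D.integrable_mul_ψ hg _) (D.integrable_mul_ψ hki _)]
  refine (norm_integral_le_of_norm_le ((hg.sub hki).norm.mul_const (M * ‖A‖))
    (Eventually.of_forall fun x => ?_)).trans ?_
  · rw [← sub_mul, norm_mul]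
    exact mul_le_mul_of_nonneg_left (hM A x) (norm_nonneg _)
  · rw [integral_mul_const]
    calc _ ≤ ε / M * (M * ‖A‖) := mul_le_mul_of_nonneg_right hk (by positivity)
      _ = ε * ‖A‖ := by field_simp

end AbelianSystem

/-! ### Functionals given by density fields are normal states. -/

section

variable {H : Type u} [NormedAddCommGroup H] [InnerProductSpace ℂ H] [CompleteSpace H]

theorem IsUltraweak.of_fintype {S : VonNeumannAlgebra H} {γ : S.toStarSubalgebra →ₗ[ℂ] ℂ}
    (h : ∀ ε > 0, ∃ (ι : Type) (_ : Fintype ι) (ξ η : ι → H), ∀ A : S.toStarSubalgebra,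
      ‖γ A - ∑ i, ⟪ξ i, (A : H →L[ℂ] H) (η i)⟫_ℂ‖ ≤ ε * ‖A‖) : IsUltraweak S γ := by
  intro ε hε
  obtain ⟨ι, _, ξ, η, hA⟩ := h ε hε
  let e := (Fintype.equivFin ι).symm
  refine ⟨Fintype.card ι, ξ ∘ e, η ∘ e, fun A => ?_⟩
  have := Equiv.sum_comp e fun i => ⟪ξ i, (A : H →L[ℂ] H) (η i)⟫_ℂ
  refine le_trans (le_of_eq ?_) (hA A)
  rw [← this]
  rfl

end

section

variable {K : Type u} [NormedAddCommGroup K] [InnerProductSpace ℂ K] [CompleteSpace K]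

theorem norm_inner_apply_le_of_trace_eq_one {T : K →L[ℂ] K} (hT : 0 ≤ T) (htc : IsTraceClass T)
    (h1 : trace T = 1) (v w : K) : ‖⟪v, T w⟫_ℂ‖ ≤ ‖v‖ * ‖w‖ := by
  refine (norm_inner_le_norm _ _).trans (mul_le_mul_of_nonneg_left ?_ (norm_nonneg _))
  exact (T.le_opNorm w).trans
    (mul_le_of_le_one_left (norm_nonneg _) (norm_le_of_trace_eq_one hT htc h1))

theorem map_star_mul {A B : Type*} [Semiring A] [Algebra ℂ A] [StarRing A] [Semiring B]
    [Algebra ℂ B] [StarRing B] (φ : A →⋆ₐ[ℂ] B) (a : A) : φ (star a * a) = star (φ a) * φ a := by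
  rw [map_mul, map_star]

theorem three_mul_mul_le {s t ε : ℝ} (hs : 0 ≤ s) (ht : t ≤ ε / 6) : 3 * s * t ≤ ε / 2 * s := by
  nlinarith

theorem norm_trace_sub_mul_le {B T p : K →L[ℂ] K} (hT : 0 ≤ T) (htc : IsTraceClass T)
    (h1 : trace T = 1) (hp : ‖1 - p‖ ≤ 1) {M f : ℝ} (hB : ‖B‖ ≤ M) (hf : 0 ≤ f) :
    ‖trace (B * T) * (f : ℂ) - trace (B * (p * T * star p)) * (f : ℂ)‖
      ≤ 3 * M * (compressError p T * f) := by
  rw [← sub_mul, norm_mul, Complex.norm_real, Real.norm_of_nonneg hf, ← mul_assoc (3 * M)]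
  refine mul_le_mul_of_nonneg_right ?_ hf
  refine (norm_trace_sub_le_compressError hT htc h1 hp _).trans ?_
  exact mul_le_mul_of_nonneg_right
    (mul_le_mul_of_nonneg_left hB (by norm_num)) (compressError_nonneg _ _)

theorem trace_one_mul (T : K →L[ℂ] K) : trace (1 * T) = trace T := by rw [one_mul]

end

namespace AbelianSystem

variable {H : Type u} [NormedAddCommGroup H] [InnerProductSpace ℂ H] [CompleteSpace H]
variable {D : AbelianSystem H} {T : D.OperatorField} {f : D.X → ℝ}

theorem IsDensityField.integrable_inner_mul (hT : D.IsDensityField T) (hf : D.IsDensity f)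
    (A B : D.C') :
    Integrable (fun x => ⟪D.vf A x, T x (D.vf B x)⟫_ℂ * (f x : ℂ)) D.μ := by
  obtain ⟨M₁, h₁, hA⟩ := D.exists_norm_vf_le A
  obtain ⟨M₂, h₂, hB⟩ := D.exists_norm_vf_le B
  refine hf.1.ofReal.bdd_mul (c := M₁ * M₂) (hT.1.aestronglyMeasurable_inner A B) ?_
  filter_upwards [hT.2] with x hx
  exact (norm_inner_apply_le_of_trace_eq_one hx.2.2.1 hx.2.1 hx.2.2.2 _ _).trans
    (mul_le_mul (hA x) (hB x) (norm_nonneg _) h₁)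

theorem trace_π_mul_compress {n : ℕ} (A B : Fin n → D.C') {p : D.OperatorField} {x : D.X}
    (hp : p x = ∑ j, InnerProductSpace.rankOne ℂ (D.vf (A j) x) (D.vf (B j) x)) (C : D.C') :
    trace (D.π x C * (p x * T x * star (p x)))
      = ∑ q : Fin n × Fin n, ⟪D.vf (B q.1) x, T x (D.vf (B q.2) x)⟫_ℂ *
          D.ψ x (star (A q.2) * (C * A q.1)) :=
  (trace_mul_compress (D.π x C) (T x) _ _ hp).trans
    (Finset.sum_congr rfl fun q _ => congrArg
      (fun z => ⟪D.vf (B q.1) x, T x (D.vf (B q.2) x)⟫_ℂ * z) (D.inner_vf_π _ _ _ x))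

/-- Half of ε pays for replacing T by p T p*, the other half for replacing the finitely many
integrable coefficients of the compressed trace by continuous ones. -/
theorem IsDecomposition.isUltraweak {S : VonNeumannAlgebra H}
    {hS : S.toStarSubalgebra ≤ D.C'} {γ : S.toStarSubalgebra →ₗ[ℂ] ℂ}
    (hT : D.IsDensityField T) (hf : D.IsDensity f) (h : D.IsDecomposition hS γ T f) :
    IsUltraweak S γ := by
  obtain ⟨p, hp, hp1, hlim⟩ := hT.exists_approximate_unit
  obtain ⟨hint, htend⟩ := hT.tendsto_integral hf hp hp1 hlim
  refine .of_fintype fun ε hε => ?_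
  -- The compression estimate carries a factor 3, so ε/6 becomes ε/2.
  obtain ⟨N, hN⟩ := (htend.eventually (gt_mem_nhds (show 0 < ε / 6 by positivity))).exists
  obtain ⟨n, A, B, hAB⟩ := D.exists_eq_sum (hp N)
  let g : Fin n × Fin n → D.X → ℂ := fun q x =>
    ⟪D.vf (B q.1) x, T x (D.vf (B q.2) x)⟫_ℂ * (f x : ℂ)
  have hg : ∀ q, Integrable (g q) D.μ := fun q => hT.integrable_inner_mul hf _ _
  choose ξ η hξ using fun q : Fin n × Fin n =>
    D.exists_vector_approx (hg q) (A q.2) (A q.1) (ε := ε / (2 * ((n : ℝ) * n + 1))) (by positivity)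
  refine ⟨Fin n × Fin n, inferInstance, ξ, η, fun a => ?_⟩
  let a' : D.C' := StarSubalgebra.inclusion hS a
  have hgi : ∀ q : Fin n × Fin n,
      Integrable (fun x => g q x * D.ψ x (star (A q.2) * (a' * A q.1))) D.μ :=
    fun q => D.integrable_mul_ψ (hg q) _
  have h1 : ∀ᵐ x ∂D.μ, ‖trace (D.π x a' * T x) * (f x : ℂ)
      - ∑ q, g q x * D.ψ x (star (A q.2) * (a' * A q.1))‖
      ≤ 3 * ‖a'‖ * (compressError (p N x) (T x) * f x) := by
    filter_upwards [hT.2, hf.2.1] with x hx hfx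
    have e1 : ∑ q, g q x * D.ψ x (star (A q.2) * (a' * A q.1))
        = trace (D.π x a' * (p N x * T x * star (p N x))) * (f x : ℂ) := by
      rw [trace_π_mul_compress A B (congrFun hAB x) a', Finset.sum_mul]
      exact Finset.sum_congr rfl fun q _ => mul_right_comm _ _ _
    exact (congrArg (fun z => ‖trace (D.π x a' * T x) * (f x : ℂ) - z‖) e1).trans_le
      (norm_trace_sub_mul_le hx.2.2.1 hx.2.1 hx.2.2.2 (hp1 N x) (D.norm_π_le a' x) hfx)
  have h2 : ‖γ a - ∑ q, ∫ x, g q x * D.ψ x (star (A q.2) * (a' * A q.1)) ∂D.μ‖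
      ≤ ε / 2 * ‖a'‖ := by
    have e2 : γ a - ∑ q, ∫ x, g q x * D.ψ x (star (A q.2) * (a' * A q.1)) ∂D.μ
        = ∫ x, (trace (D.π x a' * T x) * (f x : ℂ)
          - ∑ q, g q x * D.ψ x (star (A q.2) * (a' * A q.1))) ∂D.μ := by
      rw [integral_sub (h a).1 (integrable_finsetSum _ fun q _ => hgi q),
        integral_finsetSum _ fun q _ => hgi q, (h a).2]
    rw [e2]
    refine (norm_integral_le_of_norm_le ((hint N).const_mul (3 * ‖a'‖)) h1).trans ?_
    rw [integral_const_mul]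
    exact three_mul_mul_le (norm_nonneg a') hN.le
  have h3 : ‖∑ q, ∫ x, g q x * D.ψ x (star (A q.2) * (a' * A q.1)) ∂D.μ
      - ∑ q, ⟪ξ q, (a : H →L[ℂ] H) (η q)⟫_ℂ‖ ≤ ε / 2 * ‖a'‖ := by
    rw [← Finset.sum_sub_distrib]
    refine (norm_sum_le_of_le _ fun q _ => hξ q a').trans ?_
    rw [Finset.sum_const, Finset.card_univ, Fintype.card_prod, Fintype.card_fin, nsmul_eq_mul,
      ← mul_assoc]
    refine mul_le_mul_of_nonneg_right ?_ (norm_nonneg _)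
    push_cast
    rw [mul_div_assoc', div_le_div_iff₀ (by positivity) (by norm_num)]
    nlinarith
  calc _ ≤ _ := norm_sub_le_norm_sub_add_norm_sub _ _ _
    _ ≤ ε / 2 * ‖a'‖ + ε / 2 * ‖a'‖ := add_le_add h2 h3
    _ = ε * ‖a‖ := by rw [← add_mul, add_halves]; rfl

theorem IsDecomposition.isState {S : VonNeumannAlgebra H}
    {hS : S.toStarSubalgebra ≤ D.C'} {γ : S.toStarSubalgebra →ₗ[ℂ] ℂ}
    (hT : D.IsDensityField T) (hf : D.IsDensity f) (h : D.IsDecomposition hS γ T f) :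
    IsState S γ := by
  constructor
  · intro A
    rw [(h _).2]
    refine integral_nonneg_of_ae ?_
    filter_upwards [hT.2, hf.2.1] with x hx hfx
    refine mul_nonneg ?_ (Complex.zero_le_real.2 hfx)
    have e := map_star_mul ((D.π x).comp (StarSubalgebra.inclusion hS)) A
    have h0 := trace_star_mul_nonneg hx.2.2.1 hx.2.1 (D.π x (StarSubalgebra.inclusion hS A))
    exact le_of_le_of_eq h0 (congrArg (fun B => trace (B * T x)) e.symm)
  · rw [(h 1).2]
    have e : ∀ᵐ x ∂D.μ, trace (D.π x (StarSubalgebra.inclusion hS 1) * T x) * (f x : ℂ)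
        = (f x : ℂ) := by
      filter_upwards [hT.2] with x hx
      have e1 := map_one ((D.π x).comp (StarSubalgebra.inclusion hS))
      have e2 := (congrArg (fun B => trace (B * T x)) e1).trans
        ((trace_one_mul (T x)).trans hx.2.2.2)
      exact (congrArg (fun z => z * (f x : ℂ)) e2).trans (one_mul _)
    rw [integral_congr_ae e, integral_complex_ofReal, hf.2.2, Complex.ofReal_one]

/-- A functional with a decomposition is a normal state. -/
theorem IsDecomposition.isNormalState {S : VonNeumannAlgebra H}
    {hS : S.toStarSubalgebra ≤ D.C'} {γ : S.toStarSubalgebra →ₗ[ℂ] ℂ}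
    (hT : D.IsDensityField T) (hf : D.IsDensity f) (h : D.IsDecomposition hS γ T f) :
    IsNormalState S γ :=
  ⟨h.isState hT hf, (h.isUltraweak hT hf).isNormal (h.isState hT hf).1⟩

end AbelianSystem

/-! ### Density operators built from square summable sequences of vectors. -/

section

open InnerProductSpace ContinuousLinearMap

variable {K : Type u} [NormedAddCommGroup K] [InnerProductSpace ℂ K] [CompleteSpace K]

omit [CompleteSpace K] in
theorem norm_inner_mul_inner_le (b v w : K) :
    ‖⟪v, b⟫_ℂ * ⟪b, w⟫_ℂ‖ ≤ ‖⟪b, v⟫_ℂ‖ ^ 2 + ‖⟪b, w⟫_ℂ‖ ^ 2 := by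
  rw [norm_mul, norm_inner_symm]
  nlinarith [sq_nonneg (‖⟪b, v⟫_ℂ‖ - ‖⟪b, w⟫_ℂ‖), sq_nonneg ‖⟪b, v⟫_ℂ‖, sq_nonneg ‖⟪b, w⟫_ℂ‖]

theorem isTraceClass_of_nonneg {T : K →L[ℂ] K} (hT : 0 ≤ T)
    (hs : Summable fun i => ⟪basis K i, T (basis K i)⟫_ℂ) : IsTraceClass T := by
  unfold IsTraceClass
  rw [CFC.abs_of_nonneg T hT]
  exact hs.norm

theorem trace_smul (c : ℂ) (T : K →L[ℂ] K) : trace (c • T) = c * trace T := by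
  unfold trace
  rw [← tsum_mul_left]
  exact tsum_congr fun i => inner_smul_right _ _ _

omit [CompleteSpace K] in
theorem rankOne_self_nonneg (v : K) : 0 ≤ rankOne ℂ v v :=
  (nonneg_iff_isPositive _).2 (isPositive_rankOne_self v)

omit [CompleteSpace K] in
theorem isCompactOperator_rankOne (v w : K) : IsCompactOperator (rankOne ℂ v w) := by
  have h : IsCompactOperator (innerSL ℂ w : K →L[ℂ] ℂ) :=
    isCompactOperator_of_locallyCompactSpace_dom (innerSL ℂ w)
  exact h.clm_comp (ContinuousLinearMap.toSpanSingleton ℂ v)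

omit [CompleteSpace K] in
theorem norm_rankOne_self (v : K) : ‖rankOne ℂ v v‖ = ‖v‖ ^ 2 := by
  rw [norm_rankOne, sq]

theorem norm_rankOne_self_sub_le (u v : K) :
    ‖rankOne ℂ u u - rankOne ℂ v v‖ ≤ ‖u - v‖ * (‖u‖ + ‖v‖) := by
  have h : rankOne ℂ u u - rankOne ℂ v v = rankOne ℂ (u - v) u + rankOne ℂ v (u - v) := by
    rw [map_sub, map_sub, _root_.sub_apply]; abel
  rw [h]
  refine (norm_add_le _ _).trans ?_
  rw [norm_rankOne, norm_rankOne]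
  linarith

variable {v : ℕ → K}

theorem summable_rankOne_self (hv : Summable fun n => ‖v n‖ ^ 2) :
    Summable fun n => rankOne ℂ (v n) (v n) :=
  .of_norm (by simpa only [norm_rankOne_self] using hv)

theorem tsum_rankOne_self_nonneg : 0 ≤ ∑' n, rankOne ℂ (v n) (v n) :=
  tsum_nonneg fun n => rankOne_self_nonneg (v n)

theorem isCompactOperator_tsum_rankOne_self (hv : Summable fun n => ‖v n‖ ^ 2) :
    IsCompactOperator (∑' n, rankOne ℂ (v n) (v n) : K →L[ℂ] K) := by
  refine isCompactOperator_of_tendsto (summable_rankOne_self hv).hasSum.tendsto_sum_nat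
    (Eventually.of_forall fun k => ?_)
  exact Submodule.sum_mem (compactOperator (RingHom.id ℂ) K K)
    fun n _ => isCompactOperator_rankOne (v n) (v n)

/-- The family ⟨v_n, b_i⟩⟨b_i, B v_n⟩ is absolutely summable. Summed over i first it gives ⟨v_n, B
v_n⟩ by Parseval; summed over n first, the diagonal entries. -/
theorem trace_mul_tsum_rankOne_self (hv : Summable fun n => ‖v n‖ ^ 2)
    (B : K →L[ℂ] K) :
    (Summable fun i => ⟪basis K i, (B * ∑' n, rankOne ℂ (v n) (v n)) (basis K i)⟫_ℂ) ∧
      trace (B * ∑' n, rankOne ℂ (v n) (v n)) = ∑' n, ⟪v n, B (v n)⟫_ℂ := by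
  let b := basis K
  let F : ℕ × basisIndex K → ℂ := fun q => ⟪v q.1, b q.2⟫_ℂ * ⟪b q.2, B (v q.1)⟫_ℂ
  have hrow : ∀ n, HasSum (fun i => F (n, i)) ⟪v n, B (v n)⟫_ℂ := fun n =>
    (basis K).hasSum_inner_mul_inner (v n) (B (v n))
  have hbd : ∀ n i, ‖F (n, i)‖ ≤ ‖⟪b i, v n⟫_ℂ‖ ^ 2 + ‖⟪b i, B (v n)⟫_ℂ‖ ^ 2 := fun n i =>
    norm_inner_mul_inner_le (basis K i) (v n) (B (v n))
  have hs : ∀ n, HasSum (fun i => ‖⟪b i, v n⟫_ℂ‖ ^ 2 + ‖⟪b i, B (v n)⟫_ℂ‖ ^ 2)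
      (‖v n‖ ^ 2 + ‖B (v n)‖ ^ 2) := fun n =>
    (hasSum_norm_inner_sq (v n)).add (hasSum_norm_inner_sq (B (v n)))
  have hrs : ∀ n, Summable fun i => ‖F (n, i)‖ := fun n =>
    .of_nonneg_of_le (fun i => norm_nonneg _) (hbd n) (hs n).summable
  have hF : Summable F := by
    refine Summable.of_norm ((summable_prod_of_nonneg fun q => norm_nonneg _).2 ⟨hrs, ?_⟩)
    refine .of_nonneg_of_le (fun n => tsum_nonneg fun i => norm_nonneg _) (fun n => ?_)
      (hv.mul_left (1 + ‖B‖ ^ 2))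
    refine ((hrs n).tsum_le_tsum (hbd n) (hs n).summable).trans ?_
    rw [(hs n).tsum_eq]
    have := pow_le_pow_left₀ (norm_nonneg _) (B.le_opNorm (v n)) 2
    rw [mul_pow] at this
    linarith
  have hcol : ∀ i, HasSum (fun n => F (n, i))
      ⟪b i, (B * ∑' n, rankOne ℂ (v n) (v n)) (b i)⟫_ℂ := by
    intro i
    have h1 := (summable_rankOne_self hv).hasSum.mapL (ContinuousLinearMap.apply ℂ K (b i))
    have h2 := (h1.mapL B).mapL (innerSL ℂ (b i))
    refine h2.congr_fun fun n => ?_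
    change ⟪v n, b i⟫_ℂ * ⟪b i, B (v n)⟫_ℂ = ⟪b i, B (⟪v n, b i⟫_ℂ • v n)⟫_ℂ
    rw [map_smul, inner_smul_right]
  have hsw : Summable fun q : basisIndex K × ℕ => F (q.2, q.1) :=
    ((Equiv.prodComm _ _).summable_iff (f := F)).2 hF
  have hsum := hsw.hasSum.prod_fiberwise hcol
  refine ⟨hsum.summable, ?_⟩
  have e1 : trace (B * ∑' n, rankOne ℂ (v n) (v n)) = ∑' q : basisIndex K × ℕ, F (q.2, q.1) :=
    hsum.tsum_eq
  exact e1.trans (((Equiv.prodComm (basisIndex K) ℕ).tsum_eq F).trans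
    (hF.hasSum.prod_fiberwise hrow).tsum_eq.symm)

/-- The number of terms and the approximants vary together. The decay in n makes the total error at
stage k summable, and the decay in k makes it vanish. -/
theorem tendsto_sum_rankOne_self (hv : Summable fun n => ‖v n‖ ^ 2) {u : ℕ → ℕ → K}
    {c : ℝ}
    (hu : ∀ n k, ‖u n k - v n‖ ≤ c * (1 / 2) ^ (n + k)) :
    Tendsto (fun k => ∑ n ∈ Finset.range k, rankOne ℂ (u n k) (u n k)) atTop
      (𝓝 (∑' n, rankOne ℂ (v n) (v n))) := by
  have hc : 0 ≤ c := by simpa using (norm_nonneg _).trans (hu 0 0)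
  set M := √(∑' n, ‖v n‖ ^ 2)
  have hM : ∀ n, ‖v n‖ ≤ M := fun n =>
    Real.le_sqrt_of_sq_le (hv.le_tsum n fun _ _ => sq_nonneg _)
  have hdiff : ∀ n k, ‖rankOne ℂ (u n k) (u n k) - rankOne ℂ (v n) (v n)‖
      ≤ c * (2 * M + c) * (1 / 2) ^ k * (1 / 2) ^ n := by
    intro n k
    have hp : ((1 : ℝ) / 2) ^ (n + k) ≤ 1 := pow_le_one₀ (by norm_num) (by norm_num)
    have h1 : ‖u n k‖ ≤ ‖v n‖ + c := by
      have h2 := norm_le_norm_add_norm_sub' (u n k) (v n)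
      have h3 := hu n k
      nlinarith
    refine (norm_rankOne_self_sub_le _ _).trans ?_
    calc _ ≤ (c * (1 / 2) ^ (n + k)) * (2 * M + c) :=
          mul_le_mul (hu n k) (by linarith [hM n]) (by positivity) (by positivity)
      _ = _ := by rw [pow_add]; ring
  have hz : Tendsto (fun k => ∑ n ∈ Finset.range k,
      (rankOne ℂ (u n k) (u n k) - rankOne ℂ (v n) (v n))) atTop (𝓝 0) := by
    refine squeeze_zero_norm (a := fun k => c * (2 * M + c) * 2 * (1 / 2) ^ k) (fun k => ?_) ?_
    · refine (norm_sum_le_of_le _ fun n _ => hdiff n k).trans ?_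
      rw [← Finset.mul_sum]
      have h2 : ∑ n ∈ Finset.range k, ((1 : ℝ) / 2) ^ n ≤ 2 :=
        sum_geometric_two_le k
      have hM0 : 0 ≤ M := Real.sqrt_nonneg _
      have h3 : 0 ≤ c * (2 * M + c) * (1 / 2) ^ k := by positivity
      nlinarith
    · have := (tendsto_pow_atTop_nhds_zero_of_lt_one (r := (1 : ℝ) / 2) (by norm_num)
        (by norm_num)).const_mul (c * (2 * M + c) * 2)
      rwa [mul_zero] at this
  have := hz.add (summable_rankOne_self hv).hasSum.tendsto_sum_nat
  rw [zero_add] at this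
  refine this.congr fun k => ?_
  rw [Finset.sum_sub_distrib, sub_add_cancel]

/-- The normalisation of the sum of the operators `|v n⟩⟨v n|`; it is `|w⟩⟨w|` if all the `v n`
are zero. -/
def normalizedSum (v : ℕ → K) (w : K) : K →L[ℂ] K :=
  (((∑' n, ‖v n‖ ^ 2)⁻¹ : ℝ) : ℂ) • (∑' n, rankOne ℂ (v n) (v n)) +
    ((1 - (∑' n, ‖v n‖ ^ 2) * (∑' n, ‖v n‖ ^ 2)⁻¹ : ℝ) : ℂ) • rankOne ℂ w w

-- Since the inverse of 0 is 0, the coefficient 1 - s s⁻¹ is the indicator of s = 0. A formula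
-- without cases makes the measurability of both coefficients immediate.
omit [CompleteSpace K] in
theorem normalizedSum_of_eq_zero (hv : Summable fun n => ‖v n‖ ^ 2) (h : ∑' n, ‖v n‖ ^ 2 = 0)
    (w : K) : (∀ n, v n = 0) ∧ normalizedSum v w = rankOne ℂ w w := by
  have h0 : ∀ n, v n = 0 := fun n => by
    have := (hasSum_zero_iff_of_nonneg fun n => sq_nonneg ‖v n‖).1 (h ▸ hv.hasSum)
    simpa using congrFun this n
  refine ⟨h0, ?_⟩
  unfold normalizedSum
  rw [h]
  simp

omit [CompleteSpace K] in
theorem normalizedSum_of_ne_zero (h : ∑' n, ‖v n‖ ^ 2 ≠ 0) (w : K) :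
    normalizedSum v w = (((∑' n, ‖v n‖ ^ 2)⁻¹ : ℝ) : ℂ) • (∑' n, rankOne ℂ (v n) (v n)) := by
  unfold normalizedSum
  rw [mul_inv_cancel₀ h]
  simp

theorem normalizedSum_isDensity (hv : Summable fun n => ‖v n‖ ^ 2) {w : K} (hw : ‖w‖ = 1) :
    IsCompactOperator (normalizedSum v w) ∧ IsTraceClass (normalizedSum v w) ∧
      0 ≤ normalizedSum v w ∧ trace (normalizedSum v w) = 1 := by
  by_cases h : ∑' n, ‖v n‖ ^ 2 = 0
  · rw [(normalizedSum_of_eq_zero hv h w).2]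
    refine ⟨isCompactOperator_rankOne w w, isTraceClass_of_nonneg (rankOne_self_nonneg w)
      (hasSum_trace_rankOne w w).summable, rankOne_self_nonneg w, ?_⟩
    rw [trace_rankOne, inner_self_eq_norm_sq_to_K, hw]
    simp
  · rw [normalizedSum_of_ne_zero h]
    have h0 : 0 ≤ (∑' n, ‖v n‖ ^ 2)⁻¹ := inv_nonneg.2 (tsum_nonneg fun n => sq_nonneg _)
    have hnn : 0 ≤ (((∑' n, ‖v n‖ ^ 2)⁻¹ : ℝ) : ℂ) • (∑' n, rankOne ℂ (v n) (v n)) :=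
      smul_nonneg (Complex.zero_le_real.2 h0) tsum_rankOne_self_nonneg
    obtain ⟨hs, ht⟩ := trace_mul_tsum_rankOne_self hv 1
    rw [one_mul] at hs ht
    refine ⟨(isCompactOperator_tsum_rankOne_self hv).smul _, isTraceClass_of_nonneg hnn ?_, hnn, ?_⟩
    · refine (hs.mul_left (((∑' n, ‖v n‖ ^ 2)⁻¹ : ℝ) : ℂ)).congr fun i => ?_
      exact (inner_smul_right _ _ _).symm
    · rw [trace_smul, ht]
      have : ∀ n, ⟪v n, (1 : K →L[ℂ] K) (v n)⟫_ℂ = ((‖v n‖ ^ 2 : ℝ) : ℂ) := fun n => by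
        rw [one_apply_eq_self, inner_self_eq_norm_sq_to_K]
        simp
      simp only [this]
      rw [← Complex.ofReal_tsum, ← Complex.ofReal_mul, inv_mul_cancel₀ h, Complex.ofReal_one]

theorem trace_mul_normalizedSum (hv : Summable fun n => ‖v n‖ ^ 2) (w : K) (B : K →L[ℂ] K) :
    trace (B * normalizedSum v w) * ((∑' n, ‖v n‖ ^ 2 : ℝ) : ℂ) = ∑' n, ⟪v n, B (v n)⟫_ℂ := by
  by_cases h : ∑' n, ‖v n‖ ^ 2 = 0
  · rw [h, Complex.ofReal_zero, mul_zero]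
    simp [(normalizedSum_of_eq_zero hv h w).1]
  · rw [normalizedSum_of_ne_zero h, mul_smul_comm, trace_smul,
      (trace_mul_tsum_rankOne_self hv B).2, mul_right_comm, ← Complex.ofReal_mul,
      inv_mul_cancel₀ h, Complex.ofReal_one, one_mul]

theorem tendsto_normalizedSum (hv : Summable fun n => ‖v n‖ ^ 2) (w : K) {u : ℕ → ℕ → K} {c : ℝ}
    (hu : ∀ n k, ‖u n k - v n‖ ≤ c * (1 / 2) ^ (n + k)) {g h : ℕ → ℂ}
    (hg : Tendsto g atTop (𝓝 (((∑' n, ‖v n‖ ^ 2)⁻¹ : ℝ) : ℂ)))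
    (hh : Tendsto h atTop (𝓝 ((1 - (∑' n, ‖v n‖ ^ 2) * (∑' n, ‖v n‖ ^ 2)⁻¹ : ℝ) : ℂ))) :
    Tendsto (fun k => g k • (∑ n ∈ Finset.range k, rankOne ℂ (u n k) (u n k))
      + h k • rankOne ℂ w w) atTop (𝓝 (normalizedSum v w)) :=
  (hg.smul (tendsto_sum_rankOne_self hv hu)).add (hh.smul tendsto_const_nhds)

end

/-! ### Integrals of series, and estimates for geometrically convergent sequences. -/

section

variable {α E : Type*} [MeasurableSpace α] {μ : Measure α} [NormedAddCommGroup E]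

theorem summable_norm_of_summable_integral_norm {ι : Type*} [Countable ι] {F : ι → α → E}
    (hF : ∀ i, Integrable (F i) μ) (hs : Summable fun i => ∫ x, ‖F i x‖ ∂μ) :
    (∀ᵐ x ∂μ, Summable fun i => ‖F i x‖) ∧ Integrable (fun x => ∑' i, ‖F i x‖) μ := by
  have hfin : ∫⁻ x, ∑' i, ‖F i x‖ₑ ∂μ ≠ ⊤ := by
    rw [lintegral_tsum fun i => (hF i).1.enorm]
    simp only [← ofReal_integral_norm_eq_lintegral_enorm (hF _)]
    exact hs.tsum_ofReal_ne_top
  have hmeas : AEMeasurable (fun x => ∑' i, ‖F i x‖ₑ) μ :=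
    AEMeasurable.tsum fun i => (hF i).1.enorm
  constructor
  · filter_upwards [ae_lt_top' hmeas hfin] with x hx
    simpa using ENNReal.summable_toReal hx.ne
  · refine (integrable_toReal_of_lintegral_ne_top hmeas hfin).congr (Eventually.of_forall fun x => ?_)
    change (∑' i, ‖F i x‖ₑ).toReal = _
    rw [ENNReal.tsum_toReal_eq fun i => enorm_ne_top]
    simp

theorem integrable_tsum_of_summable_integral_norm [CompleteSpace E] {F : ℕ → α → E}
    (hF : ∀ i, Integrable (F i) μ) (hs : Summable fun i => ∫ x, ‖F i x‖ ∂μ) :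
    Integrable (fun x => ∑' i, F i x) μ := by
  obtain ⟨hsum, hint⟩ := summable_norm_of_summable_integral_norm hF hs
  refine hint.mono' (aestronglyMeasurable_of_tendsto_ae atTop
    (f := fun n x => ∑ i ∈ Finset.range n, F i x) (fun n =>
      Finset.aestronglyMeasurable_fun_sum _ fun i _ => (hF i).1) ?_) ?_
  · filter_upwards [hsum] with x hx
    exact hx.of_norm.hasSum.tendsto_sum_nat
  · filter_upwards [hsum] with x hx
    exact norm_tsum_le_tsum_norm hx

theorem integrable_and_tendsto_integral_of_dominated [NormedSpace ℝ E] {F : ℕ → α → E} {f : α → E}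
    {bound : α → ℝ} (hF : ∀ k, AEStronglyMeasurable (F k) μ) (hb : Integrable bound μ)
    (hle : ∀ᵐ x ∂μ, ∀ k, ‖F k x‖ ≤ bound x)
    (hlim : ∀ᵐ x ∂μ, Tendsto (fun k => F k x) atTop (𝓝 (f x))) :
    Integrable f μ ∧ Tendsto (fun k => ∫ x, F k x ∂μ) atTop (𝓝 (∫ x, f x ∂μ)) := by
  refine ⟨hb.mono' (aestronglyMeasurable_of_tendsto_ae atTop hF hlim) ?_,
    tendsto_integral_of_dominated_convergence bound hF hb (fun k => hle.mono fun x hx => hx k) hlim⟩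
  filter_upwards [hle, hlim] with x hx hxl
  exact le_of_tendsto' hxl.norm hx

end

section

variable {K : Type u} [NormedAddCommGroup K] [InnerProductSpace ℂ K]

-- The limits are chosen before the constant c, with value 0 for non-Cauchy sequences: sections are
-- then defined over every x, while a constant depending on x is supplied only almost everywhere.
omit [InnerProductSpace ℂ K] in
theorem exists_limits [CompleteSpace K] (u : ℕ → ℕ → K) : ∃ v : ℕ → K, ∀ c : ℝ,
    (∀ n k, ‖u n (k + 1) - u n k‖ ≤ c * (1 / 2) ^ (n + k)) →
      ∀ n k, ‖u n k - v n‖ ≤ 2 * c * (1 / 2) ^ (n + k) := by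
  classical
  refine ⟨fun n => if h : CauchySeq (u n) then (cauchySeq_tendsto_of_complete h).choose else 0,
    fun c hc n k => ?_⟩
  have hd : ∀ k, dist (u n k) (u n (k + 1)) ≤ 2 * c * (1 / 2) ^ n / 2 / 2 ^ k := fun k => by
    rw [dist_eq_norm, norm_sub_rev]
    refine (hc n k).trans_eq ?_
    rw [pow_add, one_div_pow 2 k]
    ring
  have h : CauchySeq (u n) := cauchySeq_of_le_geometric_two hd
  have hl := (cauchySeq_tendsto_of_complete h).choose_spec
  have := dist_le_of_le_geometric_two_of_tendsto hd hl k
  simp only [dif_pos h]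
  rw [dist_eq_norm] at this
  refine this.trans_eq ?_
  rw [pow_add, one_div_pow 2 k]
  ring

-- All approximants lie within 4√W of the first one. The bound is independent of the index and
-- integrable in x once ‖u₀‖² and W are.
omit [InnerProductSpace ℂ K] in
theorem norm_sq_le_of_norm_sub_le {u u₀ v : K} {W r : ℝ} (hW : 0 ≤ W) (hr : r ≤ 1)
    (h0 : ‖u₀ - v‖ ≤ 2 * √W) (h : ‖u - v‖ ≤ 2 * √W * r) :
    ‖u‖ ^ 2 ≤ 2 * ‖u₀‖ ^ 2 + 32 * W := by
  have hs := Real.sq_sqrt hW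
  have hs0 := Real.sqrt_nonneg W
  have h1 : ‖u‖ ≤ ‖u₀‖ + 4 * √W := by
    have e : u = u₀ - (u₀ - v) + (u - v) := by abel
    have h2 := norm_add_le (u₀ - (u₀ - v)) (u - v)
    rw [← e] at h2
    have h3 := norm_sub_le u₀ (u₀ - v)
    nlinarith
  have h2 := pow_le_pow_left₀ (norm_nonneg u) h1 2
  nlinarith [sq_nonneg (‖u₀‖ - 4 * √W)]

theorem norm_inner_apply_le_of_norm_sub_le {B : K →L[ℂ] K} {u : ℕ → K} {v : K} {M W : ℝ}
    (hB : ‖B‖ ≤ M) (hW : 0 ≤ W) (h : ∀ k, ‖u k - v‖ ≤ 2 * √W * (1 / 2) ^ k) (k : ℕ) :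
    ‖⟪u k, B (u k)⟫_ℂ‖ ≤ M * (2 * ‖u 0‖ ^ 2 + 32 * W) := by
  have h0 := h 0
  rw [pow_zero, mul_one] at h0
  refine (norm_inner_apply_le B (u k)).trans ?_
  exact mul_le_mul hB (norm_sq_le_of_norm_sub_le hW (pow_le_one₀ (by norm_num) (by norm_num))
    h0 (h k)) (sq_nonneg _) ((norm_nonneg _).trans hB)

theorem tendsto_inner_apply {u : ℕ → K} {v : K} {c : ℝ}
    (h : ∀ k, ‖u k - v‖ ≤ c * (1 / 2) ^ k) (B : K →L[ℂ] K) :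
    Tendsto (fun k => ⟪u k, B (u k)⟫_ℂ) atTop (𝓝 ⟪v, B v⟫_ℂ) := by
  have hu : Tendsto u atTop (𝓝 v) := by
    refine tendsto_iff_norm_sub_tendsto_zero.2 (squeeze_zero (fun k => norm_nonneg _) h ?_)
    have := (tendsto_pow_atTop_nhds_zero_of_lt_one (r := (1 : ℝ) / 2) (by norm_num)
      (by norm_num)).const_mul c
    rwa [mul_zero] at this
  exact hu.inner ((B.continuous.tendsto v).comp hu)

end

theorem summable_quarter_pow : Summable fun q : ℕ × ℕ => ((1 : ℝ) / 4) ^ (q.1 + q.2) := by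
  have h : Summable fun n : ℕ => ((1 : ℝ) / 4) ^ n :=
    summable_geometric_of_lt_one (by norm_num) (by norm_num)
  exact (h.mul_of_nonneg h (fun n => by positivity) (fun n => by positivity)).congr fun q =>
    (pow_add _ _ _).symm

theorem le_sqrt_mul_of_pow_mul_sq_le {s W : ℝ} {m : ℕ} (h : 4 ^ m * s ^ 2 ≤ W) :
    s ≤ √W * (1 / 2) ^ m := by
  have h2 : s * 2 ^ m ≤ √W := by
    refine Real.le_sqrt_of_sq_le (le_trans (le_of_eq ?_) h)
    rw [mul_pow, ← pow_mul, mul_comm m 2, pow_mul]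
    norm_num
    ring
  have h3 : (2 : ℝ) ^ m * (1 / 2) ^ m = 1 := by rw [← mul_pow]; norm_num
  calc s = s * 2 ^ m * (1 / 2) ^ m := by rw [mul_assoc, h3, mul_one]
    _ ≤ _ := mul_le_mul_of_nonneg_right h2 (by positivity)

theorem pow_mul_sq_le {s : ℝ} (hs : 0 ≤ s) {m : ℕ} (h : s ≤ 2 * (1 / 4) ^ m) :
    4 ^ m * s ^ 2 ≤ 4 * (1 / 4) ^ m := by
  have h3 : (4 : ℝ) ^ m * (1 / 4) ^ m = 1 := by rw [← mul_pow]; norm_num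
  calc 4 ^ m * s ^ 2 ≤ 4 ^ m * (2 * (1 / 4) ^ m) ^ 2 :=
        mul_le_mul_of_nonneg_left (pow_le_pow_left₀ hs h 2) (by positivity)
    _ = 4 * (4 ^ m * (1 / 4) ^ m) * (1 / 4) ^ m := by ring
    _ = _ := by rw [h3, mul_one]

/-! ### Realising vectors of H by sections. -/

namespace AbelianSystem

variable {H : Type u} [NormedAddCommGroup H] [InnerProductSpace ℂ H] [CompleteSpace H]
variable (D : AbelianSystem H)

theorem exists_norm_sub_le (ζ : H) {ε : ℝ} (hε : 0 < ε) :
    ∃ A : D.C', ‖(A : H →L[ℂ] H) D.vec - ζ‖ ≤ ε := by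
  obtain ⟨A, hA⟩ := D.dense_range.exists_dist_lt ζ hε
  refine ⟨A, ?_⟩
  rw [dist_comm, dist_eq_norm] at hA
  exact hA.le

theorem norm_vf_one (x : D.X) : ‖D.vf 1 x‖ = 1 := by
  have h : ‖D.vf 1 x‖ ^ 2 = 1 := by
    rw [norm_vf_sq, star_one, one_mul, ψ_one, Complex.one_re]
  exact (pow_eq_one_iff_of_nonneg (norm_nonneg _) two_ne_zero).1 h

theorem integrable_norm_vf_sq (A : D.C') : Integrable (fun x => ‖D.vf A x‖ ^ 2) D.μ :=
  (D.continuous_norm_vf_sq A).integrable_of_hasCompactSupport (.of_compactSpace _)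

/-- Vectors of `H` are realised by sections of the field of the Hilbert spaces `H_{ψ_x}`. -/
theorem exists_vector_sections (ζ : ℕ → H) :
    ∃ (A : ℕ → ℕ → D.C') (v : (n : ℕ) → (x : D.X) → D.fiber x) (W : D.X → ℝ),
      Integrable W D.μ ∧ (∀ x, 0 ≤ W x) ∧
      (∀ n, Tendsto (fun k => (A n k : H →L[ℂ] H) D.vec) atTop (𝓝 (ζ n))) ∧
      ∀ᵐ x ∂D.μ, ∀ n k, ‖D.vf (A n k) x - v n x‖ ≤ 2 * √(W x) * (1 / 2) ^ (n + k) := by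
  choose A hA using fun n k : ℕ =>
    D.exists_norm_sub_le (ζ n) (ε := (1 / 4) ^ (n + k)) (by positivity)
  choose v hv using fun x => exists_limits fun n k => D.vf (A n k) x
  let d : ℕ × ℕ → D.C' := fun q => A q.1 (q.2 + 1) - A q.1 q.2
  have hd : ∀ q : ℕ × ℕ, ‖(d q : H →L[ℂ] H) D.vec‖ ≤ 2 * (1 / 4) ^ (q.1 + q.2) := by
    intro q
    have e : (d q : H →L[ℂ] H) D.vec = ((A q.1 (q.2 + 1) : H →L[ℂ] H) D.vec - ζ q.1)
        - ((A q.1 q.2 : H →L[ℂ] H) D.vec - ζ q.1) := by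
      rw [sub_sub_sub_cancel_right]; rfl
    rw [e]
    refine (norm_sub_le _ _).trans ?_
    have h1 := hA q.1 (q.2 + 1)
    have h2 : ((1 : ℝ) / 4) ^ (q.1 + (q.2 + 1)) ≤ (1 / 4) ^ (q.1 + q.2) :=
      pow_le_pow_of_le_one (by norm_num) (by norm_num) (by omega)
    linarith [hA q.1 q.2]
  -- The increments have norm at most 2·4^-(n+k) in H, so even with weight 4^(n+k) their squared
  -- norms have summable integrals. The sum W then bounds each fibre increment by √W 2^-(n+k).
  let F : ℕ × ℕ → D.X → ℝ := fun q x => 4 ^ (q.1 + q.2) * ‖D.vf (d q) x‖ ^ 2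
  have hF0 : ∀ q x, 0 ≤ F q x := fun q x => by positivity
  have hFi : ∀ q, Integrable (F q) D.μ := fun q => (D.integrable_norm_vf_sq (d q)).const_mul _
  have hFs : Summable fun q => ∫ x, ‖F q x‖ ∂D.μ := by
    refine .of_nonneg_of_le (fun q => integral_nonneg fun x => norm_nonneg _) (fun q => ?_)
      (summable_quarter_pow.mul_left 4)
    simp only [Real.norm_of_nonneg (hF0 _ _)]
    rw [integral_const_mul, integral_norm_vf_sq]
    exact pow_mul_sq_le (norm_nonneg _) (hd q)
  obtain ⟨hsum, hint⟩ := summable_norm_of_summable_integral_norm hFi hFs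
  refine ⟨A, fun n x => v x n, fun x => ∑' q, ‖F q x‖, hint,
    fun x => tsum_nonneg fun q => norm_nonneg _, fun n => ?_, ?_⟩
  · refine tendsto_iff_norm_sub_tendsto_zero.2 (squeeze_zero (fun k => norm_nonneg _) (hA n) ?_)
    refine (tendsto_pow_atTop_nhds_zero_of_lt_one (r := (1 : ℝ) / 4) (by norm_num)
      (by norm_num)).comp (tendsto_atTop_mono (fun k => ?_) tendsto_id)
    exact Nat.le_add_left k n
  · filter_upwards [hsum] with x hx
    refine hv x _ fun n k => ?_
    have h1 : ‖F (n, k) x‖ ≤ ∑' q, ‖F q x‖ := hx.le_tsum (n, k) fun _ _ => norm_nonneg _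
    rw [Real.norm_of_nonneg (hF0 _ _)] at h1
    have h2 := le_sqrt_mul_of_pow_mul_sq_le h1
    exact le_of_eq_of_le (congrArg norm (D.vf_sub (A n (k + 1)) (A n k) x).symm) h2

variable {D}

/-- The identity holds for each vector A_k Ω by `integral_ψ`; dominated convergence over X and norm
convergence in H pass it to the limit. -/
theorem integral_inner_section {A : ℕ → D.C'} {v : (x : D.X) → D.fiber x} {W : D.X → ℝ}
    (hW : Integrable W D.μ) (hW0 : ∀ x, 0 ≤ W x) {ζ : H}
    (hA : Tendsto (fun k => (A k : H →L[ℂ] H) D.vec) atTop (𝓝 ζ))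
    (hv : ∀ᵐ x ∂D.μ, ∀ k, ‖D.vf (A k) x - v x‖ ≤ 2 * √(W x) * (1 / 2) ^ k) (a : D.C') :
    Integrable (fun x => ⟪v x, D.π x a (v x)⟫_ℂ) D.μ ∧
      ∫ x, ⟪v x, D.π x a (v x)⟫_ℂ ∂D.μ = ⟪ζ, (a : H →L[ℂ] H) ζ⟫_ℂ := by
  let F : ℕ → D.X → ℂ := fun k x => D.ψ x (star (A k) * (a * A k))
  have hF : ∀ k x, ⟪D.vf (A k) x, D.π x a (D.vf (A k) x)⟫_ℂ = F k x := fun k x =>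
    D.inner_vf_π _ _ _ x
  let f : D.X → ℂ := fun x => ⟪v x, D.π x a (v x)⟫_ℂ
  have hle : ∀ᵐ x ∂D.μ, ∀ k, ‖F k x‖ ≤ ‖a‖ * (2 * ‖D.vf (A 0) x‖ ^ 2 + 32 * W x) := by
    filter_upwards [hv] with x hx k
    exact (congrArg norm (hF k x)).symm.trans_le
      (norm_inner_apply_le_of_norm_sub_le (D.norm_π_le a x) (hW0 x) hx k)
  have hlim : ∀ᵐ x ∂D.μ, Tendsto (fun k => F k x) atTop (𝓝 (f x)) := by
    filter_upwards [hv] with x hx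
    exact (tendsto_inner_apply hx (D.π x a)).congr fun k => hF k x
  have hbd : Integrable (fun x => ‖a‖ * (2 * ‖D.vf (A 0) x‖ ^ 2 + 32 * W x)) D.μ :=
    (((D.integrable_norm_vf_sq (A 0)).const_mul 2).add (hW.const_mul 32)).const_mul ‖a‖
  obtain ⟨h1, h2⟩ := integrable_and_tendsto_integral_of_dominated
    (fun k => (D.continuous_ψ (star (A k) * (a * A k))).aestronglyMeasurable) hbd hle hlim
  refine ⟨h1, tendsto_nhds_unique h2 ?_⟩
  have h3 : ∀ k, ∫ x, F k x ∂D.μ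
      = ⟪(A k : H →L[ℂ] H) D.vec, (a : H →L[ℂ] H) ((A k : H →L[ℂ] H) D.vec)⟫_ℂ := by
    intro k
    rw [integral_ψ, ← star_inner']
    rfl
  exact (hA.inner (((a : H →L[ℂ] H).continuous.tendsto ζ).comp hA)).congr fun k => (h3 k).symm

end AbelianSystem

/-! ### Construction of the density field, and the equivalence. -/

namespace AbelianSystem

open InnerProductSpace

variable {H : Type u} [NormedAddCommGroup H] [InnerProductSpace ℂ H] [CompleteSpace H]
variable {D : AbelianSystem H}

/-- The two scalar coefficients are only measurable; they are replaced by continuous functions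
converging almost everywhere, and a continuous multiple of an elementary field is elementary. -/
theorem isMeasurableField_normalizedSum {A : ℕ → ℕ → D.C'} {v : ℕ → (x : D.X) → D.fiber x}
    {c : D.X → ℝ} (hv : ∀ᵐ x ∂D.μ, ∀ n k, ‖D.vf (A n k) x - v n x‖ ≤ c x * (1 / 2) ^ (n + k))
    (hs : ∀ᵐ x ∂D.μ, Summable fun n => ‖v n x‖ ^ 2)
    (hm : AEStronglyMeasurable (fun x => ∑' n, ‖v n x‖ ^ 2) D.μ) :
    D.IsMeasurableField fun x => normalizedSum (fun n => v n x) (D.vf 1 x) := by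
  have hinv : AEStronglyMeasurable (fun x => (∑' n, ‖v n x‖ ^ 2)⁻¹) D.μ :=
    hm.aemeasurable.inv.aestronglyMeasurable
  obtain ⟨g, hg⟩ := D.exists_continuous_tendsto hinv
  obtain ⟨h, hh⟩ := D.exists_continuous_tendsto
    ((aestronglyMeasurable_const (b := (1 : ℝ))).sub (hm.mul hinv))
  let g' : ℕ → C(D.X, ℂ) := fun k => ⟨fun x => (g k x : ℂ), by fun_prop⟩
  let h' : ℕ → C(D.X, ℂ) := fun k => ⟨fun x => (h k x : ℂ), by fun_prop⟩
  refine ⟨fun k x => g' k x • (∑ n ∈ Finset.range k, rankOne ℂ (D.vf (A n k) x) (D.vf (A n k) x))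
      + h' k x • rankOne ℂ (D.vf 1 x) (D.vf 1 x), fun k => ?_, ?_⟩
  · exact add_mem_elementaryFields
      (D.smul_mem_elementaryFields (g' k) (D.finset_sum_mem _ fun n => D.rankOne_mem _ _))
      (D.smul_mem_elementaryFields (h' k) (D.rankOne_mem 1 1))
  · filter_upwards [hv, hs, hg, hh] with x hvx hsx hgx hhx
    exact tendsto_normalizedSum hsx (D.vf 1 x) hvx
      ((Complex.continuous_ofReal.tendsto _).comp hgx)
      ((Complex.continuous_ofReal.tendsto _).comp hhx)

/-- The functionals `∑ ⟨ζ n, A ζ n⟩` are integrals of functionals given by density operators. -/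
theorem exists_density_fields (D : AbelianSystem H) {ζ : ℕ → H}
    (hζ : Summable fun n => ‖ζ n‖ ^ 2) (h1 : ∑' n, ‖ζ n‖ ^ 2 = 1) :
    ∃ (T : D.OperatorField) (f : D.X → ℝ), D.IsDensityField T ∧ D.IsDensity f ∧
      ∀ a : D.C', Integrable (fun x => trace (D.π x a * T x) * (f x : ℂ)) D.μ ∧
        ∫ x, trace (D.π x a * T x) * (f x : ℂ) ∂D.μ = ∑' n, ⟪ζ n, (a : H →L[ℂ] H) (ζ n)⟫_ℂ := by
  obtain ⟨A, v, W, hW, hW0, hA, hv⟩ := D.exists_vector_sections ζ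
  have hsec : ∀ n (a : D.C'), Integrable (fun x => ⟪v n x, D.π x a (v n x)⟫_ℂ) D.μ ∧
      ∫ x, ⟪v n x, D.π x a (v n x)⟫_ℂ ∂D.μ = ⟪ζ n, (a : H →L[ℂ] H) (ζ n)⟫_ℂ := by
    intro n a
    refine integral_inner_section hW hW0 (hA n) ?_ a
    filter_upwards [hv] with x hx k
    refine (hx n k).trans (mul_le_mul_of_nonneg_left ?_ (by positivity))
    exact pow_le_pow_of_le_one (by norm_num) (by norm_num) (Nat.le_add_left k n)
  -- Taking a = 1 in `hsec` shows that v_n is square integrable with the same norm as ζ_n.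
  have hsq : ∀ n x, ⟪v n x, D.π x 1 (v n x)⟫_ℂ = ((‖v n x‖ ^ 2 : ℝ) : ℂ) := by
    intro n x
    have e : D.π x 1 (v n x) = v n x := congrArg (fun B => B (v n x)) (map_one (D.π x))
    rw [e, inner_self_eq_norm_sq_to_K]
    simp
  have hvi : ∀ n, Integrable (fun x => ‖v n x‖ ^ 2) D.μ := fun n =>
    (hsec n 1).1.re.congr (Eventually.of_forall fun x => congrArg Complex.re (hsq n x))
  have hvI : ∀ n, ∫ x, ‖v n x‖ ^ 2 ∂D.μ = ‖ζ n‖ ^ 2 := by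
    intro n
    have e := (hsec n 1).2
    rw [integral_congr_ae (Eventually.of_forall (hsq n)), integral_complex_ofReal] at e
    have e2 : ⟪ζ n, ((1 : D.C') : H →L[ℂ] H) (ζ n)⟫_ℂ = ((‖ζ n‖ ^ 2 : ℝ) : ℂ) := by
      change ⟪ζ n, ζ n⟫_ℂ = _
      rw [inner_self_eq_norm_sq_to_K]
      simp
    rw [e2] at e
    exact_mod_cast e
  have hvn : ∀ n x, ‖‖v n x‖ ^ 2‖ = ‖v n x‖ ^ 2 := fun n x => Real.norm_of_nonneg (sq_nonneg _)
  have hvs : Summable fun n => ∫ x, ‖‖v n x‖ ^ 2‖ ∂D.μ := by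
    simp only [hvn, hvI]
    exact hζ
  obtain ⟨hsum, hint⟩ := summable_norm_of_summable_integral_norm hvi hvs
  simp only [hvn] at hsum hint
  have hf1 : ∫ x, ∑' n, ‖v n x‖ ^ 2 ∂D.μ = 1 := by
    rw [← integral_tsum_of_summable_integral_norm hvi hvs]
    simp only [hvI, h1]
  refine ⟨fun x => normalizedSum (fun n => v n x) (D.vf 1 x), fun x => ∑' n, ‖v n x‖ ^ 2,
    ⟨isMeasurableField_normalizedSum hv hsum hint.1, ?_⟩,
    ⟨hint, Eventually.of_forall fun x => tsum_nonneg fun n => sq_nonneg _, hf1⟩, fun a => ?_⟩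
  · filter_upwards [hsum] with x hx
    exact normalizedSum_isDensity hx (D.norm_vf_one x)
  · have hsa : Summable fun n => ∫ x, ‖⟪v n x, D.π x a (v n x)⟫_ℂ‖ ∂D.μ := by
      refine .of_nonneg_of_le (fun n => integral_nonneg fun x => norm_nonneg _) (fun n => ?_)
        (hζ.mul_left ‖a‖)
      rw [← hvI, ← integral_const_mul]
      refine integral_mono (hsec n a).1.norm ((hvi n).const_mul _) fun x => ?_
      exact (norm_inner_apply_le (D.π x a) (v n x)).trans
        (mul_le_mul_of_nonneg_right (D.norm_π_le a x) (sq_nonneg _))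
    have hae : ∀ᵐ x ∂D.μ, ∑' n, ⟪v n x, D.π x a (v n x)⟫_ℂ
        = trace (D.π x a * normalizedSum (fun n => v n x) (D.vf 1 x))
          * ((∑' n, ‖v n x‖ ^ 2 : ℝ) : ℂ) := by
      filter_upwards [hsum] with x hx
      exact (trace_mul_normalizedSum hx (D.vf 1 x) (D.π x a)).symm
    refine ⟨(integrable_tsum_of_summable_integral_norm (fun n => (hsec n a).1) hsa).congr hae, ?_⟩
    refine (integral_congr_ae hae).symm.trans ?_
    rw [← integral_tsum_of_summable_integral_norm (fun n => (hsec n a).1) hsa]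
    exact tsum_congr fun n => (hsec n a).2

/-- A normal state of a von Neumann algebra contained in the commutant has a decomposition. -/
theorem exists_isDecomposition (D : AbelianSystem H) {S : VonNeumannAlgebra H}
    (hS : S.toStarSubalgebra ≤ D.C') {γ : S.toStarSubalgebra →ₗ[ℂ] ℂ} (hγ : IsNormalState S γ) :
    ∃ (T : D.OperatorField) (f : D.X → ℝ), D.IsDensityField T ∧ D.IsDensity f ∧
      D.IsDecomposition hS γ T f := by
  obtain ⟨ζ, hζ, rfl⟩ := exists_eq_sumVecFunctional hγ.1.1 (hγ.2.isOrderContinuous hγ.1.1)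
  have h1 : ∑' n, ‖ζ n‖ ^ 2 = 1 := by
    have h := hasSum_sumVecFunctional (S := S) hζ 1
    rw [hγ.1.2] at h
    have e : ∀ n, vecFunctional S (ζ n) 1 = ((‖ζ n‖ ^ 2 : ℝ) : ℂ) := by
      intro n
      change ⟪ζ n, ζ n⟫_ℂ = _
      rw [inner_self_eq_norm_sq_to_K]
      simp
    have h2 := h.congr_fun fun n => (e n).symm
    have h3 := h2.tsum_eq
    rw [← Complex.ofReal_tsum] at h3
    exact_mod_cast h3
  -- The sum of vector functionals makes sense on the whole commutant; it is decomposed there and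
  -- the formula is restricted to S.
  obtain ⟨T, f, hT, hf, h⟩ := D.exists_density_fields hζ h1
  exact ⟨T, f, hT, hf, fun A => ⟨(h _).1, (h (StarSubalgebra.inclusion hS A)).2.symm⟩⟩

theorem isNormalState_iff (D : AbelianSystem H) {S : VonNeumannAlgebra H}
    (hS : S.toStarSubalgebra ≤ D.C') (γ : S.toStarSubalgebra →ₗ[ℂ] ℂ) :
    IsNormalState S γ ↔ ∃ (T : D.OperatorField) (f : D.X → ℝ),
      D.IsDensityField T ∧ D.IsDensity f ∧ D.IsDecomposition hS γ T f :=
  ⟨D.exists_isDecomposition hS, fun ⟨_, _, hT, hf, h⟩ => h.isNormalState hT hf⟩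

end AbelianSystem

end NormalDecomp

end

theorem theorem2p10 {F : Type*} [CStarAlgebra F] [PartialOrder F] [StarOrderedRing F]
    (ω : F →ₚ[ℂ] ℂ) (hω : ω 1 = 1) (𝒞 : VonNeumannAlgebra ω.GNS)
    (hcomm : ∀ a ∈ 𝒞, ∀ b ∈ 𝒞, a * b = b * a)
    (h𝒞 : ∀ c ∈ 𝒞, ∀ a : F, ω.gnsStarAlgHom a * c = c * ω.gnsStarAlgHom a) :
    (∀ γ : 𝒞.commutant.toStarSubalgebra →ₗ[ℂ] ℂ,
      NormalDecomp.IsNormalState 𝒞.commutant γ ↔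
        ∃ (T : (NormalDecomp.gnsSystem ω hω 𝒞 hcomm h𝒞).OperatorField)
          (f : (NormalDecomp.gnsSystem ω hω 𝒞 hcomm h𝒞).X → ℝ),
          (NormalDecomp.gnsSystem ω hω 𝒞 hcomm h𝒞).IsDensityField T ∧
          (NormalDecomp.gnsSystem ω hω 𝒞 hcomm h𝒞).IsDensity f ∧
          (NormalDecomp.gnsSystem ω hω 𝒞 hcomm h𝒞).IsDecomposition
            (S := 𝒞.commutant) le_rfl γ T f) ∧
    (∀ γ : (NormalDecomp.gnsVN ω).toStarSubalgebra →ₗ[ℂ] ℂ,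
      NormalDecomp.IsNormalState (NormalDecomp.gnsVN ω) γ ↔
        ∃ (T : (NormalDecomp.gnsSystem ω hω 𝒞 hcomm h𝒞).OperatorField)
          (f : (NormalDecomp.gnsSystem ω hω 𝒞 hcomm h𝒞).X → ℝ),
          (NormalDecomp.gnsSystem ω hω 𝒞 hcomm h𝒞).IsDensityField T ∧
          (NormalDecomp.gnsSystem ω hω 𝒞 hcomm h𝒞).IsDensity f ∧
          (NormalDecomp.gnsSystem ω hω 𝒞 hcomm h𝒞).IsDecomposition
            (NormalDecomp.gnsVN_le ω hω 𝒞 hcomm h𝒞) γ T f) :=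
  ⟨fun γ => (NormalDecomp.gnsSystem ω hω 𝒞 hcomm h𝒞).isNormalState_iff (S := 𝒞.commutant) le_rfl γ,
    fun γ => (NormalDecomp.gnsSystem ω hω 𝒞 hcomm h𝒞).isNormalState_iff
      (NormalDecomp.gnsVN_le ω hω 𝒞 hcomm h𝒞) γ⟩
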